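/- Let $p>2$ be a prime, $k$ a perfect field of characteristic $p$, $\sigma$ the Frobenius of $W(k)$, $K$ a finite totally ramified extension of $W(k)[1/p]$ and $\pi_0$ a uniformizer of $\mathcal O_K$. Let $E\in\mathfrak S:=W(k)[\![u]\!]$ be the minimal polynomial of $\pi_0$ over $W(k)$, rescaled by a unit of $W(k)$ so that its constant term is $p$. Let $r$ be an integer with $0\le r<p-1$. *Rings.* For $n\ge 0$ let $\mathfrak S_n:=W(k)[\![u_n]\!]$, with the Frobenius $\varphi$ that is $\sigma$ on $W(k)$ and satisfies $\varphi(u_n)=u_n^p$. View $\mathfrak S_n$ as a $W(k)$-subalgebra of $\mathfrak S_{n+1}$ by $u_n=u_{n+1}^p$, with $\mathfrak S_0=\mathfrak S$, $u_0=u$; then $\varphi:\mathfrak S_{n+1}\to\mathfrak S_n$ is an isomorphism. Let $S_n$ be the $p$-adic completion of the divided power envelope $\mathfrak S_n[E^i/i!\,:\,i\ge 1]\subset\mathfrak S_n[1/p]$ of $\mathfrak S_n$ with respect to the ideal $(E)$, with the induced Frobenius $\varphi$ and inclusions $S_n\subset S_{n+1}$. Put $S:=S_0$, let $\mathrm{Fil}^m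 S$ be the $p$-adic closure of the ideal of $S$ generated by the $E^i/i!$ with $i\ge m$, and let $c_0:=\varphi(E)/p\in S^\times$. Put $z_n:=E\,\varphi^{-1}(E)\cdots\varphi^{1-n}(E)\in\mathfrak S_n$, $z_0:=1$, and filter $S_n[z_n^{-1}]$ by $\mathrm{Fil}^a=z_n^aS_n$, $a\in\mathbf Z$. *Categories.* $\mathrm{Mod}_{\mathfrak S}^{\varphi,r}$ (height-$r$ filtered Breuil–Kisin modules) has as objects the triples $(M,\mathrm{Fil}^rM,\varphi_{M,r})$ where $M$ is a finite free $\mathfrak S$-module, $\mathrm{Fil}^rM\supseteq E^rM$ is a submodule with $M/\mathrm{Fil}^rM$ $p$-torsion free, and $\varphi_{M,r}:\mathrm{Fil}^rM\to M$ is a $\varphi$-semilinear map whose image generates $M$; put $\varphi_M(m):=\varphi_{M,r}(E^rm)$. $\mathrm{Mod}_S^{\varphi,r}$ (height-$r$ quasi-Breuil modules) has as objects the triples $(\mathscr M,\mathrm{Fil}^r\mathscr M,\varphi_{\mathscr M,r})$ where $\mathscr M$ is a finite free $S$-module, $\mathrm{Fil}^r\mathscr M\supseteq(\mathrm{Fil}^rS)\mathscr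 M$ is a submodule with $\mathscr M/\mathrm{Fil}^r\mathscr M$ $p$-torsion free, and $\varphi_{\mathscr M,r}:\mathrm{Fil}^r\mathscr M\to\mathscr M$ is a $\varphi$-semilinear map whose image generates $\mathscr M$; put $\varphi_{\mathscr M}(m):=c_0^{-r}\varphi_{\mathscr M,r}(E^rm)$, $\mathrm{Fil}^i\mathscr M:=\{m: E^{r-i}m\in\mathrm{Fil}^r\mathscr M\}$ for $i\le r$ and $\mathrm{Fil}^i\mathscr M:=0$ for $i>r$. In both categories morphisms are the linear maps compatible with $\mathrm{Fil}^r$ and with the maps $\varphi_{\cdot,r}$. *Base change.* $\underline{\mathscr M}(M):=(S\otimes_{\mathfrak S}M,\ \mathrm{Fil}^r,\ p^{-r}(\varphi\otimes\varphi_M))$, where $\mathrm{Fil}^r$ is the submodule generated by the images of $S\otimes\mathrm{Fil}^rM$ and $\mathrm{Fil}^rS\otimes M$. *The construction $\underline M$.* For $\mathscr M$ in $\mathrm{Mod}_S^{\varphi,r}$ equip $\mathscr M\otimes_SS_n[z_n^{-1}]$ with the tensor product filtration $\mathrm{Fil}^j=\sum_{a+b=j}\mathrm{Fil}^b\mathscr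 M\otimes z_n^aS_n$ and put $$\underline M(\mathscr M):=\varprojlim_{\varphi,n}\mathrm{Fil}^0(\mathscr M\otimes_SS_n[z_n^{-1}])=\{(\xi_n)_{n\ge0}:\ \xi_n\in\mathrm{Fil}^0(\mathscr M\otimes_SS_n[z_n^{-1}]),\ (\varphi_{\mathscr M}\otimes\varphi)(\xi_{n+1})=\xi_n\ \text{for all } n\ge 0\},$$ with the $\mathfrak S$-module structure $g\cdot(\xi_n)_n=(g^{\sigma^{-n}}(u_n)\,\xi_n)_n$, the submodule $\mathrm{Fil}^r\underline M(\mathscr M)=\{(\xi_n):\xi_0\in\mathrm{Fil}^r\mathscr M\}$ and the Frobenius $\varphi_{\underline M}((\xi_n)_n)=((\varphi_{\mathscr M}\otimes\varphi)(\xi_n))_n$. **Theorem.** (1) For every $M$ in $\mathrm{Mod}_{\mathfrak S}^{\varphi,r}$, $\underline{\mathscr M}(M)$ is a well-defined object of $\mathrm{Mod}_S^{\varphi,r}$, so that $\underline{\mathscr M}$ is a functor $\mathrm{Mod}_{\mathfrak S}^{\varphi,r}\to\mathrm{Mod}_S^{\varphi,r}$. (2) For every $\mathscr M$ in $\mathrm{Mod}_S^{\varphi,r}$,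 the $\mathfrak S$-module $\underline M(\mathscr M)$ is finite and free, $\varphi_{\underline M}$ is uniquely divisible by $\varphi(E)^r$ on $\mathrm{Fil}^r\underline M(\mathscr M)$, and $(\underline M(\mathscr M),\mathrm{Fil}^r\underline M(\mathscr M),\varphi(E)^{-r}\varphi_{\underline M})$ is an object of $\mathrm{Mod}_{\mathfrak S}^{\varphi,r}$; thus $\underline M$ is a covariant functor $\mathrm{Mod}_S^{\varphi,r}\to\mathrm{Mod}_{\mathfrak S}^{\varphi,r}$. (3) $\underline M$ is a quasi-inverse of $\underline{\mathscr M}$: there are isomorphisms of functors $\underline M\circ\underline{\mathscr M}\simeq\mathrm{id}$ and $\underline{\mathscr M}\circ\underline M\simeq\mathrm{id}$. -/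

import Mathlib

open CategoryTheory

set_option linter.unusedSectionVars false
set_option linter.unusedVariables false

namespace BreuilKisin

open scoped TensorProduct

universe u v

/-! ### `p`-adic completion of rings -/

section Completion

variable (p : ℕ) {A B C : Type*} [CommRing A] [CommRing B] [CommRing C]

/-- The `p`-adic completion of a commutative ring. -/
abbrev PCompletion (A : Type*) [CommRing A] : Type _ :=
  AdicCompletion (Ideal.span {(p : A)}) A

lemma span_pow_le_comap (f : A →+* B) (N : ℕ) :
    Ideal.span {(p : A)} ^ N ≤ (Ideal.span {(p : B)} ^ N).comap f := by
  rw [← Ideal.map_le_iff_le_comap, Ideal.map_pow, Ideal.map_span]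
  simp

lemma completionMap_compat (f : A →+* B) {m n : ℕ} (hle : m ≤ n) :
    (Ideal.Quotient.factorPow (Ideal.span {(p : B)}) hle).comp
      ((Ideal.quotientMap (Ideal.span {(p : B)} ^ n) f (span_pow_le_comap p f n)).comp
        (AdicCompletion.evalₐ (Ideal.span {(p : A)}) n : PCompletion p A →+* _)) =
      (Ideal.quotientMap (Ideal.span {(p : B)} ^ m) f (span_pow_le_comap p f m)).comp
        (AdicCompletion.evalₐ (Ideal.span {(p : A)}) m : PCompletion p A →+* _) := by
  ext x
  obtain ⟨y, hy⟩ := Ideal.Quotient.mk_surjective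
    (AdicCompletion.evalₐ (Ideal.span {(p : A)}) n x)
  have h2 : AdicCompletion.evalₐ (Ideal.span {(p : A)}) m x = Ideal.Quotient.mk _ y := by
    obtain ⟨x, rfl⟩ := AdicCompletion.mk_surjective _ _ x
    rw [AdicCompletion.evalₐ_mk] at hy ⊢
    have h3 := congrArg (Ideal.Quotient.factorPow (Ideal.span {(p : A)}) hle) hy
    have h4 := AdicCompletion.Ideal.mk_eq_mk (Ideal.span {(p : A)}) hle x
    refine h4.symm.trans ?_
    simpa using h3.symm
  simp [h2, ← hy]

/-- The map induced on `p`-adic completions by a ring homomorphism. -/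
noncomputable def completionMap (f : A →+* B) : PCompletion p A →+* PCompletion p B :=
  AdicCompletion.liftRingHom (Ideal.span {(p : B)})
    (fun N => (Ideal.quotientMap (Ideal.span {(p : B)} ^ N) f (span_pow_le_comap p f N)).comp
      (AdicCompletion.evalₐ (Ideal.span {(p : A)}) N : PCompletion p A →+* _))
    (completionMap_compat p f)

lemma evalₐ_completionMap (f : A →+* B) (N : ℕ) (x : PCompletion p A) :
    AdicCompletion.evalₐ (Ideal.span {(p : B)}) N (completionMap p f x) =
      Ideal.quotientMap (Ideal.span {(p : B)} ^ N) f (span_pow_le_comap p f N)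
        (AdicCompletion.evalₐ (Ideal.span {(p : A)}) N x) :=
  AdicCompletion.evalₐ_liftRingHom _ _ (completionMap_compat p f) N x

lemma completionMap_comp (g : B →+* C) (f : A →+* B) :
    (completionMap p g).comp (completionMap p f) = completionMap p (g.comp f) := by
  ext1 x
  apply AdicCompletion.ext_evalₐ; intro N
  rw [RingHom.comp_apply, evalₐ_completionMap, evalₐ_completionMap, evalₐ_completionMap]
  obtain ⟨y, hy⟩ := Ideal.Quotient.mk_surjective
    (AdicCompletion.evalₐ (Ideal.span {(p : A)}) N x)
  simp [← hy]

lemma completionMap_algebraMap (f : A →+* B) (a : A) :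
    completionMap p f (algebraMap A (PCompletion p A) a) = algebraMap B (PCompletion p B) (f a) := by
  apply AdicCompletion.ext_evalₐ; intro N
  rw [evalₐ_completionMap, AlgHom.commutes, AlgHom.commutes]
  simp

end Completion

/-! ### The rings `𝔖_n` and `S_n` -/

section Rings

variable (p : ℕ) [Fact p.Prime]

/-- The ring endomorphism `f(X) ↦ f(X ^ p)` of `R⟦X⟧`. -/
noncomputable def expandHom (R : Type*) [CommRing R] : PowerSeries R →+* PowerSeries R :=
  (PowerSeries.expand (R := R) p (Fact.out : p.Prime).ne_zero).toRingHom

lemma coeff_expandHom {R : Type*} [CommRing R] (f : PowerSeries R) (n : ℕ) :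
    PowerSeries.coeff n (expandHom p R f) = if p ∣ n then PowerSeries.coeff (n / p) f else 0 :=
  PowerSeries.coeff_expand p _ f

lemma map_expandHom {R R' : Type*} [CommRing R] [CommRing R'] (h : R →+* R') (f : PowerSeries R) :
    PowerSeries.map h (expandHom p R f) = expandHom p R' (PowerSeries.map h f) :=
  PowerSeries.map_expand p _ h f

variable (k : Type u) [Field k] [CharP k p] [PerfectRing k p]

/-- The fraction field `W(k)[1/p]` of `W(k)`. -/
abbrev WittFrac : Type u := FractionRing (WittVector p k)

/-- The ring `W(k)⟦u⟧`. For every `n` the ring `𝔖_n = W(k)⟦u_n⟧` is modelled by this type, with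
`PowerSeries.X` in the role of the variable `u_n`. -/
abbrev BKRing : Type u := PowerSeries (WittVector p k)

/-- The Frobenius of `𝔖_n`: it is `σ` on `W(k)` and sends `u_n` to `u_n ^ p`. -/
noncomputable def frobBK : BKRing p k →+* BKRing p k :=
  (expandHom p (WittVector p k)).comp
    (PowerSeries.map (WittVector.frobenius (p := p) (R := k)))

/-- The `W(k)`-linear inclusion `𝔖_n → 𝔖_{n+1}`, which sends `u_n` to `u_{n+1} ^ p`. -/
noncomputable def inclBK : BKRing p k →+* BKRing p k :=
  expandHom p (WittVector p k)

/-- The iterate `σ^{-n}` of the inverse of the Frobenius automorphism `σ` of `W(k)`. -/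
noncomputable def sigmaInv (n : ℕ) : WittVector p k →+* WittVector p k :=
  ((WittVector.frobeniusEquiv p k).symm : WittVector p k →+* WittVector p k) ^ n

/-- The map `𝔖 → 𝔖_n`, `g ↦ g^{σ^{-n}}(u_n)`, that is, the map `φ^{-n}`. -/
noncomputable def twistBK (n : ℕ) : BKRing p k →+* BKRing p k :=
  PowerSeries.map (sigmaInv p k n)

/-- The Frobenius of `W(k)[1/p]⟦u_n⟧`, extending the one of `𝔖_n`. -/
noncomputable def frobFrac : PowerSeries (WittFrac p k) →+* PowerSeries (WittFrac p k) :=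
  (expandHom p (WittFrac p k)).comp
    (PowerSeries.map (WittVector.FractionRing.frobeniusRingHom p k))

/-- The inclusion `W(k)[1/p]⟦u_n⟧ → W(k)[1/p]⟦u_{n+1}⟧`, sending `u_n` to `u_{n+1} ^ p`. -/
noncomputable def inclFrac : PowerSeries (WittFrac p k) →+* PowerSeries (WittFrac p k) :=
  expandHom p (WittFrac p k)

/-- Polynomials over `W(k)` with constant term `p`. -/
structure NormalizedPoly where
  /-- The underlying polynomial. -/
  poly : Polynomial (WittVector p k)
  coeff_zero : poly.coeff 0 = (p : WittVector p k)

variable {p k}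

lemma frobFrac_algebraMap (g : BKRing p k) :
    frobFrac p k (algebraMap (BKRing p k) (PowerSeries (WittFrac p k)) g) =
      algebraMap (BKRing p k) (PowerSeries (WittFrac p k)) (frobBK p k g) := by
  have h : ∀ a : WittVector p k, WittVector.FractionRing.frobeniusRingHom p k
      (algebraMap (WittVector p k) (WittFrac p k) a) =
        algebraMap (WittVector p k) (WittFrac p k) (WittVector.frobenius a) := fun a =>
    IsFractionRing.ringEquivOfRingEquiv_algebraMap (WittVector.frobeniusEquiv p k) a
  have h2 : (algebraMap (BKRing p k) (PowerSeries (WittFrac p k))) =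
    PowerSeries.map (algebraMap (WittVector p k) (WittFrac p k)) := rfl
  rw [h2]
  ext n : 1
  simp only [frobFrac, frobBK, RingHom.comp_apply, coeff_expandHom,
    PowerSeries.coeff_map]
  split_ifs <;> simp [h]

lemma inclFrac_algebraMap (g : BKRing p k) :
    inclFrac p k (algebraMap (BKRing p k) (PowerSeries (WittFrac p k)) g) =
      algebraMap (BKRing p k) (PowerSeries (WittFrac p k)) (inclBK p k g) := by
  have h2 : (algebraMap (BKRing p k) (PowerSeries (WittFrac p k))) =
    PowerSeries.map (algebraMap (WittVector p k) (WittFrac p k)) := rfl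
  rw [h2]
  exact (map_expandHom p _ g).symm

lemma frobFrac_inclFrac (x : PowerSeries (WittFrac p k)) :
    frobFrac p k (inclFrac p k x) = inclFrac p k (frobFrac p k x) := by
  simp [frobFrac, inclFrac, map_expandHom]

lemma frobBK_inclBK (x : BKRing p k) :
    frobBK p k (inclBK p k x) = inclBK p k (frobBK p k x) := by
  simp [frobBK, inclBK, map_expandHom]

lemma sigmaInv_frobenius (n : ℕ) (a : WittVector p k) :
    sigmaInv p k n (WittVector.frobenius a) = WittVector.frobenius (sigmaInv p k n a) := by
  induction n generalizing a with
  | zero => simp [sigmaInv]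
  | succ n ih =>
    have h : ∀ b, sigmaInv p k (n + 1) b =
        sigmaInv p k n ((WittVector.frobeniusEquiv p k).symm b) := fun b => by
      simp [sigmaInv, pow_succ]
    rw [h, h, ← ih]
    congr 1
    exact ((WittVector.frobeniusEquiv p k).symm_apply_apply a).trans
      ((WittVector.frobeniusEquiv p k).apply_symm_apply a).symm

lemma frobenius_sigmaInv_succ (n : ℕ) (a : WittVector p k) :
    WittVector.frobenius (sigmaInv p k (n + 1) a) = sigmaInv p k n a := by
  have h : sigmaInv p k (n + 1) a =
      sigmaInv p k n ((WittVector.frobeniusEquiv p k).symm a) := by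
    simp [sigmaInv, pow_succ]
  rw [h, ← sigmaInv_frobenius]
  congr 1
  exact (WittVector.frobeniusEquiv p k).apply_symm_apply a

lemma frobBK_twistBK (n : ℕ) (g : BKRing p k) :
    frobBK p k (twistBK p k n g) = twistBK p k n (frobBK p k g) := by
  ext i : 1
  simp only [frobBK, twistBK, RingHom.comp_apply, coeff_expandHom,
    PowerSeries.coeff_map]
  split_ifs <;> simp [sigmaInv_frobenius]

lemma frobBK_twistBK_succ (n : ℕ) (g : BKRing p k) :
    frobBK p k (twistBK p k (n + 1) g) = inclBK p k (twistBK p k n g) := by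
  ext i : 1
  simp only [frobBK, inclBK, twistBK, RingHom.comp_apply, coeff_expandHom, PowerSeries.coeff_map]
  split_ifs <;> simp [frobenius_sigmaInv_succ]

/-- The Frobenius of `𝔖_n` lifts the `p`-th power map modulo `p`. -/
lemma exists_frobBK_eq (g : BKRing p k) : ∃ h, frobBK p k g = g ^ p + (p : BKRing p k) * h := by
  have key : PowerSeries.map (WittVector.constantCoeff (p := p) (R := k)) (frobBK p k g - g ^ p)
      = 0 := by
    have h := MvPowerSeries.map_frobenius_expand (R := k) p (Fact.out : p.Prime).ne_zero
      (f := PowerSeries.map (WittVector.constantCoeff (p := p) (R := k)) g)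
    rw [map_sub, map_pow, sub_eq_zero]
    refine Eq.trans ?_ h
    change _ = PowerSeries.map (frobenius k p) (expandHom p k _)
    ext i : 1
    simp only [frobBK, RingHom.comp_apply, coeff_expandHom,
      PowerSeries.coeff_map]
    split_ifs
    · simp [WittVector.constantCoeff, frobenius_def, WittVector.coeff_frobenius_charP]
    · simp
  have h2 : ∀ i, ∃ c : WittVector p k,
      PowerSeries.coeff i (frobBK p k g - g ^ p) = (p : WittVector p k) * c := by
    intro i
    have := congrArg (PowerSeries.coeff i) key
    rw [PowerSeries.coeff_map, map_zero] at this
    have h3 : PowerSeries.coeff i (frobBK p k g - g ^ p) ∈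
        RingHom.ker (WittVector.constantCoeff (p := p) (R := k)) := this
    rw [WittVector.ker_constantCoeff] at h3
    exact Ideal.mem_span_singleton.mp h3
  choose c hc using h2
  refine ⟨PowerSeries.mk c, ?_⟩
  rw [← sub_eq_iff_eq_add']
  ext i : 1
  have h4 : (p : BKRing p k) = PowerSeries.C (p : WittVector p k) := by simp
  rw [hc, h4, PowerSeries.coeff_C_mul, PowerSeries.coeff_mk]

end Rings

section PDEnvelope

variable {p : ℕ} [Fact p.Prime] {k : Type u} [Field k] [CharP k p] [PerfectRing k p]

namespace NormalizedPoly

variable (E : NormalizedPoly p k)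

/-- The polynomial `E`, viewed as an element of `𝔖 = W(k)⟦u⟧`. -/
noncomputable def ser : BKRing p k := (E.poly : PowerSeries (WittVector p k))

/-- The element `E = E(u_0)` of `𝔖`, viewed in `𝔖_n` through `𝔖 ⊆ 𝔖_1 ⊆ ⋯ ⊆ 𝔖_n`. -/
noncomputable def elt (n : ℕ) : BKRing p k := (inclBK p k)^[n] E.ser

/-- The element `z_n = E φ⁻¹(E) ⋯ φ^{1-n}(E)` of `𝔖_n`; here `φ^{-i}(E)` lies in `𝔖_i`, and is
viewed in `𝔖_n` through the inclusions `𝔖_i ⊆ ⋯ ⊆ 𝔖_n`. -/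
noncomputable def z (n : ℕ) : BKRing p k :=
  ∏ i ∈ Finset.range n, (inclBK p k)^[n - i] (twistBK p k i E.ser)

lemma z_zero : E.z 0 = 1 := by simp [z]

lemma inclBK_elt (n : ℕ) : inclBK p k (E.elt n) = E.elt (n + 1) :=
  (Function.iterate_succ_apply' _ _ _).symm

lemma z_succ (n : ℕ) : E.z (n + 1) = inclBK p k (E.z n * twistBK p k n E.ser) := by
  rw [z, Finset.prod_range_succ, map_mul, z, map_prod]
  congr 1
  · refine Finset.prod_congr rfl fun i hi => ?_
    have : n + 1 - i = (n - i) + 1 := by have := Finset.mem_range.mp hi; omega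
    rw [this, Function.iterate_succ_apply']
  · simp

lemma frobBK_iterate_inclBK (n : ℕ) (x : BKRing p k) :
    frobBK p k ((inclBK p k)^[n] x) = (inclBK p k)^[n] (frobBK p k x) := by
  induction n with
  | zero => rfl
  | succ n ih => rw [Function.iterate_succ_apply', Function.iterate_succ_apply', frobBK_inclBK, ih]

lemma frobBK_z (n : ℕ) :
    frobBK p k (E.z (n + 1)) = frobBK p k (E.elt (n + 1)) * inclBK p k (E.z n) := by
  rw [z, map_prod, Finset.prod_range_succ', z, map_prod, mul_comm]
  congr 1
  · refine Finset.prod_congr rfl fun i hi => ?_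
    rw [frobBK_iterate_inclBK, frobBK_twistBK_succ, ← Function.iterate_succ_apply,
      ← Function.iterate_succ_apply' (inclBK p k)]
    congr 1
    have := Finset.mem_range.mp hi
    omega

lemma elt_dvd_z (n : ℕ) : E.elt (n + 1) ∣ E.z (n + 1) := by
  have h : twistBK p k 0 E.ser = E.ser := by
    ext i : 1
    simp [twistBK, sigmaInv]
  have := Finset.dvd_prod_of_mem (fun i => (inclBK p k)^[n + 1 - i] (twistBK p k i E.ser))
    (Finset.mem_range.mpr (Nat.succ_pos n))
  simpa [h, elt, z] using this

lemma constantCoeff_elt (n : ℕ) : PowerSeries.constantCoeff (E.elt n) = (p : WittVector p k) := by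
  induction n with
  | zero =>
    simp only [elt, ser, Function.iterate_zero, id]
    rw [← PowerSeries.coeff_zero_eq_constantCoeff_apply, Polynomial.coeff_coe, E.coeff_zero]
  | succ n ih =>
    rw [← E.inclBK_elt, ← ih, ← PowerSeries.coeff_zero_eq_constantCoeff_apply,
      ← PowerSeries.coeff_zero_eq_constantCoeff_apply]
    simp [inclBK, coeff_expandHom]

/-- The divided power `E ^ i / i!` in `W(k)[1/p]⟦u_n⟧`. -/
noncomputable def divPow (n i : ℕ) : PowerSeries (WittFrac p k) :=
  ((i.factorial : WittFrac p k)⁻¹) •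
    (algebraMap (BKRing p k) (PowerSeries (WittFrac p k)) (E.elt n)) ^ i

/-- The divided power envelope of `𝔖_n` with respect to the ideal generated by `E = E(u_0)` (the
kernel of `θ_n : 𝔖_n → 𝒪_{K_n}`): since `E` is a nonzerodivisor in the `p`-torsion free ring `𝔖_n`,
and remains one modulo `p`, it is the subring `𝔖_n[E ^ i / i! : i ≥ 0]` of `𝔖_n[1/p]`, which
is realised here inside `W(k)[1/p]⟦u_n⟧`. -/
noncomputable def PDEnv (n : ℕ) : Subalgebra (BKRing p k) (PowerSeries (WittFrac p k)) :=
  Algebra.adjoin (BKRing p k) (Set.range (E.divPow n))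

/-- The divided power `E ^ i / i!` as an element of the divided power envelope. -/
noncomputable def gammaD (n i : ℕ) : E.PDEnv n :=
  ⟨E.divPow n i, Algebra.subset_adjoin ⟨i, rfl⟩⟩

lemma charZero_witt : CharZero (WittVector p k) := by
  refine charZero_of_inj_zero fun n hn => ?_
  by_contra h0
  obtain ⟨v, m, hm, hn'⟩ := Nat.exists_eq_pow_mul_and_not_dvd h0 p (Fact.out : p.Prime).ne_one
  rw [hn'] at hn
  push_cast at hn
  rcases mul_eq_zero.mp hn with h | h
  · exact pow_ne_zero _ (WittVector.p_nonzero p k) h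
  · have := congrArg WittVector.constantCoeff h
    rw [map_natCast, map_zero] at this
    exact hm ((CharP.cast_eq_zero_iff k p m).mp this)

lemma charZero_frac : CharZero (WittFrac p k) :=
  have := charZero_witt (p := p) (k := k)
  charZero_of_injective_algebraMap (IsFractionRing.injective (WittVector p k) (WittFrac p k))

lemma factorial_ne_zero (i : ℕ) : (i.factorial : WittFrac p k) ≠ 0 := by
  have := charZero_frac (p := p) (k := k)
  exact_mod_cast i.factorial_ne_zero

lemma factorial_mul_divPow (n i : ℕ) :
    (i.factorial : PowerSeries (WittFrac p k)) * E.divPow n i =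
      (algebraMap (BKRing p k) (PowerSeries (WittFrac p k)) (E.elt n)) ^ i := by
  rw [divPow, ← nsmul_eq_mul, ← Nat.cast_smul_eq_nsmul (WittFrac p k), smul_smul,
    mul_inv_cancel₀ (factorial_ne_zero i), one_smul]

lemma factorial_cancel (i : ℕ) {x y : PowerSeries (WittFrac p k)}
    (h : (i.factorial : PowerSeries (WittFrac p k)) * x = i.factorial * y) : x = y := by
  rw [← nsmul_eq_mul, ← nsmul_eq_mul, ← Nat.cast_smul_eq_nsmul (WittFrac p k),
    ← Nat.cast_smul_eq_nsmul (WittFrac p k)] at h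
  have h2 := congrArg (fun w => ((i.factorial : WittFrac p k)⁻¹) • w) h
  simpa [smul_smul, inv_mul_cancel₀ (factorial_ne_zero (p := p) (k := k) i)] using h2

/-- `i!` divides `p ^ i` in `W(k)`. -/
lemma exists_factorial_mul (i : ℕ) :
    ∃ a : WittVector p k, (i.factorial : WittVector p k) * a = (p : WittVector p k) ^ i := by
  obtain ⟨m, hm⟩ : p ^ padicValNat p i.factorial ∣ i.factorial := pow_padicValNat_dvd
  have hv : padicValNat p i.factorial ≤ i := by
    have h := sub_one_mul_padicValNat_factorial (p := p) i
    have h1 : 1 ≤ p - 1 := by have := (Fact.out : p.Prime).two_le; omega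
    nlinarith [Nat.sub_le i (p.digits i).sum]
  have hmp : ¬ p ∣ m := by
    rintro ⟨c, rfl⟩
    have : p ^ (padicValNat p i.factorial + 1) ∣ i.factorial := ⟨c, by rw [pow_succ, mul_assoc]; exact hm⟩
    exact pow_succ_padicValNat_not_dvd i.factorial_ne_zero this
  have hu : IsUnit (m : WittVector p k) := by
    apply WittVector.isUnit_of_coeff_zero_ne_zero
    intro h
    have h2 : WittVector.constantCoeff (m : WittVector p k) = 0 := h
    rw [map_natCast] at h2
    exact hmp ((CharP.cast_eq_zero_iff k p m).mp h2)
  obtain ⟨w, hw⟩ := hu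
  refine ⟨(p : WittVector p k) ^ (i - padicValNat p i.factorial) * ↑w⁻¹, ?_⟩
  have : (i.factorial : WittVector p k) = (p : WittVector p k) ^ (padicValNat p i.factorial) * w := by
    rw [hw]; exact_mod_cast congrArg (Nat.cast (R := WittVector p k)) hm
  rw [this]
  calc _ = (p : WittVector p k) ^ (padicValNat p i.factorial) *
        p ^ (i - padicValNat p i.factorial) * (w * ↑w⁻¹) := by ring
    _ = _ := by rw [← pow_add, Nat.add_sub_cancel' hv]; simp

/-- The element `φ(E) / p` of the divided power envelope. -/
lemma exists_cD (n : ℕ) : ∃ c : E.PDEnv n,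
    (p : E.PDEnv n) * c = algebraMap (BKRing p k) (E.PDEnv n) (frobBK p k (E.elt n)) ∧
    ∃ h : BKRing p k, IsUnit h ∧ c = algebraMap (BKRing p k) (E.PDEnv n) h +
      ((p - 1).factorial : E.PDEnv n) * E.gammaD n p := by
  obtain ⟨h, hh⟩ := exists_frobBK_eq (E.elt n)
  refine ⟨algebraMap (BKRing p k) (E.PDEnv n) h +
    ((p - 1).factorial : E.PDEnv n) * E.gammaD n p, ?_, h, ?_, rfl⟩
  · apply Subtype.ext
    have hf : (p.factorial : PowerSeries (WittFrac p k)) = p * ((p - 1).factorial : ℕ) := by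
      rw [← Nat.mul_factorial_pred (Fact.out : p.Prime).ne_zero]; push_cast; ring
    have h2 := E.factorial_mul_divPow n p
    have hg : (E.gammaD n p : PowerSeries (WittFrac p k)) = E.divPow n p := rfl
    rw [hh]
    push_cast
    rw [hg, ← h2, hf]
    ring
  · rw [PowerSeries.isUnit_iff_constantCoeff]
    have h3 := congrArg PowerSeries.constantCoeff hh
    have h4 : PowerSeries.constantCoeff (frobBK p k (E.elt n)) = (p : WittVector p k) := by
      rw [← PowerSeries.coeff_zero_eq_constantCoeff_apply]
      simp [frobBK, coeff_expandHom, constantCoeff_elt]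
    rw [h4, map_add, map_mul, map_pow, constantCoeff_elt, map_natCast] at h3
    have hp := (Fact.out : p.Prime).two_le
    have h5 : PowerSeries.constantCoeff h = 1 - (p : WittVector p k) ^ (p - 1) := by
      apply mul_left_cancel₀ (WittVector.p_nonzero p k)
      rw [mul_sub, ← pow_succ', Nat.sub_add_cancel (by omega), mul_one]
      linear_combination -h3
    rw [h5]
    apply WittVector.isUnit_of_coeff_zero_ne_zero
    intro h6
    have h7 : WittVector.constantCoeff (1 - (p : WittVector p k) ^ (p - 1)) = 0 := h6
    rw [map_sub, map_one, map_pow, map_natCast, CharP.cast_eq_zero, zero_pow (by omega)] at h7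
    simp at h7

/-- The element `φ(E) / p` of the divided power envelope. -/
noncomputable def cD (n : ℕ) : E.PDEnv n := (E.exists_cD n).choose

lemma p_mul_cD (n : ℕ) : (p : E.PDEnv n) * E.cD n =
    algebraMap (BKRing p k) (E.PDEnv n) (frobBK p k (E.elt n)) :=
  (E.exists_cD n).choose_spec.1

lemma frobFrac_mem (n : ℕ) (x : PowerSeries (WittFrac p k)) (hx : x ∈ E.PDEnv n) :
    frobFrac p k x ∈ E.PDEnv n := by
  induction hx using Algebra.adjoin_induction with
  | mem x hx =>
    obtain ⟨i, rfl⟩ := hx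
    obtain ⟨a, ha⟩ := exists_factorial_mul (p := p) (k := k) i
    have h : frobFrac p k (E.divPow n i) =
        (algebraMap (BKRing p k) (E.PDEnv n) (PowerSeries.C a) * E.cD n ^ i : E.PDEnv n) := by
      apply factorial_cancel i
      rw [← map_natCast (frobFrac p k), ← map_mul, factorial_mul_divPow, map_pow,
        frobFrac_algebraMap]
      have h2 : (algebraMap (BKRing p k) (PowerSeries (WittFrac p k)) (frobBK p k (E.elt n))) =
          p * (E.cD n : PowerSeries (WittFrac p k)) := by
        have := congrArg (Subtype.val) (E.p_mul_cD n)
        push_cast at this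
        exact this.symm
      have h3 : (i.factorial : BKRing p k) * PowerSeries.C a = (p : BKRing p k) ^ i := by
        rw [← map_natCast (PowerSeries.C (R := WittVector p k)), ← map_mul, ha]
        simp
      have h4 := congrArg (algebraMap (BKRing p k) (PowerSeries (WittFrac p k))) h3
      rw [map_mul, map_natCast, map_pow, map_natCast] at h4
      rw [h2, mul_pow, ← h4, map_natCast]
      push_cast
      ring
    rw [h]
    exact Subtype.property _
  | algebraMap r => rw [frobFrac_algebraMap]; exact Subalgebra.algebraMap_mem _ _
  | add x y _ _ hx hy => rw [map_add]; exact add_mem hx hy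
  | mul x y _ _ hx hy => rw [map_mul]; exact mul_mem hx hy

lemma inclFrac_mem (n : ℕ) (x : PowerSeries (WittFrac p k)) (hx : x ∈ E.PDEnv n) :
    inclFrac p k x ∈ E.PDEnv (n + 1) := by
  induction hx using Algebra.adjoin_induction with
  | mem x hx =>
    obtain ⟨i, rfl⟩ := hx
    refine Algebra.subset_adjoin ⟨i, ?_⟩
    apply factorial_cancel i
    rw [factorial_mul_divPow, ← map_natCast (inclFrac p k), ← map_mul, factorial_mul_divPow,
      map_pow, inclFrac_algebraMap, inclBK_elt]
  | algebraMap r => rw [inclFrac_algebraMap]; exact Subalgebra.algebraMap_mem _ _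
  | add x y _ _ hx hy => rw [map_add]; exact add_mem hx hy
  | mul x y _ _ hx hy => rw [map_mul]; exact mul_mem hx hy

end NormalizedPoly

end PDEnvelope

section SRings

variable {p : ℕ} [Fact p.Prime] {k : Type u} [Field k] [CharP k p] [PerfectRing k p]

namespace NormalizedPoly

variable (E : NormalizedPoly p k)

/-- The Frobenius of the divided power envelope of `𝔖_n`. -/
noncomputable def frobD (n : ℕ) : E.PDEnv n →+* E.PDEnv n :=
  (frobFrac p k).restrict (E.PDEnv n) (E.PDEnv n) (E.frobFrac_mem n)

/-- The inclusion of the divided power envelope of `𝔖_n` in the one of `𝔖_{n+1}`. -/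
noncomputable def inclD (n : ℕ) : E.PDEnv n →+* E.PDEnv (n + 1) :=
  (inclFrac p k).restrict (E.PDEnv n) (E.PDEnv (n + 1)) (E.inclFrac_mem n)

lemma frobD_algebraMap (n : ℕ) (g : BKRing p k) :
    E.frobD n (algebraMap _ _ g) = algebraMap _ _ (frobBK p k g) :=
  Subtype.ext (frobFrac_algebraMap g)

lemma inclD_algebraMap (n : ℕ) (g : BKRing p k) :
    E.inclD n (algebraMap _ _ g) = algebraMap _ _ (inclBK p k g) :=
  Subtype.ext (inclFrac_algebraMap g)

lemma frobD_inclD (n : ℕ) :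
    (E.frobD (n + 1)).comp (E.inclD n) = (E.inclD n).comp (E.frobD n) := by
  ext1 x
  exact Subtype.ext (frobFrac_inclFrac (x : PowerSeries (WittFrac p k)))

/-- The ring `S_n`: the `p`-adic completion of the divided power envelope of `𝔖_n` with respect
to `E`. The ring `S` is `S_0`. -/
def S (n : ℕ) : Type u := PCompletion p (E.PDEnv n)

noncomputable instance (n : ℕ) : CommRing (E.S n) :=
  inferInstanceAs (CommRing (PCompletion p (E.PDEnv n)))

noncomputable instance (n : ℕ) : Algebra (E.PDEnv n) (E.S n) :=
  inferInstanceAs (Algebra (E.PDEnv n) (PCompletion p (E.PDEnv n)))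

/-- The structure map `𝔖_n → S_n`. -/
noncomputable instance (n : ℕ) : Algebra (BKRing p k) (E.S n) :=
  ((algebraMap (E.PDEnv n) (E.S n)).comp (algebraMap (BKRing p k) (E.PDEnv n))).toAlgebra

lemma algebraMap_S (n : ℕ) (g : BKRing p k) : algebraMap (BKRing p k) (E.S n) g =
    algebraMap (E.PDEnv n) (E.S n) (algebraMap (BKRing p k) (E.PDEnv n) g) := rfl

/-- The Frobenius of `S_n`. -/
noncomputable def frobS (n : ℕ) : E.S n →+* E.S n := completionMap p (E.frobD n)

/-- The inclusion `S_n → S_{n+1}`. -/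
noncomputable def inclS (n : ℕ) : E.S n →+* E.S (n + 1) := completionMap p (E.inclD n)

lemma frobS_algebraMap (n : ℕ) (g : BKRing p k) :
    E.frobS n (algebraMap _ _ g) = algebraMap _ _ (frobBK p k g) := by
  rw [algebraMap_S, algebraMap_S, ← frobD_algebraMap]
  exact completionMap_algebraMap p (E.frobD n) _

lemma inclS_algebraMap (n : ℕ) (g : BKRing p k) :
    E.inclS n (algebraMap _ _ g) = algebraMap _ _ (inclBK p k g) := by
  rw [algebraMap_S, algebraMap_S, ← inclD_algebraMap]
  exact completionMap_algebraMap p (E.inclD n) _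

lemma frobS_inclS (n : ℕ) (x : E.S n) :
    E.frobS (n + 1) (E.inclS n x) = E.inclS n (E.frobS n x) := by
  have h : (E.frobS (n + 1)).comp (E.inclS n) = (E.inclS n).comp (E.frobS n) := by
    refine (completionMap_comp p (E.frobD (n + 1)) (E.inclD n)).trans ?_
    rw [frobD_inclD]
    exact (completionMap_comp p (E.inclD n) (E.frobD n)).symm
  exact RingHom.congr_fun h x

/-- The divided power `E ^ i / i!` in `S_n`. -/
noncomputable def gamma (n i : ℕ) : E.S n := algebraMap (E.PDEnv n) (E.S n) (E.gammaD n i)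

lemma factorial_mul_gamma (n i : ℕ) :
    (i.factorial : E.S n) * E.gamma n i = algebraMap (BKRing p k) (E.S n) (E.elt n) ^ i := by
  have h : (i.factorial : E.PDEnv n) * E.gammaD n i =
      algebraMap (BKRing p k) (E.PDEnv n) (E.elt n) ^ i :=
    Subtype.ext (by push_cast; exact E.factorial_mul_divPow n i)
  rw [gamma, ← map_natCast (algebraMap (E.PDEnv n) (E.S n)), ← map_mul, h, map_pow, algebraMap_S]

/-- The ideal `Fil^m S_n`: the closure, for the `p`-adic topology of `S_n`, of the ideal generated
by the divided powers `E ^ i / i!` with `i ≥ m`. -/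
noncomputable def FilS (n m : ℕ) : Ideal (E.S n) :=
  ⨅ N : ℕ, Ideal.span {x | ∃ i ≥ m, x = E.gamma n i} ⊔ Ideal.span {(p : E.S n) ^ N}

lemma elt_pow_mem_FilS (n m : ℕ) :
    algebraMap (BKRing p k) (E.S n) (E.elt n) ^ m ∈ E.FilS n m := by
  rw [← factorial_mul_gamma]
  refine Ideal.mul_mem_left _ _ ?_
  rw [FilS, Ideal.mem_iInf]
  exact fun N => Ideal.mem_sup_left (Ideal.subset_span ⟨m, le_rfl, rfl⟩)

lemma isUnit_of_pow_mem (n : ℕ) {h t s : E.S n} (hh : IsUnit h) (ht : t ^ p = p * s) :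
    IsUnit (h + t) := by
  have hfg : (Ideal.span {(p : E.PDEnv n)}).FG := ⟨{(p : E.PDEnv n)}, by simp⟩
  have hc : IsAdicComplete ((Ideal.span {(p : E.PDEnv n)}).map
      (algebraMap (E.PDEnv n) (E.S n))) (E.S n) := AdicCompletion.isAdicComplete_self _ hfg
  have hj := IsAdicComplete.le_jacobson_bot ((Ideal.span {(p : E.PDEnv n)}).map
      (algebraMap (E.PDEnv n) (E.S n)))
  have hp : (p : E.S n) ∈ (⊥ : Ideal (E.S n)).jacobson := hj (by
    rw [Ideal.map_span]
    exact Ideal.subset_span ⟨p, rfl, by simp⟩)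
  obtain ⟨w, hw⟩ := hh.pow p
  have h1 : IsUnit (h ^ p - (-t) ^ p) := by
    rw [neg_pow, ht, ← hw]
    have := (Ideal.mem_jacobson_bot.mp hp) (-(-1) ^ p * s * ↑w⁻¹)
    have h2 : (w : E.S n) - (-1) ^ p * (p * s) =
        w * (p * (-(-1) ^ p * s * ↑w⁻¹) + 1) := by
      have : (w : E.S n) * ↑w⁻¹ = 1 := by simp
      linear_combination (-(p * (-1) ^ p * s) : E.S n) * (1 - this)
    rw [h2]
    exact w.isUnit.mul this
  have h3 := sub_dvd_pow_sub_pow h (-t) p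
  rw [sub_neg_eq_add] at h3
  exact isUnit_of_dvd_unit h3 h1

lemma exists_gamma_pow (n : ℕ) : ∃ s, E.gamma n p ^ p = p * s := by
  have hp := (Fact.out : p.Prime)
  have hb := Nat.uniformBell_mul_eq p hp.ne_zero
  refine ⟨(p.uniformBell p * (p - 1).factorial : ℕ) * E.gamma n (p * p), ?_⟩
  have key : E.divPow n p ^ p =
      (p * (p.uniformBell p * (p - 1).factorial) : ℕ) * E.divPow n (p * p) := by
    have h1 : (p * (p.uniformBell p * (p - 1).factorial) : ℕ) * p.factorial ^ p =
        (p * p).factorial := by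
      rw [← hb, ← Nat.mul_factorial_pred hp.ne_zero]
      ring
    have h2 : ((p.factorial : WittFrac p k)⁻¹) ^ p =
        ((p * (p.uniformBell p * (p - 1).factorial) : ℕ) : WittFrac p k) *
          ((p * p).factorial : WittFrac p k)⁻¹ := by
      have h3 := factorial_ne_zero (p := p) (k := k) p
      have h4 := factorial_ne_zero (p := p) (k := k) (p * p)
      rw [inv_pow, eq_mul_inv_iff_mul_eq₀ h4, inv_mul_eq_iff_eq_mul₀ (pow_ne_zero _ h3), ← h1]
      push_cast
      ring
    rw [divPow, divPow, smul_pow, ← pow_mul, h2, mul_smul, Nat.cast_smul_eq_nsmul, nsmul_eq_mul]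
  have h2 : E.gammaD n p ^ p =
      (p * (p.uniformBell p * (p - 1).factorial) : ℕ) * E.gammaD n (p * p) :=
    Subtype.ext (by push_cast; push_cast at key; exact key)
  rw [gamma, ← map_pow, h2, map_mul, map_natCast]
  push_cast
  rw [gamma]
  ring

lemma isUnit_c (n : ℕ) : IsUnit (algebraMap (E.PDEnv n) (E.S n) (E.cD n)) := by
  obtain ⟨h, hh, hc⟩ := (E.exists_cD n).choose_spec.2
  obtain ⟨s, hs⟩ := E.exists_gamma_pow n
  have hc' : E.cD n = _ := hc
  rw [hc', map_add, map_mul, map_natCast]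
  refine E.isUnit_of_pow_mem n (s := ((p - 1).factorial : E.S n) ^ p * s) ?_ ?_
  · exact (hh.map (algebraMap (BKRing p k) (E.PDEnv n))).map (algebraMap (E.PDEnv n) (E.S n))
  · have : E.gamma n p = algebraMap (E.PDEnv n) (E.S n) (E.gammaD n p) := rfl
    rw [mul_pow, ← this, hs]
    ring

/-- The unit `φ(E) / p` of `S_n`. For `n = 0` it is called `c₀`. -/
noncomputable def c (n : ℕ) : (E.S n)ˣ := (E.isUnit_c n).unit

lemma p_mul_c (n : ℕ) : (p : E.S n) * E.c n =
    E.frobS n (algebraMap (BKRing p k) (E.S n) (E.elt n)) := by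
  rw [frobS_algebraMap, algebraMap_S, ← p_mul_cD, map_mul, map_natCast]
  rfl

end NormalizedPoly

end SRings

section Localization

variable {p : ℕ} [Fact p.Prime] {k : Type u} [Field k] [CharP k p] [PerfectRing k p]

namespace NormalizedPoly

variable (E : NormalizedPoly p k)

/-- The element `z_n` in `S_n`. -/
noncomputable def zS (n : ℕ) : E.S n := algebraMap (BKRing p k) (E.S n) (E.z n)

/-- The ring `S_n[z_n⁻¹]`. -/
def SLoc (n : ℕ) : Type u := Localization.Away (E.zS n)

noncomputable instance (n : ℕ) : CommRing (E.SLoc n) :=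
  inferInstanceAs (CommRing (Localization.Away (E.zS n)))

/-- The localization map `S_n → S_n[z_n⁻¹]`. -/
noncomputable def toLoc (n : ℕ) : E.S n →+* E.SLoc n :=
  algebraMap (E.S n) (Localization.Away (E.zS n))

lemma isUnit_toLoc_zS (n : ℕ) : IsUnit (E.toLoc n (E.zS n)) :=
  IsLocalization.Away.algebraMap_isUnit (S := Localization.Away (E.zS n)) (E.zS n)

/-- The element `z_n` as a unit of `S_n[z_n⁻¹]`. -/
noncomputable def zUnit (n : ℕ) : (E.SLoc n)ˣ := (E.isUnit_toLoc_zS n).unit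

lemma coe_zUnit (n : ℕ) : (E.zUnit n : E.SLoc n) = E.toLoc n (E.zS n) := rfl

/-- The ring homomorphism out of `S_n[z_n⁻¹]` induced by one out of `S_n` inverting `z_n`. -/
noncomputable def locLift (n : ℕ) {B : Type*} [CommRing B] (f : E.S n →+* B)
    (h : IsUnit (f (E.zS n))) : E.SLoc n →+* B :=
  IsLocalization.Away.lift (S := Localization.Away (E.zS n)) (E.zS n) h

lemma locLift_toLoc (n : ℕ) {B : Type*} [CommRing B] (f : E.S n →+* B)
    (h : IsUnit (f (E.zS n))) (x : E.S n) : E.locLift n f h (E.toLoc n x) = f x :=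
  IsLocalization.Away.lift_eq (S := Localization.Away (E.zS n)) (E.zS n) h x

lemma loc_hom_ext (n : ℕ) {B : Type*} [CommRing B] {f g : E.SLoc n →+* B}
    (h : ∀ x, f (E.toLoc n x) = g (E.toLoc n x)) : f = g :=
  IsLocalization.ringHom_ext (Submonoid.powers (E.zS n)) (S := Localization.Away (E.zS n))
    (RingHom.ext h)

lemma inclS_zS_dvd (n : ℕ) : ∃ w, E.zS (n + 1) = E.inclS n (E.zS n) * w := by
  refine ⟨algebraMap _ _ (inclBK p k (twistBK p k n E.ser)), ?_⟩
  rw [zS, z_succ, map_mul, map_mul, zS, inclS_algebraMap]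

lemma isUnit_toLoc_inclS_zS (n : ℕ) :
    IsUnit (((E.toLoc (n + 1)).comp (E.inclS n)) (E.zS n)) := by
  obtain ⟨w, hw⟩ := E.inclS_zS_dvd n
  have := E.isUnit_toLoc_zS (n + 1)
  rw [hw, map_mul] at this
  exact isUnit_of_mul_isUnit_left this

lemma isUnit_toLoc_p (n : ℕ) : IsUnit (E.toLoc (n + 1) (p : E.S (n + 1))) := by
  have h1 : IsUnit (E.toLoc (n + 1) (algebraMap (BKRing p k) _ (E.elt (n + 1)))) :=
    isUnit_of_dvd_unit ((E.toLoc (n + 1)).map_dvd ((algebraMap (BKRing p k) _).map_dvd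
      (E.elt_dvd_z n))) (E.isUnit_toLoc_zS (n + 1))
  have h2 := h1.pow p
  rw [← map_pow, ← factorial_mul_gamma, ← Nat.mul_factorial_pred (Fact.out : p.Prime).ne_zero,
    Nat.cast_mul, mul_assoc, map_mul] at h2
  exact isUnit_of_mul_isUnit_left h2

lemma isUnit_toLoc_frobS_zS (n : ℕ) :
    IsUnit (((E.toLoc n).comp (E.frobS n)) (E.zS n)) := by
  cases n with
  | zero => simp [zS, z_zero]
  | succ n =>
    rw [RingHom.comp_apply, zS, frobS_algebraMap, frobBK_z, map_mul, map_mul, ← frobS_algebraMap,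
      ← p_mul_c, map_mul, ← inclS_algebraMap]
    exact ((E.isUnit_toLoc_p n).mul ((E.c (n + 1)).isUnit.map _)).mul (E.isUnit_toLoc_inclS_zS n)

/-- The Frobenius of `S_n[z_n⁻¹]`; it exists because `φ(z_n) = φ(E) z_{n-1}`, where
`φ(E)` is `p` times a unit, and `p` divides `E ^ p` in `S_n`. -/
noncomputable def frobLoc (n : ℕ) : E.SLoc n →+* E.SLoc n :=
  E.locLift n ((E.toLoc n).comp (E.frobS n)) (E.isUnit_toLoc_frobS_zS n)

lemma frobLoc_toLoc (n : ℕ) (x : E.S n) :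
    E.frobLoc n (E.toLoc n x) = E.toLoc n (E.frobS n x) :=
  E.locLift_toLoc _ _ _ x

/-- The inclusion `S_n[z_n⁻¹] → S_{n+1}[z_{n+1}⁻¹]`. -/
noncomputable def inclLoc (n : ℕ) : E.SLoc n →+* E.SLoc (n + 1) :=
  E.locLift n ((E.toLoc (n + 1)).comp (E.inclS n)) (E.isUnit_toLoc_inclS_zS n)

lemma inclLoc_toLoc (n : ℕ) (x : E.S n) :
    E.inclLoc n (E.toLoc n x) = E.toLoc (n + 1) (E.inclS n x) :=
  E.locLift_toLoc _ _ _ x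

lemma frobLoc_inclLoc (n : ℕ) (x : E.SLoc n) :
    E.frobLoc (n + 1) (E.inclLoc n x) = E.inclLoc n (E.frobLoc n x) := by
  have h : (E.frobLoc (n + 1)).comp (E.inclLoc n) = (E.inclLoc n).comp (E.frobLoc n) := by
    apply E.loc_hom_ext
    intro x
    simp only [RingHom.comp_apply, inclLoc_toLoc, frobLoc_toLoc, frobS_inclS]
  exact RingHom.congr_fun h x

/-- The composite inclusion `S = S_0 → S_n`. -/
noncomputable def baseS : ∀ n : ℕ, E.S 0 →+* E.S n
  | 0 => RingHom.id _
  | n + 1 => (E.inclS n).comp (baseS n)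

lemma frobS_baseS (n : ℕ) (x : E.S 0) :
    E.frobS n (E.baseS n x) = E.baseS n (E.frobS 0 x) := by
  induction n with
  | zero => rfl
  | succ n ih => simp only [baseS, RingHom.comp_apply, frobS_inclS, ih]

/-- The ring `S_n[z_n⁻¹]` as an `S`-algebra. -/
noncomputable instance (n : ℕ) : Algebra (E.S 0) (E.SLoc n) :=
  ((E.toLoc n).comp (E.baseS n)).toAlgebra

lemma algebraMap_SLoc (n : ℕ) (x : E.S 0) :
    algebraMap (E.S 0) (E.SLoc n) x = E.toLoc n (E.baseS n x) := rfl

lemma frobLoc_algebraMap (n : ℕ) (x : E.S 0) :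
    E.frobLoc n (algebraMap (E.S 0) (E.SLoc n) x) = algebraMap _ _ (E.frobS 0 x) := by
  rw [algebraMap_SLoc, algebraMap_SLoc, frobLoc_toLoc, frobS_baseS]

lemma inclLoc_algebraMap (n : ℕ) (x : E.S 0) :
    E.inclLoc n (algebraMap (E.S 0) (E.SLoc n) x) = algebraMap _ _ x := by
  rw [algebraMap_SLoc, algebraMap_SLoc, inclLoc_toLoc]
  rfl

/-- The map `𝔖 → S_n`, `g ↦ g^{σ^{-n}}(u_n)`. -/
noncomputable def twistS (n : ℕ) : BKRing p k →+* E.S n :=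
  (algebraMap (BKRing p k) (E.S n)).comp (twistBK p k n)

lemma frobS_twistS (n : ℕ) (g : BKRing p k) :
    E.frobS n (E.twistS n g) = E.twistS n (frobBK p k g) := by
  simp only [twistS, RingHom.comp_apply, frobS_algebraMap, frobBK_twistBK]

lemma frobS_twistS_succ (n : ℕ) (g : BKRing p k) :
    E.frobS (n + 1) (E.twistS (n + 1) g) = E.inclS n (E.twistS n g) := by
  simp only [twistS, RingHom.comp_apply, frobS_algebraMap, inclS_algebraMap, frobBK_twistBK_succ]

lemma twistS_zero (g : BKRing p k) : E.twistS 0 g = algebraMap _ _ g := by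
  have : twistBK p k 0 g = g := by
    ext i : 1
    simp [twistBK, sigmaInv]
  rw [twistS, RingHom.comp_apply, this]

lemma toLoc_zero_surjective : Function.Surjective (E.toLoc 0) := by
  intro x
  obtain ⟨n, a, ha⟩ := IsLocalization.Away.surj (S := Localization.Away (E.zS 0)) (E.zS 0) x
  refine ⟨a, ?_⟩
  have h : E.zS 0 = 1 := by simp [zS, z_zero]
  have h2 : algebraMap (E.S 0) (Localization.Away (E.zS 0)) (E.zS 0) ^ n = 1 := by
    rw [← map_pow, h, one_pow, map_one]
  rw [h2] at ha
  exact ha.symm.trans (mul_one (M := Localization.Away (E.zS 0)) x)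

end NormalizedPoly

end Localization


/-! ### Filtered modules with divided Frobenius -/

/-- Let `R` be a ring with an endomorphism `φ` and an ideal `I`. The objects are the triples
`(M, Fil M, φ_r)` where `M` is a finite free `R`-module, `Fil M` is a submodule with
`I M ⊆ Fil M` such that `M / Fil M` is `p`-torsion free, and `φ_r : Fil M → M` is a `φ`-semilinear
map whose image generates `M` as an `R`-module. -/
structure FilteredPhiModule (R : Type u) [CommRing R] (φ : R →+* R) (I : Ideal R) (p : ℕ) where
  /-- The underlying module. -/
  carrier : Type u
  [addCommGroup : AddCommGroup carrier]
  [module : Module R carrier]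
  [finite : Module.Finite R carrier]
  [free : Module.Free R carrier]
  /-- The submodule `Fil^r M`. -/
  Fil : Submodule R carrier
  smul_top_le : I • (⊤ : Submodule R carrier) ≤ Fil
  torsionFree : ∀ x : carrier ⧸ Fil, (p : R) • x = 0 → x = 0
  /-- The divided Frobenius `φ_{M,r}`. -/
  phiR : Fil →ₛₗ[φ] carrier
  span_range_phiR : Submodule.span R (Set.range phiR) = ⊤

attribute [instance] FilteredPhiModule.addCommGroup FilteredPhiModule.module
  FilteredPhiModule.finite FilteredPhiModule.free

namespace FilteredPhiModule

variable {R : Type u} [CommRing R] {φ : R →+* R} {I : Ideal R} {p : ℕ}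

/-- Morphisms are the `R`-linear maps compatible with the filtrations and with `φ_r`. -/
@[ext]
structure Hom (M N : FilteredPhiModule R φ I p) where
  /-- The underlying linear map. -/
  lin : M.carrier →ₗ[R] N.carrier
  map_fil : ∀ x ∈ M.Fil, lin x ∈ N.Fil
  map_phiR : ∀ x : M.Fil, lin (M.phiR x) = N.phiR ⟨lin x, map_fil x x.2⟩

instance : Category (FilteredPhiModule R φ I p) where
  Hom M N := Hom M N
  id M := ⟨LinearMap.id, fun _ h => h, fun _ => rfl⟩
  comp f g := ⟨g.lin ∘ₗ f.lin, fun x h => g.map_fil _ (f.map_fil x h), fun x => by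
    simp [f.map_phiR, g.map_phiR]⟩

@[ext]
lemma hom_ext {M N : FilteredPhiModule R φ I p} {f g : M ⟶ N} (h : f.lin = g.lin) : f = g :=
  Hom.ext h

@[simp] lemma id_lin (M : FilteredPhiModule R φ I p) : Hom.lin (𝟙 M) = LinearMap.id := rfl

@[simp] lemma comp_lin {M N P : FilteredPhiModule R φ I p} (f : M ⟶ N) (g : N ⟶ P) :
    Hom.lin (f ≫ g) = g.lin ∘ₗ f.lin := rfl

lemma smul_mem_Fil (M : FilteredPhiModule R φ I p) {e : R} (he : e ∈ I) (m : M.carrier) :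
    e • m ∈ M.Fil :=
  M.smul_top_le (Submodule.smul_mem_smul he trivial)

/-- For `e ∈ I`, the `φ`-semilinear map `m ↦ φ_r(e m)` on `M`. -/
def phiOf (M : FilteredPhiModule R φ I p) (e : R) (he : e ∈ I) : M.carrier →ₛₗ[φ] M.carrier where
  toFun m := M.phiR ⟨e • m, M.smul_mem_Fil he m⟩
  map_add' x y := by
    rw [← map_add]
    congr 1
    exact Subtype.ext (smul_add e x y)
  map_smul' a x := by
    rw [← M.phiR.map_smulₛₗ]
    congr 1
    exact Subtype.ext (smul_comm e a x)

/-- The filtration `Fil^j M = {m : e^{r-j} m ∈ Fil^r M}` for `j ≤ r`, and `Fil^j M = 0` for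
`j > r`. -/
def FilZ (M : FilteredPhiModule R φ I p) (e : R) (r : ℕ) (j : ℤ) : Submodule R M.carrier :=
  if j ≤ r then M.Fil.comap (LinearMap.lsmul R M.carrier (e ^ ((r : ℤ) - j).toNat)) else ⊥

end FilteredPhiModule

/-- Modules over `R` with a submodule and a `φ`-semilinear endomorphism. -/
structure PhiModule (R : Type u) [CommRing R] (φ : R →+* R) where
  /-- The underlying module. -/
  carrier : Type u
  [addCommGroup : AddCommGroup carrier]
  [module : Module R carrier]
  /-- The submodule. -/
  Fil : Submodule R carrier
  /-- The Frobenius. -/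
  frob : carrier →ₛₗ[φ] carrier

attribute [instance] PhiModule.addCommGroup PhiModule.module

namespace PhiModule

variable {R : Type u} [CommRing R] {φ : R →+* R}

/-- Morphisms are the `R`-linear maps compatible with the submodules and the Frobenius maps. -/
@[ext]
structure Hom (M N : PhiModule R φ) where
  /-- The underlying linear map. -/
  lin : M.carrier →ₗ[R] N.carrier
  map_fil : ∀ x ∈ M.Fil, lin x ∈ N.Fil
  map_frob : ∀ x, lin (M.frob x) = N.frob (lin x)

instance : Category (PhiModule R φ) where
  Hom M N := Hom M N
  id M := ⟨LinearMap.id, fun _ h => h, fun _ => rfl⟩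
  comp f g := ⟨g.lin ∘ₗ f.lin, fun x h => g.map_fil _ (f.map_fil x h), fun x => by
    simp [f.map_frob, g.map_frob]⟩

@[ext]
lemma hom_ext {M N : PhiModule R φ} {f g : M ⟶ N} (h : f.lin = g.lin) : f = g :=
  Hom.ext h

@[simp] lemma id_lin (M : PhiModule R φ) : Hom.lin (𝟙 M) = LinearMap.id := rfl

@[simp] lemma comp_lin {M N P : PhiModule R φ} (f : M ⟶ N) (g : N ⟶ P) :
    Hom.lin (f ≫ g) = g.lin ∘ₗ f.lin := rfl

/-- The condition that `(M, Fil M, c⁻¹ φ_M)` is a well-defined object of the category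
`FilteredPhiModule R φ I p`: the module `M` is finite and free, `I M ⊆ Fil M`, the quotient
`M / Fil M` is `p`-torsion free, `φ_M` is uniquely divisible by `c` on `Fil M`, and the image of
`c⁻¹ φ_M : Fil M → M` generates `M`. -/
structure IsDivided (M : PhiModule R φ) (I : Ideal R) (p : ℕ) (c : R) : Prop where
  finite : Module.Finite R M.carrier
  free : Module.Free R M.carrier
  smul_top_le : I • (⊤ : Submodule R M.carrier) ≤ M.Fil
  torsionFree : ∀ x : M.carrier ⧸ M.Fil, (p : R) • x = 0 → x = 0
  existsUnique_div : ∀ x ∈ M.Fil, ∃! y : M.carrier, c • y = M.frob x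
  span_eq_top : Submodule.span R {y : M.carrier | ∃ x ∈ M.Fil, c • y = M.frob x} = ⊤

namespace IsDivided

variable {M N P : PhiModule R φ} {I : Ideal R} {p : ℕ} {c : R}

lemma cancel (h : M.IsDivided I p c) {x y : M.carrier} (hxy : c • x = c • y) : x = y := by
  have h0 := h.existsUnique_div 0 (zero_mem _)
  have h1 : x - y = 0 := h0.unique (by rw [smul_sub, hxy, sub_self, map_zero])
    (by rw [smul_zero, map_zero])
  exact sub_eq_zero.mp h1

/-- The triple `(M, Fil M, c⁻¹ φ_M)`. -/
noncomputable def divided (h : M.IsDivided I p c) : FilteredPhiModule R φ I p where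
  carrier := M.carrier
  finite := h.finite
  free := h.free
  Fil := M.Fil
  smul_top_le := h.smul_top_le
  torsionFree := h.torsionFree
  phiR :=
    { toFun := fun x => (h.existsUnique_div x x.2).choose
      map_add' := fun x y => h.cancel (by
        rw [smul_add, (h.existsUnique_div _ (x + y).2).choose_spec.1,
          (h.existsUnique_div _ x.2).choose_spec.1, (h.existsUnique_div _ y.2).choose_spec.1]
        simp)
      map_smul' := fun a x => h.cancel (by
        rw [smul_comm, (h.existsUnique_div _ (a • x).2).choose_spec.1,
          (h.existsUnique_div _ x.2).choose_spec.1]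
        simp) }
  span_range_phiR := by
    rw [← h.span_eq_top]
    congr 1
    ext y
    constructor
    · rintro ⟨x, rfl⟩
      exact ⟨x, x.2, (h.existsUnique_div _ x.2).choose_spec.1⟩
    · rintro ⟨x, hx, hy⟩
      exact ⟨⟨x, hx⟩, h.cancel ((h.existsUnique_div _ hx).choose_spec.1.trans hy.symm)⟩

lemma smul_divided_phiR (h : M.IsDivided I p c) (x : M.Fil) :
    c • (show M.carrier from h.divided.phiR x) = M.frob x :=
  (h.existsUnique_div _ x.2).choose_spec.1

/-- A morphism `M ⟶ N` is also a morphism for the maps `c⁻¹ φ`. -/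
noncomputable def dividedMap (hM : M.IsDivided I p c) (hN : N.IsDivided I p c) (f : M ⟶ N) :
    hM.divided ⟶ hN.divided where
  lin := f.lin
  map_fil := f.map_fil
  map_phiR x := hN.cancel (by
    refine Eq.trans ?_ (hN.smul_divided_phiR ⟨f.lin x.1, f.map_fil x.1 x.2⟩).symm
    refine (f.lin.map_smul c _).symm.trans ?_
    exact (congrArg f.lin (hM.smul_divided_phiR x)).trans (f.map_frob _))

end IsDivided

/-- A functor to `PhiModule R φ` whose values satisfy `IsDivided` gives a functor to
`FilteredPhiModule R φ I p`, replacing `φ_M` by `c⁻¹ φ_M` on `Fil M`. -/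
noncomputable def dividedFunctor {C : Type*} [Category C] (F : C ⥤ PhiModule R φ) {I : Ideal R}
    {p : ℕ} {c : R} (h : ∀ X, (F.obj X).IsDivided I p c) : C ⥤ FilteredPhiModule R φ I p where
  obj X := (h X).divided
  map {X Y} f := (h X).dividedMap (h Y) (F.map f)
  map_id X := FilteredPhiModule.hom_ext (congrArg Hom.lin (F.map_id X))
  map_comp f g := FilteredPhiModule.hom_ext (congrArg Hom.lin (F.map_comp f g))

end PhiModule

section SemiTensor

variable {A B C : Type*} [CommRing A] [CommRing B] [CommRing C] [Algebra A B] [Algebra A C]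
  {φA : A →+* A} {φB : B →+* B} {M N : Type*} [AddCommGroup M] [AddCommGroup N] [Module A M]
  [Module A N]

/-- The `φ_B`-semilinear map `φ_B ⊗ f : B ⊗ M → B ⊗ N` for a `φ_A`-semilinear map `f`. -/
noncomputable def semiTensor (h : ∀ a, φB (algebraMap A B a) = algebraMap A B (φA a))
    (f : M →ₛₗ[φA] N) : B ⊗[A] M →ₛₗ[φB] B ⊗[A] N where
  toFun := TensorProduct.map
    ({ toFun := φB
       map_add' := map_add φB
       map_smul' := fun a b => by rw [Algebra.smul_def, map_mul, h, Algebra.smul_def] } :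
      B →ₛₗ[φA] B) f
  map_add' := map_add _
  map_smul' b x := by
    induction x with
    | zero => simp
    | add x y hx hy => rw [smul_add, map_add, map_add, hx, hy, smul_add]
    | tmul c m => simp [TensorProduct.smul_tmul']

@[simp]
lemma semiTensor_tmul (h : ∀ a, φB (algebraMap A B a) = algebraMap A B (φA a))
    (f : M →ₛₗ[φA] N) (b : B) (m : M) : semiTensor h f (b ⊗ₜ m) = φB b ⊗ₜ f m := rfl

/-- The map `g ⊗ id : B ⊗ M → C ⊗ M` for a homomorphism of `A`-algebras `g`. -/
noncomputable def extendScalars (g : B →+* C) (h : ∀ a, g (algebraMap A B a) = algebraMap A C a)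
    (M : Type*) [AddCommGroup M] [Module A M] : B ⊗[A] M →+ C ⊗[A] M :=
  (LinearMap.rTensor M ({ toRingHom := g, commutes' := h } : B →ₐ[A] C).toLinearMap).toAddMonoidHom

@[simp]
lemma extendScalars_tmul (g : B →+* C) (h : ∀ a, g (algebraMap A B a) = algebraMap A C a)
    (b : B) (m : M) : extendScalars g h M (b ⊗ₜ[A] m) = g b ⊗ₜ m := rfl

lemma extendScalars_smul (g : B →+* C) (h : ∀ a, g (algebraMap A B a) = algebraMap A C a)
    (b : B) (x : B ⊗[A] M) : extendScalars g h M (b • x) = g b • extendScalars g h M x := by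
  induction x with
  | zero => simp
  | add x y hx hy => rw [smul_add, map_add, map_add, hx, hy, smul_add]
  | tmul c m => simp [TensorProduct.smul_tmul']

end SemiTensor

section Functors

variable {p : ℕ} [Fact p.Prime] {k : Type u} [Field k] [CharP k p] [PerfectRing k p]

/-- The category `Mod_𝔖^{φ,r}` of height-`r` filtered Breuil–Kisin modules over `𝔖`. -/
abbrev BKMod (E : NormalizedPoly p k) (r : ℕ) : Type (u + 1) :=
  FilteredPhiModule (BKRing p k) (frobBK p k) (Ideal.span {E.ser ^ r}) p

/-- The category `Mod_S^{φ,r}` of height-`r` quasi-Breuil modules over `S`. -/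
abbrev BreuilMod (E : NormalizedPoly p k) (r : ℕ) : Type (u + 1) :=
  FilteredPhiModule (E.S 0) (E.frobS 0) (E.FilS 0 r) p

variable {E : NormalizedPoly p k} {r : ℕ}

/-- The Frobenius `φ_M(m) = φ_{M,r}(E ^ r m)` of a filtered Breuil–Kisin module. -/
noncomputable def BKMod.phi (M : BKMod E r) : M.carrier →ₛₗ[frobBK p k] M.carrier :=
  M.phiOf (E.ser ^ r) (Ideal.mem_span_singleton_self _)

lemma BKMod.map_phi {M N : BKMod E r} (f : M ⟶ N) (x : M.carrier) :
    f.lin (BKMod.phi M x) = BKMod.phi N (f.lin x) := by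
  refine (f.map_phiR _).trans ?_
  exact congrArg N.phiR (Subtype.ext (f.lin.map_smul _ _))

variable (E) in
/-- The element `E` of `S`. -/
noncomputable def NormalizedPoly.inS : E.S 0 := algebraMap (BKRing p k) (E.S 0) E.ser

lemma NormalizedPoly.inS_pow_mem : E.inS ^ r ∈ E.FilS 0 r := E.elt_pow_mem_FilS 0 r

/-- The Frobenius `φ_𝓜(m) = c₀^{-r} φ_{𝓜,r}(E ^ r m)` of a quasi-Breuil module. -/
noncomputable def BreuilMod.phi (M : BreuilMod E r) : M.carrier →ₛₗ[E.frobS 0] M.carrier :=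
  (((E.c 0)⁻¹ ^ r : (E.S 0)ˣ) : E.S 0) • M.phiOf (E.inS ^ r) E.inS_pow_mem

lemma BreuilMod.map_phi {M N : BreuilMod E r} (f : M ⟶ N) (x : M.carrier) :
    f.lin (BreuilMod.phi M x) = BreuilMod.phi N (f.lin x) := by
  refine (f.lin.map_smul _ _).trans (congrArg _ ((f.map_phiR _).trans ?_))
  exact congrArg N.phiR (Subtype.ext (f.lin.map_smul _ _))

/-- The filtration `Fil^j 𝓜`, `j ∈ ℤ`, of a quasi-Breuil module. -/
noncomputable def BreuilMod.fil (M : BreuilMod E r) (j : ℤ) : Submodule (E.S 0) M.carrier :=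
  M.FilZ E.inS r j

lemma BreuilMod.map_fil {M N : BreuilMod E r} (f : M ⟶ N) (j : ℤ) {x : M.carrier}
    (hx : x ∈ BreuilMod.fil M j) : f.lin x ∈ BreuilMod.fil N j := by
  unfold BreuilMod.fil FilteredPhiModule.FilZ at *
  split_ifs at * with h
  · have := f.map_fil _ hx
    simpa using this
  · simp_all

lemma BreuilMod.fil_of_nonpos (M : BreuilMod E r) {j : ℤ} (hj : j ≤ 0) (x : M.carrier) :
    x ∈ BreuilMod.fil M j := by
  have h : j ≤ r := by omega
  have h2 : ((r : ℤ) - j).toNat = r + (-j).toNat := by omega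
  rw [BreuilMod.fil, FilteredPhiModule.FilZ, if_pos h, h2]
  refine M.smul_mem_Fil ?_ x
  rw [pow_add]
  exact Ideal.mul_mem_right _ _ E.inS_pow_mem

lemma BreuilMod.fil_r (M : BreuilMod E r) : BreuilMod.fil M r = M.Fil := by
  ext x
  simp [BreuilMod.fil, FilteredPhiModule.FilZ]

/-- The base change `(S ⊗ M, Fil^r (S ⊗ M), φ ⊗ φ_M)` of a filtered Breuil–Kisin module, where
`Fil^r (S ⊗ M)` is the submodule generated by the images of `S ⊗ Fil^r M` and `Fil^r S ⊗ M`. -/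
noncomputable def baseChangeObj (M : BKMod E r) : PhiModule (E.S 0) (E.frobS 0) where
  carrier := E.S 0 ⊗[BKRing p k] M.carrier
  Fil := Submodule.span (E.S 0)
    ({x | ∃ s : E.S 0, ∃ m ∈ M.Fil, x = s ⊗ₜ m} ∪
      {x | ∃ s ∈ E.FilS 0 r, ∃ m : M.carrier, x = s ⊗ₜ m})
  frob := semiTensor (E.frobS_algebraMap 0) (BKMod.phi M)

lemma baseChange_mem_Fil {M N : BKMod E r} (f : M ⟶ N) (x : E.S 0 ⊗[BKRing p k] M.carrier)
    (hx : x ∈ (baseChangeObj M).Fil) :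
    (f.lin.baseChange (E.S 0) x : E.S 0 ⊗[BKRing p k] N.carrier) ∈ (baseChangeObj N).Fil := by
  have hle : (baseChangeObj M).Fil ≤
      Submodule.comap (f.lin.baseChange (E.S 0)) (baseChangeObj N).Fil := by
    refine Submodule.span_le.mpr ?_
    rintro x (⟨s, m, hm, rfl⟩ | ⟨s, hs, m, rfl⟩)
    · exact Submodule.subset_span (Or.inl ⟨s, f.lin m, f.map_fil m hm, rfl⟩)
    · exact Submodule.subset_span (Or.inr ⟨s, hs, f.lin m, rfl⟩)
  exact hle hx

lemma baseChange_frob {M N : BKMod E r} (f : M ⟶ N) (x : E.S 0 ⊗[BKRing p k] M.carrier) :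
    f.lin.baseChange (E.S 0) (semiTensor (E.frobS_algebraMap 0) (BKMod.phi M) x) =
      semiTensor (E.frobS_algebraMap 0) (BKMod.phi N) (f.lin.baseChange (E.S 0) x) := by
  induction x with
  | zero => simp only [map_zero]
  | add x y hx hy => simp only [map_add, hx, hy]
  | tmul s m => simp [BKMod.map_phi]

variable (E r) in
/-- The base change functor, before dividing the Frobenius on `Fil^r` by `p ^ r`. -/
noncomputable def preBaseChange : BKMod E r ⥤ PhiModule (E.S 0) (E.frobS 0) where
  obj M := baseChangeObj M
  map {M N} f :=
    { lin := f.lin.baseChange (E.S 0)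
      map_fil := baseChange_mem_Fil f
      map_frob := baseChange_frob f }
  map_id M := PhiModule.hom_ext LinearMap.baseChange_id
  map_comp f g := PhiModule.hom_ext (LinearMap.baseChange_comp f.lin g.lin)

/-! ### The modules `𝓜 ⊗_S S_n[z_n⁻¹]` -/

/-- The module `S_n[z_n⁻¹] ⊗_S 𝓜`. -/
def Level (M : BreuilMod E r) (n : ℕ) : Type u := E.SLoc n ⊗[E.S 0] M.carrier

namespace Level

variable (M : BreuilMod E r) (n : ℕ)

noncomputable instance : AddCommGroup (Level M n) :=
  inferInstanceAs (AddCommGroup (E.SLoc n ⊗[E.S 0] M.carrier))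

noncomputable instance : Module (E.SLoc n) (Level M n) :=
  inferInstanceAs (Module (E.SLoc n) (E.SLoc n ⊗[E.S 0] M.carrier))

/-- The `S_n`-module structure. -/
noncomputable instance : Module (E.S n) (Level M n) := Module.compHom _ (E.toLoc n)

/-- The `𝔖`-module structure, where `g ∈ 𝔖` acts as `g^{σ^{-n}}(u_n) ∈ 𝔖_n`. -/
noncomputable instance : Module (BKRing p k) (Level M n) :=
  Module.compHom _ ((E.toLoc n).comp (E.twistS n))

lemma smul_def' (s : E.S n) (x : Level M n) : s • x = E.toLoc n s • x := rfl

lemma bk_smul_def (g : BKRing p k) (x : Level M n) :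
    g • x = E.toLoc n (E.twistS n g) • x := rfl

variable {M n} in
/-- The pure tensor `s ⊗ m`. -/
noncomputable def tmul (s : E.SLoc n) (m : M.carrier) : Level M n := s ⊗ₜ[E.S 0] m

/-- The Frobenius `φ ⊗ φ_𝓜`. -/
noncomputable def frob : Level M n →ₛₗ[E.frobLoc n] Level M n :=
  semiTensor (E.frobLoc_algebraMap n) (BreuilMod.phi M)

/-- The map `S_n[z_n⁻¹] ⊗_S 𝓜 → S_{n+1}[z_{n+1}⁻¹] ⊗_S 𝓜` induced by the inclusion. -/
noncomputable def incl : Level M n →+ Level M (n + 1) :=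
  extendScalars (E.inclLoc n) (E.inclLoc_algebraMap n) M.carrier

/-- The tensor product filtration: `Fil^j` is generated over `S_n` by the tensors `z_n^a ⊗ m` with
`a, b ∈ ℤ`, `a + b = j` and `m ∈ Fil^b 𝓜`. -/
noncomputable def fil (j : ℤ) : Submodule (E.S n) (Level M n) :=
  Submodule.span (E.S n) {x | ∃ a b : ℤ, a + b = j ∧ ∃ m ∈ BreuilMod.fil M b,
    x = tmul ((E.zUnit n ^ a : (E.SLoc n)ˣ) : E.SLoc n) m}

variable {M} in
/-- The map induced by a morphism of quasi-Breuil modules. -/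
noncomputable def map {N : BreuilMod E r} (f : M ⟶ N) : Level M n →ₗ[E.SLoc n] Level N n :=
  f.lin.baseChange (E.SLoc n)

variable {M n}

lemma induction {P : Level M n → Prop} (h0 : P 0) (ha : ∀ x y, P x → P y → P (x + y))
    (ht : ∀ s m, P (tmul s m)) (x : Level M n) : P x :=
  TensorProduct.induction_on (motive := P) x h0 ht ha

lemma frob_tmul (s : E.SLoc n) (m : M.carrier) :
    frob M n (tmul s m) = tmul (E.frobLoc n s) (BreuilMod.phi M m) := rfl

lemma incl_tmul (s : E.SLoc n) (m : M.carrier) :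
    incl M n (tmul s m) = tmul (E.inclLoc n s) m := rfl

lemma map_tmul {N : BreuilMod E r} (f : M ⟶ N) (s : E.SLoc n) (m : M.carrier) :
    map n f (tmul s m) = tmul s (f.lin m) := rfl

lemma smul_tmul (s t : E.SLoc n) (m : M.carrier) : s • (tmul t m : Level M n) = tmul (s * t) m :=
  rfl

lemma incl_smul (s : E.SLoc n) (x : Level M n) : incl M n (s • x) = E.inclLoc n s • incl M n x :=
  extendScalars_smul _ _ _ _

lemma frob_incl (x : Level M n) : frob M (n + 1) (incl M n x) = incl M n (frob M n x) := by
  induction x using Level.induction with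
  | h0 => simp only [map_zero]
  | ha x y hx hy => simp only [map_add, hx, hy]
  | ht s m => simp only [incl_tmul, frob_tmul, NormalizedPoly.frobLoc_inclLoc]

lemma frob_bk_smul (g : BKRing p k) (x : Level M n) :
    frob M n (g • x) = frobBK p k g • frob M n x := by
  rw [bk_smul_def, map_smulₛₗ, E.frobLoc_toLoc, E.frobS_twistS, ← bk_smul_def]

lemma frob_bk_smul_succ (g : BKRing p k) (x : Level M (n + 1)) :
    frob M (n + 1) (g • x) = E.inclLoc n (E.toLoc n (E.twistS n g)) • frob M (n + 1) x := by
  rw [bk_smul_def, map_smulₛₗ, E.frobLoc_toLoc, E.frobS_twistS_succ, E.inclLoc_toLoc]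

lemma map_frob {N : BreuilMod E r} (f : M ⟶ N) (x : Level M n) :
    map n f (frob M n x) = frob N n (map n f x) := by
  induction x using Level.induction with
  | h0 => simp only [map_zero]
  | ha x y hx hy => simp only [map_add, hx, hy]
  | ht s m => simp only [map_tmul, frob_tmul, BreuilMod.map_phi]

lemma map_incl {N : BreuilMod E r} (f : M ⟶ N) (x : Level M n) :
    map (n + 1) f (incl M n x) = incl N n (map n f x) := by
  induction x using Level.induction with
  | h0 => simp only [map_zero]
  | ha x y hx hy => simp only [map_add, hx, hy]
  | ht s m => simp only [map_tmul, incl_tmul]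

lemma map_mem_fil {N : BreuilMod E r} (f : M ⟶ N) (j : ℤ) {x : Level M n} (hx : x ∈ fil M n j) :
    map n f x ∈ fil N n j := by
  induction hx using Submodule.span_induction with
  | zero => rw [map_zero]; exact zero_mem _
  | add x y _ _ hx hy => rw [map_add]; exact add_mem hx hy
  | smul a x _ hx => rw [smul_def', map_smul, ← smul_def']; exact Submodule.smul_mem _ _ hx
  | mem x hx =>
    obtain ⟨a, b, hab, m, hm, rfl⟩ := hx
    exact Submodule.subset_span ⟨a, b, hab, f.lin m, BreuilMod.map_fil f b hm, rfl⟩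

lemma one_tmul_mem_fil (m : M.carrier) : (tmul 1 m : Level M n) ∈ fil M n 0 :=
  Submodule.subset_span ⟨0, 0, rfl, m, BreuilMod.fil_of_nonpos M le_rfl m, by simp⟩

lemma toLoc_tmul_mem_fil (s : E.S n) (m : M.carrier) :
    (tmul (E.toLoc n s) m : Level M n) ∈ fil M n 0 := by
  have h := Submodule.smul_mem (fil M n 0) s (one_tmul_mem_fil m)
  rwa [smul_def', smul_tmul, mul_one] at h

lemma mem_fil_zero (x : Level M 0) : x ∈ fil M 0 0 := by
  induction x using Level.induction with
  | h0 => exact zero_mem _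
  | ha x y hx hy => exact add_mem hx hy
  | ht s m =>
    obtain ⟨s, rfl⟩ := E.toLoc_zero_surjective s
    exact toLoc_tmul_mem_fil s m

lemma incl_mem_fil {x : Level M n} (hx : x ∈ fil M n 0) : incl M n x ∈ fil M (n + 1) 0 := by
  induction hx using Submodule.span_induction with
  | zero => rw [map_zero]; exact zero_mem _
  | add x y _ _ hx hy => rw [map_add]; exact add_mem hx hy
  | smul a x _ hx =>
    rw [smul_def', incl_smul, E.inclLoc_toLoc, ← smul_def']
    exact Submodule.smul_mem _ _ hx
  | mem x hx =>
    obtain ⟨a, b, hab, m, hm, rfl⟩ := hx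
    rw [incl_tmul]
    rcases le_total 0 a with ha | ha
    · obtain ⟨a, rfl⟩ := Int.eq_ofNat_of_zero_le ha
      rw [zpow_natCast, Units.val_pow_eq_pow_val, E.coe_zUnit, map_pow,
        E.inclLoc_toLoc, ← map_pow]
      exact toLoc_tmul_mem_fil _ m
    · obtain ⟨a', rfl⟩ : ∃ a' : ℕ, a = -a' := ⟨a.natAbs, by omega⟩
      obtain ⟨w, hw⟩ := E.inclS_zS_dvd n
      have h : E.inclLoc n ((E.zUnit n ^ (-(a' : ℤ)) : (E.SLoc n)ˣ) : E.SLoc n) =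
          E.toLoc (n + 1) (w ^ a') *
            ((E.zUnit (n + 1) ^ (-(a' : ℤ)) : (E.SLoc (n + 1))ˣ) : E.SLoc (n + 1)) := by
        have e2 : (E.zUnit (n + 1) : E.SLoc (n + 1)) =
            (Units.map (E.inclLoc n : E.SLoc n →* E.SLoc (n + 1)) (E.zUnit n) : E.SLoc (n + 1)) *
              E.toLoc (n + 1) w := by
          rw [E.coe_zUnit, hw, map_mul, ← E.inclLoc_toLoc]
          rfl
        have e1 : E.inclLoc n ((E.zUnit n ^ (-(a' : ℤ)) : (E.SLoc n)ˣ) : E.SLoc n) =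
            ((Units.map (E.inclLoc n : E.SLoc n →* E.SLoc (n + 1)) (E.zUnit n) ^ (-(a' : ℤ)) :
              (E.SLoc (n + 1))ˣ) : E.SLoc (n + 1)) := by
          rw [← map_zpow]
          rfl
        rw [e1, zpow_neg, zpow_neg, zpow_natCast, zpow_natCast, Units.eq_mul_inv_iff_mul_eq,
          Units.val_pow_eq_pow_val, e2, mul_pow, ← mul_assoc, ← Units.val_pow_eq_pow_val,
          Units.inv_mul, one_mul, map_pow]
      rw [h, ← smul_tmul, ← smul_def']
      exact Submodule.smul_mem _ _ (Submodule.subset_span ⟨-a', b, hab, m, hm, rfl⟩)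

end Level

/-- The `𝔖`-module `M̲(𝓜)` of the sequences `(ξ_n)` with `ξ_n ∈ Fil^0(S_n[z_n⁻¹] ⊗_S 𝓜)` and
`(φ ⊗ φ_𝓜)(ξ_{n+1}) = ξ_n` for all `n ≥ 0`. Here `g ∈ 𝔖` acts on `ξ_n` as `g^{σ^{-n}}(u_n)`; the
second condition is an equality in `S_{n+1}[z_{n+1}⁻¹] ⊗_S 𝓜`, which contains the element `ξ_n` of
`S_n[z_n⁻¹] ⊗_S 𝓜`. -/
noncomputable def limModule (M : BreuilMod E r) :
    Submodule (BKRing p k) (∀ n, Level M n) where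
  carrier := {ξ | (∀ n, ξ n ∈ Level.fil M n 0) ∧
    ∀ n, Level.frob M (n + 1) (ξ (n + 1)) = Level.incl M n (ξ n)}
  zero_mem' := ⟨fun _ => zero_mem _, fun _ => by simp⟩
  add_mem' hx hy := ⟨fun n => add_mem (hx.1 n) (hy.1 n), fun n => by
    simp only [Pi.add_apply, map_add, hx.2 n, hy.2 n]⟩
  smul_mem' g ξ hξ := ⟨fun n => Submodule.smul_mem _ (E.twistS n g) (hξ.1 n), fun n => by
    rw [Pi.smul_apply, Pi.smul_apply, Level.frob_bk_smul_succ, hξ.2 n, Level.bk_smul_def,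
      Level.incl_smul]⟩

/-- The filtration `Fil^i M̲(𝓜) = {(ξ_n) : ξ_0 ∈ Fil^i 𝓜}`. -/
noncomputable def limFil (M : BreuilMod E r) (i : ℤ) :
    Submodule (BKRing p k) (limModule M) where
  carrier := {ξ | ∃ m ∈ BreuilMod.fil M i, ξ.1 0 = Level.tmul 1 m}
  zero_mem' := ⟨0, zero_mem _, by
    exact (TensorProduct.tmul_zero (M := E.SLoc 0) M.carrier (1 : E.SLoc 0)).symm⟩
  add_mem' := by
    rintro ξ η ⟨x, hx, hx'⟩ ⟨y, hy, hy'⟩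
    refine ⟨x + y, add_mem hx hy, ?_⟩
    have : (ξ + η).1 0 = ξ.1 0 + η.1 0 := rfl
    rw [this, hx', hy']
    exact (TensorProduct.tmul_add (1 : E.SLoc 0) x y).symm
  smul_mem' := by
    rintro g ξ ⟨x, hx, hx'⟩
    refine ⟨algebraMap (BKRing p k) (E.S 0) g • x, Submodule.smul_mem _ _ hx, ?_⟩
    have : (g • ξ).1 0 = g • ξ.1 0 := rfl
    rw [this, hx', Level.bk_smul_def, E.twistS_zero, Level.smul_tmul, mul_one]
    have h2 : E.toLoc 0 (algebraMap (BKRing p k) (E.S 0) g) =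
      (algebraMap (BKRing p k) (E.S 0) g) • (1 : E.SLoc 0) := by
      rw [Algebra.smul_def, mul_one]; rfl
    rw [h2]
    exact TensorProduct.smul_tmul _ _ _

/-- The Frobenius `(ξ_n) ↦ ((φ ⊗ φ_𝓜)(ξ_n))` of `M̲(𝓜)`. -/
noncomputable def limFrob (M : BreuilMod E r) : limModule M →ₛₗ[frobBK p k] limModule M where
  toFun ξ := ⟨fun n => Level.frob M n (ξ.1 n), by
    refine ⟨fun n => ?_, fun n => ?_⟩
    · cases n with
      | zero => exact Level.mem_fil_zero _
      | succ n =>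
        change Level.frob M (n + 1) (ξ.1 (n + 1)) ∈ _
        rw [ξ.2.2 n]
        exact Level.incl_mem_fil (ξ.2.1 n)
    · change Level.frob M (n + 1) (Level.frob M (n + 1) (ξ.1 (n + 1))) = _
      rw [ξ.2.2 n, Level.frob_incl]⟩
  map_add' ξ η := Subtype.ext (funext fun n => map_add (Level.frob M n) (ξ.1 n) (η.1 n))
  map_smul' g ξ := Subtype.ext (funext fun n => Level.frob_bk_smul g (ξ.1 n))

variable (E r) in
/-- The construction `𝓜 ↦ (M̲(𝓜), Fil^r M̲(𝓜), φ_{M̲})`. -/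
noncomputable def preLim : BreuilMod E r ⥤ PhiModule (BKRing p k) (frobBK p k) where
  obj M :=
    { carrier := limModule M
      Fil := limFil M r
      frob := limFrob M }
  map {M N} f :=
    { lin :=
        { toFun := fun ξ => ⟨fun n => Level.map n f (ξ.1 n),
            fun n => Level.map_mem_fil f 0 (ξ.2.1 n), fun n => by
              rw [← Level.map_frob, ξ.2.2 n, Level.map_incl]⟩
          map_add' := fun ξ η =>
            Subtype.ext (funext fun n => map_add (Level.map n f) (ξ.1 n) (η.1 n))
          map_smul' := fun g ξ =>
            Subtype.ext (funext fun n => map_smul (Level.map n f) _ (ξ.1 n)) }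
      map_fil := by
        rintro ξ ⟨m, hm, h⟩
        refine ⟨f.lin m, BreuilMod.map_fil f _ hm, ?_⟩
        exact (congrArg (Level.map 0 f) h).trans (Level.map_tmul f 1 m)
      map_frob := fun ξ => Subtype.ext (funext fun n => Level.map_frob f (ξ.1 n)) }
  map_id M := by
    apply PhiModule.hom_ext
    ext1 ξ
    exact Subtype.ext (funext fun n =>
      LinearMap.congr_fun (LinearMap.baseChange_id (A := E.SLoc n)) (ξ.1 n))
  map_comp f g := by
    apply PhiModule.hom_ext
    ext1 ξ
    exact Subtype.ext (funext fun n =>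
      LinearMap.congr_fun (LinearMap.baseChange_comp (A := E.SLoc n) f.lin g.lin) (ξ.1 n))

end Functors

section Final

variable {p : ℕ} [Fact p.Prime] {k : Type u} [Field k] [CharP k p] [PerfectRing k p]

/-- For every filtered Breuil–Kisin module `M`, the base change `(S ⊗ M, Fil^r, p^{-r} (φ ⊗ φ_M))`
is a quasi-Breuil module. -/
def BaseChangeIsBreuil (E : NormalizedPoly p k) (r : ℕ) : Prop :=
  ∀ M : BKMod E r, ((preBaseChange E r).obj M).IsDivided (E.FilS 0 r) p ((p : E.S 0) ^ r)

/-- For every quasi-Breuil module `𝓜`, the triple `(M̲(𝓜), Fil^r M̲(𝓜), φ(E)^{-r} φ_{M̲})` is a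
filtered Breuil–Kisin module. -/
def LimIsBK (E : NormalizedPoly p k) (r : ℕ) : Prop :=
  ∀ M : BreuilMod E r,
    ((preLim E r).obj M).IsDivided (Ideal.span {E.ser ^ r}) p (frobBK p k E.ser ^ r)

/-- The base change functor `Mod_𝔖^{φ,r} ⥤ Mod_S^{φ,r}`. -/
noncomputable def baseChangeFunctor {E : NormalizedPoly p k} {r : ℕ}
    (h : BaseChangeIsBreuil E r) : BKMod E r ⥤ BreuilMod E r :=
  PhiModule.dividedFunctor (preBaseChange E r) h

/-- The functor `M̲ : Mod_S^{φ,r} ⥤ Mod_𝔖^{φ,r}`, `𝓜 ↦ lim_{φ,n} Fil^0 (𝓜 ⊗_S S_n[z_n⁻¹])`. -/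
noncomputable def limFunctor {E : NormalizedPoly p k} {r : ℕ}
    (h : LimIsBK E r) : BreuilMod E r ⥤ BKMod E r :=
  PhiModule.dividedFunctor (preLim E r) h

/-- The discrete valuation ring `O` is the ring of integers of a finite totally ramified extension
of `W(k)[1/p]`: it is finite and torsion free over `W(k)`, with the same residue field. -/
structure IsTotallyRamified (p : ℕ) [Fact p.Prime] (k : Type*) [Field k] [CharP k p]
    [PerfectRing k p] (O : Type*) [CommRing O] [IsDomain O] [IsDiscreteValuationRing O]
    [Algebra (WittVector p k) O] : Prop where
  finite : Module.Finite (WittVector p k) O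
  injective : Function.Injective (algebraMap (WittVector p k) O)
  residue : ∀ x : O, ∃ a : WittVector p k,
    x - algebraMap (WittVector p k) O a ∈ IsLocalRing.maximalIdeal O

/-- `E` is the minimal polynomial of `π` over `W(k)`, rescaled by a unit so as to have constant
term `p`. -/
def NormalizedPoly.IsMinpoly (E : NormalizedPoly p k) {O : Type*} [CommRing O]
    [Algebra (WittVector p k) O] (π : O) : Prop :=
  ∃ c : (WittVector p k)ˣ, E.poly = Polynomial.C (c : WittVector p k) * minpoly (WittVector p k) π

end Final

end BreuilKisin

/-!
The base change functor `M ↦ S ⊗ M` is shown to be essentially surjective, and the functor `M̲` to be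
a faithful left inverse of it; formally, such functors are quasi-inverse to each other
(`nonempty_comp_iso_id`).

*The rings.* Modulo `p` the polynomial `E` is `u ^ m` times a unit (`exists_hasOrder`). So `E` and
`u_n ^ (m p ^ n)` have the same divided powers up to those of `p`, and `S_n` embeds in
`W(k)[1/p]⟦u_n⟧`, with image in the series whose coefficient of degree `j` has denominator dividing
`⌊j / (m p ^ n)⌋!` (`toFrac_injective`). This makes all rings in sight domains, makes all Frobenius
maps and inclusions injective, and shows that `𝔖_n` is `p`-adically closed in `S_n`
(`mem_range_of_forall_pow`). The other inputs are `S_n = 𝔖_n + Fil^p S_n` (`exists_add_FilS`),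
`𝔖_n ∩ Fil^M S_n = E ^ M 𝔖_n` for `M ≤ p` (`pow_dvd_of_mem_FilS`), and the divisibility of
`φ(Fil^e S_n)` by `p ^ e` for `e ≤ p - 1` (`pow_dvd_frobS`). They imply
`Fil^r (S ⊗ M) = Fil^r M + Fil^p S ⊗ M`, from which `S ⊗ M` is seen to be a quasi-Breuil module
(`baseChangeIsBreuil`).

*The left inverse.* Let `(ξ_n)` be a compatible sequence of `S ⊗ M`. By definition of the
filtration, `z_n ^ r ξ_n` is in `𝔖_n ⊗ Fil^r M + Fil^p S_n ⊗ M`. Since `φ(z_{n+1}) = φ(E) z_n`,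
dividing `φ(z_{n+1} ^ r ξ_{n+1})` by `φ(E) ^ r` gives `z_n ^ r ξ_n`; this operation maps
`𝔖_{n+1} ⊗ Fil^r M` to `𝔖_n ⊗ M`, and maps `Fil^p S_{n+1} ⊗ M` to `p ^ (p - 1 - r) (S_n ⊗ M)`. As
`r < p - 1`, it is contracting, so that `z_n ^ r ξ_n` is a limit of elements of `𝔖_n ⊗ M`
(`exists_approx`); for `n = 0` this says `ξ_0 ∈ M` (`exists_eq_lm`). Conversely each element of `M`
lifts to a compatible sequence (`exists_limModule`), which is unique because `φ` is injective at
the levels `n ≥ 1`, where `φ(E)` is invertible (`frob_injective`). Hence `ξ ↦ ξ_0` identifies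
`M̲(S ⊗ M)` with `M` (`limPhiIso`).

*Essential surjectivity.* Let `𝓜` be a quasi-Breuil module of rank `d` and `ϕ` the divided Frobenius
`c₀^{-r} φ_{𝓜,r}`. Modulo `Fil^p S ⬝ 𝓜` the submodule `Fil^r 𝓜` is generated by `d` vectors, by
reduction to the principal ideal domain `k⟦u⟧` (`exists_generators`). What is needed is a basis `e`
of `𝓜` and a matrix `A` over `𝔖` such that the vectors `e A` are in `Fil^r 𝓜`, generate it modulo
`Fil^p S ⬝ 𝓜`, and satisfy `ϕ(e A) = e`. These are found by successive approximation: `ϕ` is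
divisible by `p` on `Fil^p S ⬝ 𝓜`, again because `r < p - 1`, so that an error in `Fil^p S ⬝ 𝓜`
improves by a factor `p` (`BreuilMod.IsApprox.succ`, `BreuilMod.exists_phiC_eq_basis`). The
`𝔖`-span of `e` is then a filtered Breuil–Kisin module with base change `𝓜` (`exists_bc_iso`). In
particular `M̲(𝓜)` is a filtered Breuil–Kisin module for every `𝓜` (`limIsBK`).
-/

namespace BreuilKisin

open scoped TensorProduct

universe u v

/-! ### Elementwise `p`-adic completeness -/

section Adic

lemma smodEq_span_singleton_iff {R : Type*} [CommRing R] (a : R) (n : ℕ) (x y : R) :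
    x ≡ y [SMOD (Ideal.span {a} ^ n • ⊤ : Ideal R)] ↔ a ^ n ∣ x - y := by
  rw [SModEq.sub_mem, smul_eq_mul, Ideal.mul_top, Ideal.span_singleton_pow,
    Ideal.mem_span_singleton]

lemma eq_zero_of_forall_pow_dvd {R : Type*} [CommRing R] (a : R)
    [h : IsHausdorff (Ideal.span {a}) R] {x : R} (hx : ∀ n, a ^ n ∣ x) : x = 0 :=
  h.haus x fun n => (smodEq_span_singleton_iff a n x 0).mpr (by simpa using hx n)

/-- A sequence whose `n`-th increment is divisible by `a ^ n` converges `a`-adically. -/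
lemma exists_limit {R : Type*} [CommRing R] (a : R) [h : IsPrecomplete (Ideal.span {a}) R]
    (f : ℕ → R) (hf : ∀ n, a ^ n ∣ f (n + 1) - f n) : ∃ L, ∀ n, a ^ n ∣ L - f n := by
  have key : ∀ m n, m ≤ n → a ^ m ∣ f n - f m := by
    intro m n hmn
    induction n, hmn using Nat.le_induction with
    | base => simp
    | succ n hmn ih =>
      have := ((pow_dvd_pow a hmn).trans (hf n)).add ih
      simpa using this
  obtain ⟨L, hL⟩ := h.prec (f := f) fun {m n} hmn =>
    ((smodEq_span_singleton_iff a m _ _).mpr (key m n hmn)).symm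
  exact ⟨L, fun n => (smodEq_span_singleton_iff a n _ _).mp (hL n).symm⟩

lemma isAdicComplete_span_singleton {R : Type*} [CommRing R] (a : R)
    (h1 : ∀ x : R, (∀ n, a ^ n ∣ x) → x = 0)
    (h2 : ∀ f : ℕ → R, (∀ n, a ^ n ∣ f (n + 1) - f n) → ∃ L, ∀ n, a ^ n ∣ L - f n) :
    IsAdicComplete (Ideal.span {a}) R where
  haus' x hx := h1 x fun n => by simpa using (smodEq_span_singleton_iff a n x 0).mp (hx n)
  prec' f hf := by
    obtain ⟨L, hL⟩ := h2 f fun n =>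
      (smodEq_span_singleton_iff a n _ _).mp (hf (Nat.le_succ n)).symm
    exact ⟨L, fun n => ((smodEq_span_singleton_iff a n _ _).mpr (hL n)).symm⟩

/-- A ring whose additive group is a product of copies of a `p`-adically complete ring is
`p`-adically complete, since `p ^ n x` only depends on the additive structure. -/
lemma isAdicComplete_of_addEquiv_pi {R W ι : Type*} [CommRing R] [CommRing W] (p : ℕ)
    [IsAdicComplete (Ideal.span {(p : W)}) W] (e : R ≃+ (ι → W)) :
    IsAdicComplete (Ideal.span {(p : R)}) R := by
  have hdvd : ∀ n (x : R), (p : R) ^ n ∣ x ↔ ∀ i, (p : W) ^ n ∣ e x i := by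
    intro n x
    constructor
    · rintro ⟨y, rfl⟩ i
      refine ⟨e y i, ?_⟩
      have h : (p : R) ^ n * y = (p ^ n) • y := by rw [nsmul_eq_mul]; push_cast; ring
      rw [h, map_nsmul, Pi.smul_apply, nsmul_eq_mul]
      push_cast
      ring
    · intro h
      choose y hy using h
      refine ⟨e.symm y, e.injective ?_⟩
      have h : (p : R) ^ n * e.symm y = (p ^ n) • e.symm y := by
        rw [nsmul_eq_mul]; push_cast; ring
      rw [h, map_nsmul, e.apply_symm_apply]
      funext i
      rw [hy, Pi.smul_apply, nsmul_eq_mul]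
      push_cast
      ring
  apply isAdicComplete_span_singleton
  · intro x hx
    apply e.injective
    rw [map_zero]
    funext i
    exact eq_zero_of_forall_pow_dvd (p : W) fun n => (hdvd n x).mp (hx n) i
  · intro f hf
    have : ∀ i, ∃ L, ∀ n, (p : W) ^ n ∣ L - e (f n) i := fun i =>
      exists_limit (p : W) (fun n => e (f n) i) fun n => by
        have := (hdvd n _).mp (hf n) i
        rwa [map_sub, Pi.sub_apply] at this
    choose L hL using this
    refine ⟨e.symm L, fun n => (hdvd n _).mpr fun i => ?_⟩
    rw [map_sub, e.apply_symm_apply, Pi.sub_apply]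
    exact hL i n

/-- In the completion along a principal ideal, the kernel of the reduction modulo `a ^ n` is
generated by `a ^ n`; no noetherian hypothesis is needed, since the ideal is finitely generated. -/
lemma ker_evalₐ_span_singleton {A : Type*} [CommRing A] (a : A) (n : ℕ)
    {x : AdicCompletion (Ideal.span {a}) A}
    (hx : AdicCompletion.evalₐ (Ideal.span {a}) n x = 0) :
    algebraMap A (AdicCompletion (Ideal.span {a}) A) a ^ n ∣ x := by
  have hfg : (Ideal.span {a}).FG := ⟨{a}, by simp⟩
  have h1 : AdicCompletion.eval (Ideal.span {a}) A n x = 0 := by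
    have hle : Ideal.span {a} ^ n ≤ Ideal.span {a} ^ n • (⊤ : Ideal A) := by simp
    rw [← AdicCompletion.factor_evalₐ_eq_eval _ x hle, hx, map_zero]
  have h2 : x ∈ (AdicCompletion.eval (Ideal.span {a}) A n).ker := h1
  rw [← AdicCompletion.pow_smul_top_eq_ker_eval hfg, Ideal.span_singleton_pow,
    Submodule.ideal_span_singleton_smul] at h2
  obtain ⟨y, -, rfl⟩ := (Submodule.mem_smul_pointwise_iff_exists _ _ _).mp h2
  exact ⟨y, by rw [← map_pow, Algebra.smul_def]⟩

end Adic

section SAdic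

variable {p : ℕ} [Fact p.Prime] {k : Type u} [Field k] [CharP k p] [PerfectRing k p]

namespace NormalizedPoly

variable (E : NormalizedPoly p k)

instance isAdicComplete_S (n : ℕ) : IsAdicComplete (Ideal.span {(p : E.S n)}) (E.S n) := by
  have hfg : (Ideal.span {(p : E.PDEnv n)}).FG := ⟨{(p : E.PDEnv n)}, by simp⟩
  have hc : IsAdicComplete ((Ideal.span {(p : E.PDEnv n)}).map
      (algebraMap (E.PDEnv n) (E.S n))) (E.S n) := AdicCompletion.isAdicComplete_self _ hfg
  rwa [Ideal.map_span, Set.image_singleton, map_natCast] at hc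

lemma p_mem_jacobson (n : ℕ) : Ideal.span {(p : E.S n)} ≤ (⊥ : Ideal (E.S n)).jacobson :=
  IsAdicComplete.le_jacobson_bot _

/-- Reduction modulo `p ^ N`, from `S_n` to the quotient of the divided power envelope. -/
noncomputable def evalS (n N : ℕ) : E.S n →+* E.PDEnv n ⧸ Ideal.span {(p : E.PDEnv n)} ^ N :=
  (AdicCompletion.evalₐ (Ideal.span {(p : E.PDEnv n)}) N : PCompletion p (E.PDEnv n) →+* _)

lemma evalS_algebraMap (n N : ℕ) (d : E.PDEnv n) :
    E.evalS n N (algebraMap (E.PDEnv n) (E.S n) d) = Ideal.Quotient.mk _ d :=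
  AlgHom.commutes (AdicCompletion.evalₐ (Ideal.span {(p : E.PDEnv n)}) N) d

lemma pow_dvd_of_evalS_eq_zero (n N : ℕ) {s : E.S n} (h : E.evalS n N s = 0) :
    (p : E.S n) ^ N ∣ s := by
  obtain ⟨t, ht⟩ := ker_evalₐ_span_singleton (p : E.PDEnv n) N h
  refine ⟨t, ht.trans ?_⟩
  rw [map_natCast]
  rfl

/-- The divided power envelope is `p`-adically dense in `S_n`. -/
lemma exists_eq_algebraMap_add (n N : ℕ) (s : E.S n) :
    ∃ (d : E.PDEnv n) (t : E.S n), s = algebraMap (E.PDEnv n) (E.S n) d + (p : E.S n) ^ N * t := by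
  obtain ⟨d, hd⟩ := Ideal.Quotient.mk_surjective (E.evalS n N s)
  obtain ⟨t, ht⟩ := E.pow_dvd_of_evalS_eq_zero n N
    (s := s - algebraMap (E.PDEnv n) (E.S n) d) (by
      rw [map_sub, evalS_algebraMap, hd, sub_self])
  exact ⟨d, t, by rw [← ht]; ring⟩

/-- The map from the divided power envelope to `S_n` reflects divisibility by `p ^ N`. -/
lemma pow_dvd_of_algebraMap (n N : ℕ) (d : E.PDEnv n)
    (h : (p : E.S n) ^ N ∣ algebraMap (E.PDEnv n) (E.S n) d) : (p : E.PDEnv n) ^ N ∣ d := by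
  obtain ⟨t, ht⟩ := h
  have h1 := congrArg (E.evalS n N) ht
  rw [evalS_algebraMap, map_mul, map_pow, map_natCast] at h1
  rw [← Ideal.mem_span_singleton, ← Ideal.span_singleton_pow, ← Ideal.Quotient.eq_zero_iff_mem,
    h1]
  have : ((p : E.PDEnv n ⧸ Ideal.span {(p : E.PDEnv n)} ^ N)) ^ N = 0 := by
    rw [← map_natCast (Ideal.Quotient.mk _), ← map_pow]
    exact Ideal.Quotient.eq_zero_iff_mem.mpr
      (by rw [Ideal.span_singleton_pow]; exact Ideal.mem_span_singleton_self _)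
  rw [this, zero_mul]

end NormalizedPoly

end SAdic

/-! ### Embedding `S_n` in `W(k)[1/p]⟦u_n⟧` -/

section Lattice

variable {p : ℕ} [Fact p.Prime] {k : Type u} [Field k] [CharP k p] [PerfectRing k p]

open PowerSeries in
instance isAdicComplete_BKRing : IsAdicComplete (Ideal.span {(p : BKRing p k)}) (BKRing p k) :=
  isAdicComplete_of_addEquiv_pi (W := WittVector p k) (ι := ℕ) p
    { toFun := fun f j => coeff j f
      invFun := PowerSeries.mk
      left_inv := fun f => by ext j : 1; simp
      right_inv := fun f => by funext j; simp
      map_add' := fun f g => by funext j; simp }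

lemma algebraMap_witt_injective :
    Function.Injective (algebraMap (WittVector p k) (WittFrac p k)) :=
  IsFractionRing.injective _ _

lemma coeff_algebraMap_BK (g : BKRing p k) (j : ℕ) :
    PowerSeries.coeff j (algebraMap (BKRing p k) (PowerSeries (WittFrac p k)) g) =
      algebraMap (WittVector p k) (WittFrac p k) (PowerSeries.coeff j g) := by
  have h2 : (algebraMap (BKRing p k) (PowerSeries (WittFrac p k))) =
    PowerSeries.map (algebraMap (WittVector p k) (WittFrac p k)) := rfl
  rw [h2, PowerSeries.coeff_map]

lemma algebraMap_BK_injective :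
    Function.Injective (algebraMap (BKRing p k) (PowerSeries (WittFrac p k))) := by
  intro f g h
  ext j : 1
  apply algebraMap_witt_injective
  rw [← coeff_algebraMap_BK, ← coeff_algebraMap_BK, h]

lemma mem_range_algebraMap_BK {f : PowerSeries (WittFrac p k)}
    (h : ∀ j, PowerSeries.coeff j f ∈ (algebraMap (WittVector p k) (WittFrac p k)).range) :
    ∃ g : BKRing p k, algebraMap (BKRing p k) (PowerSeries (WittFrac p k)) g = f := by
  choose w hw using h
  refine ⟨PowerSeries.mk w, ?_⟩
  ext j : 1
  rw [coeff_algebraMap_BK, PowerSeries.coeff_mk, hw]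

lemma coeff_natCast_mul {R : Type*} [CommRing R] (a j : ℕ) (f : PowerSeries R) :
    PowerSeries.coeff j ((a : PowerSeries R) * f) = a * PowerSeries.coeff j f := by
  rw [← nsmul_eq_mul, map_nsmul, nsmul_eq_mul]

lemma factorial_div_dvd {m : ℕ} (a b : ℕ) :
    (a / m).factorial * (b / m).factorial ∣ ((a + b) / m).factorial :=
  (Nat.factorial_mul_factorial_dvd_factorial_add _ _).trans
    (Nat.factorial_dvd_factorial (Nat.div_add_div_le_add_div))

variable (p k) in
/-- The subalgebra of `W(k)[1/p]⟦u⟧` of the series `∑ f_j u ^ j` with `⌊j / m⌋! f_j ∈ W(k)`. It is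
the product of the `W(k)`-lines spanned by the `u ^ j / ⌊j / m⌋!`, hence `p`-adically complete, and
it contains the divided power envelope of an element which is `u ^ m` times a unit modulo `p`. -/
def lat (m : ℕ) : Subalgebra (BKRing p k) (PowerSeries (WittFrac p k)) where
  carrier := {f | ∀ j, ((j / m).factorial : WittFrac p k) * PowerSeries.coeff j f ∈
    (algebraMap (WittVector p k) (WittFrac p k)).range}
  add_mem' hf hg j := by
    rw [map_add, mul_add]
    exact add_mem (hf j) (hg j)
  mul_mem' {f g} hf hg j := by
    rw [PowerSeries.coeff_mul, Finset.mul_sum]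
    refine sum_mem fun ab hab => ?_
    rw [Finset.HasAntidiagonal.mem_antidiagonal] at hab
    obtain ⟨c, hc⟩ := factorial_div_dvd (m := m) ab.1 ab.2
    rw [hab] at hc
    have h := mul_mem (natCast_mem (algebraMap (WittVector p k) (WittFrac p k)).range c)
      (mul_mem (hf ab.1) (hg ab.2))
    convert h using 1
    rw [hc]
    push_cast
    ring
  algebraMap_mem' g j := by
    rw [coeff_algebraMap_BK]
    exact mul_mem (natCast_mem _ _) ⟨_, rfl⟩

instance isAdicComplete_lat (m : ℕ) : IsAdicComplete (Ideal.span {(p : lat p k m)}) (lat p k m) := by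
  have hne := fun j : ℕ => NormalizedPoly.factorial_ne_zero (p := p) (k := k) (j / m)
  let F : (ℕ → WittVector p k) →+ lat p k m :=
    { toFun := fun w => ⟨PowerSeries.mk fun j =>
        ((j / m).factorial : WittFrac p k)⁻¹ * algebraMap _ _ (w j), fun j => by
          rw [PowerSeries.coeff_mk, mul_inv_cancel_left₀ (hne j)]
          exact ⟨_, rfl⟩⟩
      map_zero' := by
        apply Subtype.ext
        ext j : 1
        simp
      map_add' := fun w w' => by
        apply Subtype.ext
        ext j : 1
        simp [mul_add] }
  have hF : Function.Bijective F := by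
    constructor
    · intro w w' h
      funext j
      have h1 := congrArg (fun f : lat p k m => PowerSeries.coeff j f.1) h
      simp only [F, AddMonoidHom.coe_mk, ZeroHom.coe_mk, PowerSeries.coeff_mk] at h1
      exact algebraMap_witt_injective (mul_left_cancel₀ (inv_ne_zero (hne j)) h1)
    · rintro ⟨f, hf⟩
      have hf' := hf
      choose w hw using hf'
      refine ⟨w, Subtype.ext ?_⟩
      ext j : 1
      simp only [F, AddMonoidHom.coe_mk, ZeroHom.coe_mk, PowerSeries.coeff_mk]
      rw [hw, inv_mul_cancel_left₀ (hne j)]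
  exact isAdicComplete_of_addEquiv_pi (W := WittVector p k) p (AddEquiv.ofBijective F hF).symm

/-- The element `x` of `W(k)[1/p]⟦u⟧` has all its divided powers in the subalgebra `T`. -/
def HasDP (T : Subalgebra (BKRing p k) (PowerSeries (WittFrac p k)))
    (x : PowerSeries (WittFrac p k)) : Prop :=
  ∀ i : ℕ, ((i.factorial : WittFrac p k)⁻¹) • x ^ i ∈ T

namespace HasDP

variable {T : Subalgebra (BKRing p k) (PowerSeries (WittFrac p k))}
  {x y : PowerSeries (WittFrac p k)}

lemma add (hx : HasDP T x) (hy : HasDP T y) : HasDP T (x + y) := by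
  intro i
  rw [(Commute.all x y).add_pow', Finset.smul_sum]
  refine sum_mem fun ab hab => ?_
  rw [Finset.HasAntidiagonal.mem_antidiagonal] at hab
  convert mul_mem (hx ab.1) (hy ab.2) using 1
  rw [smul_mul_smul_comm, ← Nat.cast_smul_eq_nsmul (WittFrac p k), smul_smul]
  congr 1
  have h1 := NormalizedPoly.factorial_ne_zero (p := p) (k := k) i
  have h2 := NormalizedPoly.factorial_ne_zero (p := p) (k := k) ab.1
  have h3 := NormalizedPoly.factorial_ne_zero (p := p) (k := k) ab.2
  have h4 : (i.factorial : WittFrac p k) = i.choose ab.1 * ab.1.factorial * ab.2.factorial := by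
    have := Nat.choose_mul_factorial_mul_factorial (n := i) (k := ab.1) (by omega)
    have h5 : i - ab.1 = ab.2 := by omega
    rw [h5] at this
    rw [← this]
    push_cast
    ring
  rw [← mul_inv, inv_mul_eq_iff_eq_mul₀ h1, eq_mul_inv_iff_mul_eq₀ (mul_ne_zero h2 h3), h4]
  ring

lemma mul (hx : HasDP T x) (hy : y ∈ T) : HasDP T (x * y) := by
  intro i
  rw [mul_pow, ← smul_mul_assoc]
  exact mul_mem (hx i) (pow_mem hy i)

/-- As `p ^ i / i!` lies in `W(k)`, the element `p` has all its divided powers in `T`. -/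
lemma natCast_p : HasDP T (p : PowerSeries (WittFrac p k)) := by
  intro i
  obtain ⟨a, ha⟩ := NormalizedPoly.exists_factorial_mul (p := p) (k := k) i
  convert T.algebraMap_mem (PowerSeries.C a) using 1
  have h1 := NormalizedPoly.factorial_ne_zero (p := p) (k := k) i
  apply NormalizedPoly.factorial_cancel i
  rw [← nsmul_eq_mul, ← Nat.cast_smul_eq_nsmul (WittFrac p k), smul_smul, mul_inv_cancel₀ h1,
    one_smul, ← map_natCast (algebraMap (BKRing p k) (PowerSeries (WittFrac p k))),
    ← map_natCast (algebraMap (BKRing p k) (PowerSeries (WittFrac p k))), ← map_pow, ← map_mul]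
  congr 1
  have h4 : ∀ n : ℕ, (n : BKRing p k) = PowerSeries.C (n : WittVector p k) := fun n => by simp
  rw [h4, h4, ← map_pow, ← map_mul, ha]

end HasDP

lemma hasDP_lat {m : ℕ} (hm : 0 < m) :
    HasDP (lat p k m) ((PowerSeries.X : PowerSeries (WittFrac p k)) ^ m) := by
  intro i j
  rw [← pow_mul, PowerSeries.coeff_smul, PowerSeries.coeff_X_pow]
  split_ifs with h
  · rw [h, Nat.mul_div_cancel_left _ hm, smul_eq_mul,
      mul_one, mul_inv_cancel₀ (NormalizedPoly.factorial_ne_zero i)]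
    exact one_mem _
  · simp

/-- A subalgebra containing the divided powers of `u ^ m` contains all elements of `lat p k m` with
bounded denominators. -/
lemma mem_of_mem_lat {T : Subalgebra (BKRing p k) (PowerSeries (WittFrac p k))} {m : ℕ}
    (hT : HasDP T ((PowerSeries.X : PowerSeries (WittFrac p k)) ^ m))
    {f : PowerSeries (WittFrac p k)} (hf : f ∈ lat p k m) {n : ℕ} (hn : 0 < n)
    (hnf : ∃ g : BKRing p k, algebraMap _ (PowerSeries (WittFrac p k)) g = n * f) : f ∈ T := by
  have hX : ∀ j, (PowerSeries.X : PowerSeries (WittFrac p k)) ^ j ∈ T := fun j => by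
    convert T.algebraMap_mem (PowerSeries.X ^ j : BKRing p k) using 1
    have h2 : (algebraMap (BKRing p k) (PowerSeries (WittFrac p k))) =
      PowerSeries.map (algebraMap (WittVector p k) (WittFrac p k)) := rfl
    rw [h2, map_pow, PowerSeries.map_X]
  have hmon : ∀ j, PowerSeries.monomial j (PowerSeries.coeff j f) ∈ T := by
    intro j
    obtain ⟨w, hw⟩ := hf j
    have h1 := NormalizedPoly.factorial_ne_zero (p := p) (k := k) (j / m)
    convert mul_mem (mul_mem (T.algebraMap_mem (PowerSeries.C w)) (hX (j % m))) (hT (j / m))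
      using 1
    have h2 : (algebraMap (BKRing p k) (PowerSeries (WittFrac p k))) =
      PowerSeries.map (algebraMap (WittVector p k) (WittFrac p k)) := rfl
    rw [h2, PowerSeries.map_C, hw, mul_smul_comm, mul_assoc, ← pow_mul, ← pow_add,
      Nat.mod_add_div]
    ext i : 1
    rw [PowerSeries.coeff_monomial, PowerSeries.coeff_smul, PowerSeries.coeff_C_mul,
      PowerSeries.coeff_X_pow]
    split_ifs with h
    · rw [smul_eq_mul, mul_one, inv_mul_cancel_left₀ h1]
    · simp
  have htr : ((PowerSeries.trunc (m * n) f : Polynomial _) : PowerSeries (WittFrac p k)) ∈ T := by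
    have h : ((PowerSeries.trunc (m * n) f : Polynomial _) : PowerSeries (WittFrac p k)) =
        ∑ j ∈ Finset.range (m * n), PowerSeries.monomial j (PowerSeries.coeff j f) := by
      ext i : 1
      rw [Polynomial.coeff_coe, PowerSeries.coeff_trunc, map_sum]
      simp [PowerSeries.coeff_monomial]
    rw [h]
    exact sum_mem fun j _ => hmon j
  rw [PowerSeries.eq_shift_mul_X_pow_add_trunc (m * n) f]
  refine add_mem ?_ htr
  -- The tail is `(n! g) (u ^ m) ^ n / n!`, where `n! g` is integral because `n` divides `n!`.
  obtain ⟨g, hg⟩ := hnf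
  have hn1 := NormalizedPoly.factorial_ne_zero (p := p) (k := k) n
  obtain ⟨g', hg'⟩ := mem_range_algebraMap_BK
    (f := (n.factorial : PowerSeries (WittFrac p k)) *
      PowerSeries.mk fun i => PowerSeries.coeff (i + m * n) f) (fun i => by
        obtain ⟨c, hc⟩ := Nat.dvd_factorial hn le_rfl
        rw [coeff_natCast_mul, PowerSeries.coeff_mk, hc]
        have h3 := congrArg (PowerSeries.coeff (i + m * n)) hg
        rw [coeff_natCast_mul, coeff_algebraMap_BK] at h3
        refine ⟨c * PowerSeries.coeff (i + m * n) g, ?_⟩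
        rw [map_mul, h3, map_natCast]
        push_cast
        ring)
  convert mul_mem (T.algebraMap_mem g') (hT n) using 1
  rw [hg', ← pow_mul, mul_smul_comm, mul_assoc, ← nsmul_eq_mul,
    ← Nat.cast_smul_eq_nsmul (WittFrac p k), smul_smul, inv_mul_cancel₀ hn1, one_smul]

end Lattice

section Embedding

variable {p : ℕ} [Fact p.Prime] {k : Type u} [Field k] [CharP k p] [PerfectRing k p]

namespace NormalizedPoly

variable (E : NormalizedPoly p k)

/-- Modulo `p`, the polynomial `E` is `u ^ m` times a unit, with `m > 0`. -/
structure HasOrder (m : ℕ) : Prop where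
  pos : 0 < m
  exists_eq : ∃ v h : BKRing p k, IsUnit v ∧ E.ser = PowerSeries.X ^ m * v + (p : BKRing p k) * h

variable {E} {m : ℕ}

lemma inclBK_X_pow (m : ℕ) : inclBK p k (PowerSeries.X ^ m) = PowerSeries.X ^ (m * p) := by
  have h : inclBK p k PowerSeries.X = PowerSeries.X ^ p :=
    PowerSeries.expand_X p (Fact.out : p.Prime).ne_zero
  rw [map_pow, h, ← pow_mul, mul_comm]

/-- At level `n` one has `u_0 = u_n ^ (p ^ n)`, so that modulo `p` the element `E` is
`u_n ^ (m p ^ n)` times a unit. -/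
lemma HasOrder.elt (hm : E.HasOrder m) (n : ℕ) : ∃ v h : BKRing p k, IsUnit v ∧
    E.elt n = PowerSeries.X ^ (m * p ^ n) * v + (p : BKRing p k) * h := by
  induction n with
  | zero => simpa [NormalizedPoly.elt] using hm.exists_eq
  | succ n ih =>
    obtain ⟨v, h, hv, hE⟩ := ih
    refine ⟨inclBK p k v, inclBK p k h, hv.map _, ?_⟩
    rw [← inclBK_elt, hE, map_add, map_mul, map_mul, map_natCast, inclBK_X_pow, pow_succ,
      mul_assoc]

lemma HasOrder.pos' (hm : E.HasOrder m) (n : ℕ) : 0 < m * p ^ n :=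
  Nat.mul_pos hm.pos (pow_pos (Fact.out : p.Prime).pos n)

lemma hasDP_PDEnv (n : ℕ) : HasDP (E.PDEnv n) (algebraMap _ _ (E.elt n)) := fun i =>
  Algebra.subset_adjoin ⟨i, rfl⟩

lemma algebraMap_X_pow (m : ℕ) : algebraMap (BKRing p k) (PowerSeries (WittFrac p k))
    (PowerSeries.X ^ m) = PowerSeries.X ^ m := by
  have h2 : (algebraMap (BKRing p k) (PowerSeries (WittFrac p k))) =
    PowerSeries.map (algebraMap (WittVector p k) (WittFrac p k)) := rfl
  rw [h2, map_pow, PowerSeries.map_X]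

lemma PDEnv_le_lat (hm : E.HasOrder m) (n : ℕ) : E.PDEnv n ≤ lat p k (m * p ^ n) := by
  refine Algebra.adjoin_le ?_
  rintro _ ⟨i, rfl⟩
  obtain ⟨v, h, hv, hE⟩ := hm.elt n
  have : HasDP (lat p k (m * p ^ n)) (algebraMap _ _ (E.elt n)) := by
    rw [hE, map_add, map_mul, map_mul, map_natCast, algebraMap_X_pow]
    exact ((hasDP_lat (hm.pos' n)).mul (Subalgebra.algebraMap_mem _ _)).add
      (HasDP.natCast_p.mul (Subalgebra.algebraMap_mem _ _))
  exact this i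

/-- Modulo `p`, the element `u_n ^ (m p ^ n)` is conversely a multiple of `E`. -/
lemma hasDP_X_pow (hm : E.HasOrder m) (n : ℕ) :
    HasDP (E.PDEnv n) ((PowerSeries.X : PowerSeries (WittFrac p k)) ^ (m * p ^ n)) := by
  obtain ⟨v, h, ⟨v, rfl⟩, hE⟩ := hm.elt n
  have h1 : (PowerSeries.X ^ (m * p ^ n) : BKRing p k) =
      E.elt n * ↑v⁻¹ + p * (-h * ↑v⁻¹) := by
    have : (v : BKRing p k) * ↑v⁻¹ = 1 := by simp
    rw [hE]
    linear_combination (-PowerSeries.X ^ (m * p ^ n) : BKRing p k) * this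
  rw [← algebraMap_X_pow, h1, map_add, map_mul, map_mul, map_natCast]
  exact ((hasDP_PDEnv n).mul (Subalgebra.algebraMap_mem _ _)).add
    (HasDP.natCast_p.mul (Subalgebra.algebraMap_mem _ _))

/-- The elements of the divided power envelope have bounded denominators. -/
lemma exists_natCast_mul_mem (n : ℕ) {x : PowerSeries (WittFrac p k)} (hx : x ∈ E.PDEnv n) :
    ∃ a > 0, ∃ g : BKRing p k, algebraMap _ (PowerSeries (WittFrac p k)) g = (a : ℕ) * x := by
  induction hx using Algebra.adjoin_induction with
  | mem x hx =>
    obtain ⟨i, rfl⟩ := hx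
    exact ⟨i.factorial, i.factorial_pos, _, by rw [factorial_mul_divPow, map_pow]⟩
  | algebraMap r => exact ⟨1, one_pos, r, by simp⟩
  | add x y _ _ hx hy =>
    obtain ⟨a, ha, g, hg⟩ := hx
    obtain ⟨b, hb, h, hh⟩ := hy
    refine ⟨a * b, Nat.mul_pos ha hb, b * g + a * h, ?_⟩
    rw [map_add, map_mul, map_mul, hg, hh, map_natCast, map_natCast]
    push_cast
    ring
  | mul x y _ _ hx hy =>
    obtain ⟨a, ha, g, hg⟩ := hx
    obtain ⟨b, hb, h, hh⟩ := hy
    refine ⟨a * b, Nat.mul_pos ha hb, g * h, ?_⟩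
    rw [map_mul, hg, hh]
    push_cast
    ring

/-- The divided power envelope is saturated in `lat p k (m p ^ n)` for division by integers. -/
lemma mem_PDEnv_of_mem_lat (hm : E.HasOrder m) (n : ℕ) {f : PowerSeries (WittFrac p k)}
    (hf : f ∈ lat p k (m * p ^ n)) {a : ℕ} (ha : 0 < a)
    (h : (a : PowerSeries (WittFrac p k)) * f ∈ E.PDEnv n) : f ∈ E.PDEnv n := by
  obtain ⟨b, hb, g, hg⟩ := exists_natCast_mul_mem n h
  refine mem_of_mem_lat (hasDP_X_pow hm n) hf (Nat.mul_pos hb ha) ⟨g, ?_⟩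
  rw [hg]
  push_cast
  ring

/-- The map from `S_n` to the `p`-adically complete ring `lat p k (m p ^ n)` extending the
inclusion of the divided power envelope. -/
noncomputable def toLat (hm : E.HasOrder m) (n : ℕ) : E.S n →+* lat p k (m * p ^ n) :=
  ((AdicCompletion.ofAlgEquiv (Ideal.span {(p : lat p k (m * p ^ n))})).symm :
      PCompletion p (lat p k (m * p ^ n)) →+* lat p k (m * p ^ n)).comp
    (completionMap p ((Subalgebra.inclusion (PDEnv_le_lat hm n)).toRingHom))

lemma toLat_algebraMap (hm : E.HasOrder m) (n : ℕ) (d : E.PDEnv n) :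
    (toLat hm n (algebraMap (E.PDEnv n) (E.S n) d) : PowerSeries (WittFrac p k)) = d := by
  have h : completionMap p ((Subalgebra.inclusion (PDEnv_le_lat hm n)).toRingHom)
      (algebraMap (E.PDEnv n) (PCompletion p (E.PDEnv n)) d) = _ := completionMap_algebraMap p _ d
  have h2 := AdicCompletion.ofAlgEquiv_symm_of (Ideal.span {(p : lat p k (m * p ^ n))})
    (Subalgebra.inclusion (PDEnv_le_lat hm n) d)
  have h3 : toLat hm n (algebraMap (E.PDEnv n) (E.S n) d) =
    Subalgebra.inclusion (PDEnv_le_lat hm n) d :=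
    (congrArg (AdicCompletion.ofAlgEquiv (Ideal.span {(p : lat p k (m * p ^ n))})).symm h).trans h2
  rw [h3]
  rfl

/-- The embedding of `S_n` in `W(k)[1/p]⟦u_n⟧`. -/
noncomputable def toFrac (hm : E.HasOrder m) (n : ℕ) : E.S n →+* PowerSeries (WittFrac p k) :=
  ((lat p k (m * p ^ n)).val : lat p k (m * p ^ n) →+* _).comp (toLat hm n)

lemma toFrac_mem_lat (hm : E.HasOrder m) (n : ℕ) (s : E.S n) :
    toFrac hm n s ∈ lat p k (m * p ^ n) := (toLat hm n s).2

lemma toFrac_algebraMap (hm : E.HasOrder m) (n : ℕ) (d : E.PDEnv n) :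
    toFrac hm n (algebraMap (E.PDEnv n) (E.S n) d) = d := toLat_algebraMap hm n d

lemma toFrac_BK (hm : E.HasOrder m) (n : ℕ) (g : BKRing p k) :
    toFrac hm n (algebraMap (BKRing p k) (E.S n) g) = algebraMap _ _ g :=
  toFrac_algebraMap hm n _

/-- Since the divided power envelope is saturated in the lattice `lat p k (m p ^ n)`, the lattice
induces on it its own `p`-adic topology; hence the completion embeds. -/
lemma toFrac_injective (hm : E.HasOrder m) (n : ℕ) : Function.Injective (toFrac hm n) := by
  rw [injective_iff_map_eq_zero]
  intro s hs
  refine eq_zero_of_forall_pow_dvd (p : E.S n) fun N => ?_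
  obtain ⟨d, t, rfl⟩ := E.exists_eq_algebraMap_add n N s
  rw [map_add, toFrac_algebraMap, map_mul, map_pow, map_natCast] at hs
  have h2 : -toFrac hm n t ∈ E.PDEnv n := by
    refine mem_PDEnv_of_mem_lat hm n (neg_mem (toFrac_mem_lat hm n t))
      (a := p ^ N) (pow_pos (Fact.out : p.Prime).pos N) ?_
    convert d.2 using 1
    push_cast
    linear_combination -hs
  have h3 : d = (p : E.PDEnv n) ^ N * ⟨_, h2⟩ := by
    apply Subtype.ext
    push_cast
    linear_combination hs
  rw [h3, map_mul, map_pow, map_natCast]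
  exact dvd_add (Dvd.intro _ rfl) (Dvd.intro _ rfl)

/-- The lattices `lat p k M` are `p`-adically separated. -/
lemma eq_zero_of_mem_lat {M : ℕ} {x : PowerSeries (WittFrac p k)}
    (h : ∀ N, ∃ y ∈ lat p k M, x = (p : PowerSeries (WittFrac p k)) ^ N * y) : x = 0 := by
  have hx : x ∈ lat p k M := by
    obtain ⟨y, hy, rfl⟩ := h 0
    simpa using hy
  have : (⟨x, hx⟩ : lat p k M) = 0 := eq_zero_of_forall_pow_dvd (p : lat p k M) fun N => by
    obtain ⟨y, hy, hxy⟩ := h N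
    exact ⟨⟨y, hy⟩, Subtype.ext (by push_cast; exact hxy)⟩
  exact congrArg Subtype.val this

lemma frobFrac_mem_lat {M : ℕ} {x : PowerSeries (WittFrac p k)} (hx : x ∈ lat p k M) :
    frobFrac p k x ∈ lat p k M := by
  intro j
  rw [frobFrac, RingHom.comp_apply, coeff_expandHom, PowerSeries.coeff_map]
  split_ifs with h
  · obtain ⟨i, rfl⟩ := h
    have hp := (Fact.out : p.Prime).pos
    rw [Nat.mul_div_cancel_left _ hp]
    obtain ⟨c, hc⟩ := Nat.factorial_dvd_factorial
      (Nat.div_le_div_right (c := M) (Nat.le_mul_of_pos_left i hp))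
    obtain ⟨w, hw⟩ := hx i
    refine ⟨c * WittVector.frobenius w, ?_⟩
    have h1 : WittVector.FractionRing.frobeniusRingHom p k
        (algebraMap (WittVector p k) (WittFrac p k) w) =
          algebraMap (WittVector p k) (WittFrac p k) (WittVector.frobenius w) :=
      IsFractionRing.ringEquivOfRingEquiv_algebraMap (WittVector.frobeniusEquiv p k) w
    rw [map_mul, ← h1, hw, map_mul, map_natCast, map_natCast, hc]
    push_cast
    ring
  · rw [mul_zero]
    exact zero_mem _

lemma inclFrac_mem_lat {M : ℕ} {x : PowerSeries (WittFrac p k)} (hx : x ∈ lat p k M) :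
    inclFrac p k x ∈ lat p k (M * p) := by
  intro j
  rw [inclFrac, coeff_expandHom]
  split_ifs with h
  · obtain ⟨i, rfl⟩ := h
    have hp := (Fact.out : p.Prime).pos
    rw [Nat.mul_div_cancel_left _ hp, mul_comm M, Nat.mul_div_mul_left _ _ hp]
    exact hx i
  · rw [mul_zero]
    exact zero_mem _

lemma frobS_D (n : ℕ) (d : E.PDEnv n) : E.frobS n (algebraMap (E.PDEnv n) (E.S n) d) =
    algebraMap (E.PDEnv n) (E.S n) (E.frobD n d) :=
  completionMap_algebraMap p (E.frobD n) d

lemma inclS_D (n : ℕ) (d : E.PDEnv n) : E.inclS n (algebraMap (E.PDEnv n) (E.S n) d) =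
    algebraMap (E.PDEnv (n + 1)) (E.S (n + 1)) (E.inclD n d) :=
  completionMap_algebraMap p (E.inclD n) d

lemma toFrac_frobS (hm : E.HasOrder m) (n : ℕ) (s : E.S n) :
    toFrac hm n (E.frobS n s) = frobFrac p k (toFrac hm n s) := by
  rw [← sub_eq_zero]
  refine eq_zero_of_mem_lat (M := m * p ^ n) fun N => ?_
  obtain ⟨d, t, rfl⟩ := E.exists_eq_algebraMap_add n N s
  refine ⟨toFrac hm n (E.frobS n t) - frobFrac p k (toFrac hm n t),
    sub_mem (toFrac_mem_lat hm n _) (frobFrac_mem_lat (toFrac_mem_lat hm n _)), ?_⟩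
  simp only [map_add, map_mul, map_pow, map_natCast, frobS_D, toFrac_algebraMap]
  have : (E.frobD n d : PowerSeries (WittFrac p k)) = frobFrac p k d := rfl
  rw [this]
  ring

lemma toFrac_inclS (hm : E.HasOrder m) (n : ℕ) (s : E.S n) :
    toFrac hm (n + 1) (E.inclS n s) = inclFrac p k (toFrac hm n s) := by
  rw [← sub_eq_zero]
  refine eq_zero_of_mem_lat (M := m * p ^ (n + 1)) fun N => ?_
  obtain ⟨d, t, rfl⟩ := E.exists_eq_algebraMap_add n N s
  refine ⟨toFrac hm (n + 1) (E.inclS n t) - inclFrac p k (toFrac hm n t),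
    sub_mem (toFrac_mem_lat hm _ _) ?_, ?_⟩
  · rw [pow_succ, ← mul_assoc]
    exact inclFrac_mem_lat (toFrac_mem_lat hm n _)
  · simp only [map_add, map_mul, map_pow, map_natCast, inclS_D, toFrac_algebraMap]
    have : (E.inclD n d : PowerSeries (WittFrac p k)) = inclFrac p k d := rfl
    rw [this]
    ring

lemma isDomain_S (hm : E.HasOrder m) (n : ℕ) : IsDomain (E.S n) :=
  (toFrac_injective hm n).isDomain

lemma natCast_ne_zero_S (hm : E.HasOrder m) (n : ℕ) {a : ℕ} (ha : a ≠ 0) : (a : E.S n) ≠ 0 := by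
  intro h
  have h1 := congrArg (toFrac hm n) h
  have := charZero_frac (p := p) (k := k)
  rw [map_natCast, map_zero, ← map_natCast PowerSeries.C, map_eq_zero_iff _
    PowerSeries.C_injective, Nat.cast_eq_zero] at h1
  exact ha h1

lemma natCast_p_ne_zero (hm : E.HasOrder m) (n : ℕ) : (p : E.S n) ≠ 0 :=
  natCast_ne_zero_S hm n (Fact.out : p.Prime).ne_zero

lemma algebraMap_S_injective (hm : E.HasOrder m) (n : ℕ) :
    Function.Injective (algebraMap (BKRing p k) (E.S n)) := by
  intro x y h
  apply algebraMap_BK_injective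
  rw [← toFrac_BK hm n, ← toFrac_BK hm n, h]

lemma expandHom_injective {R : Type*} [CommRing R] : Function.Injective (expandHom p R) := by
  intro f g h
  ext j : 1
  have h1 := congrArg (PowerSeries.coeff (p * j)) h
  rwa [coeff_expandHom, coeff_expandHom, if_pos (Dvd.intro _ rfl), if_pos (Dvd.intro _ rfl),
    Nat.mul_div_cancel_left _ (Fact.out : p.Prime).pos] at h1

lemma inclFrac_injective : Function.Injective (inclFrac p k) := expandHom_injective

lemma frobFrac_injective : Function.Injective (frobFrac p k) :=
  expandHom_injective.comp (PowerSeries.map_injective _ (RingHom.injective _))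

/-- The ring `𝔖` is closed in `S_n` for the `p`-adic topology of `S_n`. -/
lemma mem_range_of_forall_pow (hm : E.HasOrder m) (n : ℕ) {s : E.S n}
    (h : ∀ N, ∃ (g : BKRing p k) (t : E.S n), s = algebraMap _ _ g + (p : E.S n) ^ N * t) :
    ∃ g : BKRing p k, s = algebraMap _ _ g := by
  obtain ⟨g, hg⟩ := mem_range_algebraMap_BK (f := toFrac hm n s) fun j => by
    -- The coefficient of degree `j` of an element of `S_n` has denominator `q!`, which divides
    -- `p ^ q` in `W(k)`; so a congruence modulo `p ^ q` is precise enough.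
    set q := j / (m * p ^ n) with hq
    obtain ⟨g, t, hgt⟩ := h q
    obtain ⟨a, ha⟩ := exists_factorial_mul (p := p) (k := k) q
    obtain ⟨w, hw⟩ := toFrac_mem_lat hm n t j
    refine ⟨PowerSeries.coeff j g + a * w, ?_⟩
    have hb : ((p : PowerSeries (WittFrac p k)) ^ q) = ((p ^ q : ℕ) : PowerSeries _) := by
      push_cast; rfl
    have ha' := congrArg (algebraMap (WittVector p k) (WittFrac p k)) ha
    rw [map_mul, map_natCast, map_pow, map_natCast] at ha'
    have h1 : toFrac hm n s = algebraMap _ _ g + ((p ^ q : ℕ) : PowerSeries _) * toFrac hm n t := by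
      rw [← hb, hgt, map_add, map_mul, map_pow, map_natCast, toFrac_BK]
    rw [h1, map_add, map_add, map_mul, hw, coeff_algebraMap_BK, coeff_natCast_mul]
    push_cast
    rw [← ha']
    ring
  exact ⟨g, toFrac_injective hm n (by rw [toFrac_BK, hg])⟩

/-! ### The isomorphism `S_{n+1} ≅ S_n^{(φ)}` -/

lemma map_frobenius_mem (n : ℕ) {x : PowerSeries (WittFrac p k)} (hx : x ∈ E.PDEnv (n + 1)) :
    PowerSeries.map (WittVector.FractionRing.frobeniusRingHom p k) x ∈ E.PDEnv n := by
  have hcomp : ∀ y, inclFrac p k (PowerSeries.map (WittVector.FractionRing.frobeniusRingHom p k) y)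
    = frobFrac p k y := fun y => rfl
  have hBK : ∀ g : BKRing p k, PowerSeries.map (WittVector.FractionRing.frobeniusRingHom p k)
      (algebraMap (BKRing p k) (PowerSeries (WittFrac p k)) g) = algebraMap (BKRing p k) _
        (PowerSeries.map WittVector.frobenius g) := by
    intro g
    apply inclFrac_injective
    rw [hcomp, frobFrac_algebraMap, inclFrac_algebraMap]
    rfl
  induction hx using Algebra.adjoin_induction with
  | mem x hx =>
    obtain ⟨i, rfl⟩ := hx
    have h : PowerSeries.map (WittVector.FractionRing.frobeniusRingHom p k) (E.divPow (n + 1) i) =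
        frobFrac p k (E.divPow n i) := by
      apply inclFrac_injective
      rw [hcomp, ← frobFrac_inclFrac]
      congr 1
      apply factorial_cancel i
      rw [factorial_mul_divPow, ← map_natCast (inclFrac p k), ← map_mul, factorial_mul_divPow,
        map_pow, inclFrac_algebraMap, inclBK_elt]
    rw [h]
    exact E.frobFrac_mem n _ (Algebra.subset_adjoin ⟨i, rfl⟩)
  | algebraMap r => rw [hBK]; exact Subalgebra.algebraMap_mem _ _
  | add x y _ _ hx hy => rw [map_add]; exact add_mem hx hy
  | mul x y _ _ hx hy => rw [map_mul]; exact mul_mem hx hy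

variable (E) in
/-- The ring homomorphism `S_{n+1} → S_n` through which the Frobenius of `S_{n+1}` factors; it is
`σ` on `W(k)` and sends `u_{n+1}` to `u_n`. -/
noncomputable def psiS (n : ℕ) : E.S (n + 1) →+* E.S n :=
  completionMap p ((PowerSeries.map (WittVector.FractionRing.frobeniusRingHom p k)).restrict
    (E.PDEnv (n + 1)) (E.PDEnv n) (fun _ => map_frobenius_mem n))

lemma inclS_psiS (n : ℕ) (s : E.S (n + 1)) : E.inclS n (E.psiS n s) = E.frobS (n + 1) s := by
  have h : (E.inclS n).comp (E.psiS n) = E.frobS (n + 1) := by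
    refine (completionMap_comp p (E.inclD n) _).trans ?_
    rfl
  exact RingHom.congr_fun h s

lemma psiS_inclS (n : ℕ) (s : E.S n) : E.psiS n (E.inclS n s) = E.frobS n s := by
  have h : (E.psiS n).comp (E.inclS n) = E.frobS n := by
    refine (completionMap_comp p _ (E.inclD n)).trans ?_
    rw [frobS]
    congr 1
    ext1 x
    apply Subtype.ext
    change PowerSeries.map (WittVector.FractionRing.frobeniusRingHom p k)
      (inclFrac p k x) = frobFrac p k x
    rw [inclFrac, map_expandHom]
    rfl
  exact RingHom.congr_fun h s

end NormalizedPoly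

end Embedding

/-! ### Reduction modulo `p` -/

section ModP

variable {p : ℕ} [Fact p.Prime] {k : Type u} [Field k] [CharP k p] [PerfectRing k p]

variable (p k) in
/-- The reduction `𝔖 → k⟦u⟧` modulo `p`. -/
noncomputable def redBK : BKRing p k →+* PowerSeries k :=
  PowerSeries.map (WittVector.constantCoeff (p := p) (R := k))

lemma redBK_surjective : Function.Surjective (redBK p k) := by
  intro f
  choose w hw using fun j => WittVector.constantCoeff_surjective p (PowerSeries.coeff j f)
  refine ⟨PowerSeries.mk w, ?_⟩
  ext j : 1
  rw [redBK, PowerSeries.coeff_map, PowerSeries.coeff_mk, hw]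

lemma redBK_eq_zero_iff {g : BKRing p k} : redBK p k g = 0 ↔ (p : BKRing p k) ∣ g := by
  constructor
  · intro hg
    have h2 : ∀ i, ∃ c : WittVector p k, PowerSeries.coeff i g = (p : WittVector p k) * c := by
      intro i
      have := congrArg (PowerSeries.coeff i) hg
      rw [redBK, PowerSeries.coeff_map, map_zero] at this
      have h3 : PowerSeries.coeff i g ∈
          RingHom.ker (WittVector.constantCoeff (p := p) (R := k)) := this
      rw [WittVector.ker_constantCoeff] at h3
      exact Ideal.mem_span_singleton.mp h3
    choose c hc using h2
    refine ⟨PowerSeries.mk c, ?_⟩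
    ext i : 1
    rw [coeff_natCast_mul, PowerSeries.coeff_mk, hc]
  · rintro ⟨h, rfl⟩
    have : ((p : ℕ) : PowerSeries k) = 0 := by
      rw [← map_natCast PowerSeries.C, CharP.cast_eq_zero, map_zero]
    rw [map_mul, map_natCast, this, zero_mul]

lemma natCast_p_ne_zero_BK : (p : BKRing p k) ≠ 0 := by
  rw [← map_natCast PowerSeries.C]
  intro h
  exact WittVector.p_nonzero p k ((map_eq_zero_iff _ PowerSeries.C_injective).mp h)

lemma prime_p : Prime (p : BKRing p k) := by
  refine ⟨natCast_p_ne_zero_BK, fun h => ?_, fun a b hab => ?_⟩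
  · have h1 : redBK p k (p : BKRing p k) = 0 := redBK_eq_zero_iff.mpr dvd_rfl
    exact (h.map (redBK p k)).ne_zero h1
  · rw [← redBK_eq_zero_iff, map_mul, mul_eq_zero, redBK_eq_zero_iff, redBK_eq_zero_iff] at hab
    exact hab

/-- A nonzero integer is a power of `p` times a unit of `W(k)`. -/
lemma natCast_eq_pow_mul_unit {a : ℕ} (ha : a ≠ 0) : ∃ w : (WittVector p k)ˣ,
    (a : WittVector p k) = (p : WittVector p k) ^ padicValNat p a * w := by
  obtain ⟨m, hm⟩ : p ^ padicValNat p a ∣ a := pow_padicValNat_dvd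
  have hmp : ¬ p ∣ m := by
    rintro ⟨c, rfl⟩
    have : p ^ (padicValNat p a + 1) ∣ a := ⟨c, by rw [pow_succ, mul_assoc]; exact hm⟩
    exact pow_succ_padicValNat_not_dvd ha this
  have hu : IsUnit (m : WittVector p k) := by
    apply WittVector.isUnit_of_coeff_zero_ne_zero
    intro h
    have h2 : WittVector.constantCoeff (m : WittVector p k) = 0 := h
    rw [map_natCast] at h2
    exact hmp ((CharP.cast_eq_zero_iff k p m).mp h2)
  obtain ⟨w, hw⟩ := hu
  refine ⟨w, ?_⟩
  rw [hw]
  exact_mod_cast congrArg (Nat.cast (R := WittVector p k)) hm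

/-- Powers of an element prime to the prime `π` can be cancelled against powers of `π`. -/
lemma pow_dvd_of_pow_dvd_mul {R : Type*} [CommRing R] [IsDomain R] {π a u x g : R} {v n : ℕ}
    (hπ : Prime π) (hu : IsUnit u) (ha : a = π ^ v * u) (hx : ¬ π ∣ x) (h : x ^ n ∣ a * g) :
    x ^ n ∣ g := by
  obtain ⟨y, hy⟩ := h
  rw [ha, mul_assoc] at hy
  obtain ⟨z, hz⟩ := hπ.pow_dvd_of_dvd_mul_left v
    (fun h => hx (hπ.dvd_of_dvd_pow h)) (Dvd.intro _ hy)
  rw [hz, mul_left_comm (x ^ n)] at hy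
  have h1 := mul_left_cancel₀ (pow_ne_zero _ hπ.ne_zero) hy
  exact hu.dvd_mul_left.mp ⟨z, h1⟩

lemma natCast_BK_eq_pow_mul_unit {a : ℕ} (ha : a ≠ 0) : ∃ w : BKRing p k, IsUnit w ∧
    (a : BKRing p k) = (p : BKRing p k) ^ padicValNat p a * w := by
  obtain ⟨w, hw⟩ := natCast_eq_pow_mul_unit (p := p) (k := k) ha
  refine ⟨PowerSeries.C (w : WittVector p k), w.isUnit.map _, ?_⟩
  rw [← map_natCast PowerSeries.C a, hw, map_mul, map_pow, map_natCast]

lemma dvd_of_dvd_natCast_mul {a : ℕ} (ha : a ≠ 0) {x g : BKRing p k}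
    (hx : ¬ (p : BKRing p k) ∣ x) (n : ℕ) (h : x ^ n ∣ (a : BKRing p k) * g) : x ^ n ∣ g := by
  obtain ⟨w, hw, hC⟩ := natCast_BK_eq_pow_mul_unit (p := p) (k := k) ha
  exact pow_dvd_of_pow_dvd_mul prime_p hw hC hx h

namespace NormalizedPoly

variable {E : NormalizedPoly p k} {m : ℕ}

lemma HasOrder.not_dvd_elt (hm : E.HasOrder m) (n : ℕ) : ¬ (p : BKRing p k) ∣ E.elt n := by
  obtain ⟨v, h, hv, hE⟩ := hm.elt n
  rw [hE, dvd_add_left (dvd_mul_right _ _), hv.dvd_mul_right, ← redBK_eq_zero_iff, redBK, map_pow,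
    PowerSeries.map_X]
  exact pow_ne_zero _ PowerSeries.X_ne_zero

/-- A normalized minimal polynomial does not vanish modulo `p`. -/
lemma exists_hasOrder {O : Type*} [CommRing O] [Algebra (WittVector p k) O] {π : O}
    (hπ : IsIntegral (WittVector p k) π) (hE : E.IsMinpoly π) : ∃ m, E.HasOrder m := by
  obtain ⟨c, hc⟩ := hE
  have h0 : redBK p k E.ser ≠ 0 := by
    intro h
    have h1 := congrArg (PowerSeries.coeff (minpoly (WittVector p k) π).natDegree) h
    rw [redBK, PowerSeries.coeff_map, ser, Polynomial.coeff_coe, hc, Polynomial.coeff_C_mul,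
      Polynomial.coeff_natDegree, (minpoly.monic hπ).leadingCoeff, mul_one, map_zero] at h1
    exact (c.isUnit.map (WittVector.constantCoeff (p := p) (R := k))).ne_zero h1
  set f := redBK p k E.ser with hf
  obtain ⟨v, hv⟩ := redBK_surjective (p := p) f.divXPowOrder
  have hvu : IsUnit v := by
    rw [PowerSeries.isUnit_iff_constantCoeff]
    apply WittVector.isUnit_of_coeff_zero_ne_zero
    have h1 := PowerSeries.isUnit_divided_by_X_pow_order h0
    rw [← hv, PowerSeries.isUnit_iff_constantCoeff] at h1
    have h2 := h1.ne_zero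
    rw [redBK, ← PowerSeries.coeff_zero_eq_constantCoeff_apply, PowerSeries.coeff_map] at h2
    rw [← PowerSeries.coeff_zero_eq_constantCoeff_apply]
    exact h2
  have h2 : redBK p k (E.ser - PowerSeries.X ^ f.order.toNat * v) = 0 := by
    rw [map_sub, map_mul, hv, map_pow, sub_eq_zero]
    have : redBK p k PowerSeries.X = PowerSeries.X := PowerSeries.map_X _
    rw [this, PowerSeries.X_pow_order_mul_divXPowOrder]
  obtain ⟨h, hh⟩ := redBK_eq_zero_iff.mp h2
  refine ⟨f.order.toNat, Nat.pos_of_ne_zero fun h3 => ?_, v, h, hvu, by rw [← hh]; ring⟩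
  have h4 : PowerSeries.constantCoeff f = 0 := by
    rw [hf, redBK, ← PowerSeries.coeff_zero_eq_constantCoeff_apply, PowerSeries.coeff_map,
      PowerSeries.coeff_zero_eq_constantCoeff_apply]
    have := E.constantCoeff_elt 0
    rw [NormalizedPoly.elt, Function.iterate_zero, id] at this
    rw [this, map_natCast, CharP.cast_eq_zero]
  have h5 := PowerSeries.X_pow_order_mul_divXPowOrder (f := f)
  rw [h3, pow_zero, one_mul] at h5
  have h6 := PowerSeries.isUnit_divided_by_X_pow_order h0
  rw [h5, PowerSeries.isUnit_iff_constantCoeff, h4] at h6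
  exact not_isUnit_zero h6

end NormalizedPoly

end ModP

/-! ### The filtration of `S_n` -/

section Fil

variable {p : ℕ} [Fact p.Prime] {k : Type u} [Field k] [CharP k p] [PerfectRing k p]

namespace NormalizedPoly

variable {E : NormalizedPoly p k} {m : ℕ}

variable (E) in
/-- The ideal of the divided power envelope generated by the `E ^ i / i!` with `i ≥ M`. -/
noncomputable def FilD (n M : ℕ) : Ideal (E.PDEnv n) := Ideal.span {x | ∃ i ≥ M, x = E.gammaD n i}

lemma factorial_mul_gammaD (n i : ℕ) :
    (i.factorial : E.PDEnv n) * E.gammaD n i = algebraMap (BKRing p k) (E.PDEnv n) (E.elt n) ^ i :=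
  Subtype.ext (by push_cast; exact E.factorial_mul_divPow n i)

lemma algebraMap_PDEnv_injective (n : ℕ) :
    Function.Injective (algebraMap (BKRing p k) (E.PDEnv n)) := fun _ _ h =>
  algebraMap_BK_injective (congrArg Subtype.val h)

/-- After multiplication by an integer, an element of `FilD` becomes divisible by `E ^ M`. -/
lemma exists_natCast_mul_of_mem_FilD {n M : ℕ} {x : E.PDEnv n} (hx : x ∈ E.FilD n M) :
    ∃ a : ℕ, 0 < a ∧ ∃ g, algebraMap (BKRing p k) (E.PDEnv n) (E.elt n ^ M * g) = a * x := by
  induction hx using Submodule.span_induction with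
  | mem x hx =>
    obtain ⟨i, hi, rfl⟩ := hx
    refine ⟨i.factorial, i.factorial_pos, E.elt n ^ (i - M), ?_⟩
    rw [← pow_add, Nat.add_sub_cancel' hi, map_pow, factorial_mul_gammaD]
  | zero => exact ⟨1, one_pos, 0, by simp⟩
  | add x y _ _ hx hy =>
    obtain ⟨a, ha, g, hg⟩ := hx
    obtain ⟨b, hb, h, hh⟩ := hy
    refine ⟨a * b, Nat.mul_pos ha hb, b * g + a * h, ?_⟩
    rw [mul_add, map_add, mul_left_comm, mul_left_comm _ (a : BKRing p k), map_mul, hg, map_mul, hh,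
      map_natCast, map_natCast]
    push_cast
    ring
  | smul d x _ hx =>
    obtain ⟨a, ha, g, hg⟩ := hx
    obtain ⟨b, hb, h, hh⟩ := exists_natCast_mul_mem n d.2
    refine ⟨a * b, Nat.mul_pos ha hb, g * h, ?_⟩
    have hh' : algebraMap (BKRing p k) (E.PDEnv n) h = b * d :=
      Subtype.ext (by push_cast; exact hh)
    rw [← mul_assoc, map_mul, hg, hh']
    push_cast
    rw [smul_eq_mul]
    ring

/-- `𝔖_n` meets the `M`-th step of the filtration of the divided power envelope in `E ^ M 𝔖_n`: the
denominators are powers of `p` up to units, and `E` is prime to `p`. -/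
lemma pow_dvd_of_mem_FilD (hm : E.HasOrder m) {n M : ℕ} {g : BKRing p k}
    (hg : algebraMap (BKRing p k) (E.PDEnv n) g ∈ E.FilD n M) : E.elt n ^ M ∣ g := by
  obtain ⟨a, ha, h, hh⟩ := exists_natCast_mul_of_mem_FilD hg
  refine dvd_of_dvd_natCast_mul ha.ne' (hm.not_dvd_elt n) M ⟨h, ?_⟩
  apply algebraMap_PDEnv_injective n (E := E)
  rw [hh, map_mul, map_natCast]

/-- For `M ≤ p` the divided powers `E ^ i / i!` with `i < M` are in `𝔖_n`, as `i!` is a unit. -/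
lemma exists_add_FilD {n M : ℕ} (hM : M ≤ p) (d : E.PDEnv n) :
    ∃ g, d - algebraMap (BKRing p k) (E.PDEnv n) g ∈ E.FilD n M := by
  obtain ⟨x, hx⟩ := d
  induction hx using Algebra.adjoin_induction with
  | mem x hx =>
    obtain ⟨i, rfl⟩ := hx
    rcases le_or_gt M i with hi | hi
    · exact ⟨0, by rw [map_zero, sub_zero]; exact Ideal.subset_span ⟨i, hi, rfl⟩⟩
    · obtain ⟨w, hw⟩ := natCast_eq_pow_mul_unit (p := p) (k := k) i.factorial_ne_zero
      have h0 : padicValNat p i.factorial = 0 := by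
        refine padicValNat.eq_zero_of_not_dvd fun h => ?_
        rw [(Fact.out : p.Prime).dvd_factorial] at h
        omega
      rw [h0, pow_zero, one_mul] at hw
      refine ⟨PowerSeries.C ((w⁻¹ : (WittVector p k)ˣ) : WittVector p k) * E.elt n ^ i, ?_⟩
      have h1 : E.gammaD n i = algebraMap (BKRing p k) (E.PDEnv n)
          (PowerSeries.C ((w⁻¹ : (WittVector p k)ˣ) : WittVector p k) * E.elt n ^ i) := by
        apply Subtype.ext
        apply factorial_cancel i
        have h2 := congrArg Subtype.val (factorial_mul_gammaD (E := E) n i)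
        have h3 : (i.factorial : BKRing p k) *
            (PowerSeries.C ((w⁻¹ : (WittVector p k)ˣ) : WittVector p k)) = 1 := by
          rw [← map_natCast PowerSeries.C, hw, ← map_mul, Units.mul_inv, map_one]
        push_cast at h2
        rw [h2]
        have h5 : ∀ a b c : BKRing p k, a * b = 1 → algebraMap (BKRing p k) (PowerSeries
            (WittFrac p k)) c = algebraMap (BKRing p k) (PowerSeries (WittFrac p k)) a *
              algebraMap (BKRing p k) (PowerSeries (WittFrac p k)) (b * c) := fun a b c h => by
          rw [← map_mul, ← mul_assoc, h, one_mul]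
        have h6 := h5 _ _ (E.elt n ^ i) h3
        rw [map_pow, map_natCast] at h6
        exact h6
      have h4 : (⟨E.divPow n i, Algebra.subset_adjoin ⟨i, rfl⟩⟩ : E.PDEnv n) = E.gammaD n i := rfl
      rw [h4, h1, sub_self]
      exact zero_mem _
  | algebraMap r => exact ⟨r, by
      have : (⟨algebraMap _ _ r, Subalgebra.algebraMap_mem _ r⟩ : E.PDEnv n) -
        algebraMap _ _ r = 0 := sub_self _
      rw [this]
      exact zero_mem _⟩
  | add x y hx' hy' hx hy =>
    obtain ⟨g, hg⟩ := hx
    obtain ⟨h, hh⟩ := hy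
    refine ⟨g + h, ?_⟩
    convert add_mem hg hh using 1
    rw [map_add]
    exact add_sub_add_comm (⟨x, hx'⟩ : E.PDEnv n) ⟨y, hy'⟩ _ _
  | mul x y hx' hy' hx hy =>
    obtain ⟨g, hg⟩ := hx
    obtain ⟨h, hh⟩ := hy
    refine ⟨g * h, ?_⟩
    convert add_mem (Ideal.mul_mem_right (⟨y, hy'⟩ : E.PDEnv n) _ hg)
      (Ideal.mul_mem_left _ (algebraMap (BKRing p k) (E.PDEnv n) g) hh) using 1
    have : (⟨x * y, mul_mem hx' hy'⟩ : E.PDEnv n) = ⟨x, hx'⟩ * ⟨y, hy'⟩ := rfl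
    rw [map_mul, this]
    ring

/-- The elements of `Fil^M S_n` are the `p`-adic limits of elements of `FilD`. -/
lemma mem_FilS_iff {n M : ℕ} {s : E.S n} : s ∈ E.FilS n M ↔
    ∀ N : ℕ, ∃ d ∈ E.FilD n M, ∃ t : E.S n,
      s = algebraMap (E.PDEnv n) (E.S n) d + (p : E.S n) ^ N * t := by
  rw [FilS, Ideal.mem_iInf]
  refine forall_congr' fun N => ?_
  rw [Submodule.mem_sup]
  constructor
  · rintro ⟨y, hy, z, hz, rfl⟩
    obtain ⟨t', rfl⟩ := Ideal.mem_span_singleton.mp hz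
    have : ∃ d ∈ E.FilD n M, ∃ t : E.S n,
      y = algebraMap (E.PDEnv n) (E.S n) d + (p : E.S n) ^ N * t := by
      induction hy using Submodule.span_induction with
      | mem x hx =>
        obtain ⟨i, hi, rfl⟩ := hx
        exact ⟨E.gammaD n i, Ideal.subset_span ⟨i, hi, rfl⟩, 0, by simp [gamma]⟩
      | zero => exact ⟨0, zero_mem _, 0, by simp⟩
      | add x y _ _ hx hy =>
        obtain ⟨d, hd, t, rfl⟩ := hx
        obtain ⟨d', hd', t', rfl⟩ := hy
        exact ⟨d + d', add_mem hd hd', t + t', by rw [map_add]; ring⟩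
      | smul s x _ hx =>
        obtain ⟨d, hd, t, rfl⟩ := hx
        obtain ⟨e, t', rfl⟩ := E.exists_eq_algebraMap_add n N s
        refine ⟨e * d, Ideal.mul_mem_left _ _ hd,
          t' * algebraMap _ _ d + algebraMap _ _ e * t + t' * ((p : E.S n) ^ N * t), ?_⟩
        rw [map_mul, smul_eq_mul]
        ring
    obtain ⟨d, hd, t, rfl⟩ := this
    exact ⟨d, hd, t + t', by ring⟩
  · rintro ⟨d, hd, t, rfl⟩
    refine ⟨_, ?_, _, Ideal.mem_span_singleton.mpr (Dvd.intro t rfl), rfl⟩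
    have h := Ideal.mem_map_of_mem (algebraMap (E.PDEnv n) (E.S n)) hd
    rw [FilD, Ideal.map_span] at h
    refine Ideal.span_mono ?_ h
    rintro _ ⟨_, ⟨i, hi, rfl⟩, rfl⟩
    exact ⟨i, hi, rfl⟩

lemma FilS_mono {n M M' : ℕ} (h : M ≤ M') : E.FilS n M' ≤ E.FilS n M := by
  refine iInf_mono fun N => sup_le_sup_right (Ideal.span_mono ?_) _
  rintro _ ⟨i, hi, rfl⟩
  exact ⟨i, h.trans hi, rfl⟩

/-- `S_n = 𝔖_n + Fil^M S_n` for `M ≤ p`. -/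
lemma exists_add_FilS {n M : ℕ} (hM : M ≤ p) (s : E.S n) :
    ∃ g, s - algebraMap (BKRing p k) (E.S n) g ∈ E.FilS n M := by
  have step : ∀ s : E.S n, ∃ (g : BKRing p k) (d : E.PDEnv n) (t : E.S n), d ∈ E.FilD n M ∧
      s = algebraMap _ _ g + algebraMap _ _ d + p * t := by
    intro s
    obtain ⟨d, t, hs⟩ := E.exists_eq_algebraMap_add n 1 s
    obtain ⟨g, hg⟩ := exists_add_FilD hM d
    refine ⟨g, _, t, hg, ?_⟩
    rw [hs, map_sub, algebraMap_S, pow_one]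
    ring
  choose g d t hd hs using step
  -- Iterating the step writes `s` as the sum of the series `∑ p ^ i (g_i + d_i)`.
  let T : ℕ → E.S n := fun N => t^[N] s
  have hT : ∀ N, T (N + 1) = t (T N) := fun N => Function.iterate_succ_apply' _ _ _
  let G : ℕ → BKRing p k := fun N => ∑ i ∈ Finset.range N, (p : BKRing p k) ^ i * g (T i)
  let F : ℕ → E.PDEnv n := fun N => ∑ i ∈ Finset.range N, (p : E.PDEnv n) ^ i * d (T i)
  have hF : ∀ N, F N ∈ E.FilD n M := fun N =>
    sum_mem fun i _ => Ideal.mul_mem_left _ _ (hd _)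
  have hsum : ∀ N, s = algebraMap _ _ (G N) + algebraMap _ _ (F N) + (p : E.S n) ^ N * T N := by
    intro N
    induction N with
    | zero => simp [G, F, T]
    | succ N ih =>
      have h1 := hs (T N)
      rw [← hT] at h1
      simp only [G, F, Finset.sum_range_succ, map_add, map_mul, map_pow, map_natCast] at ih ⊢
      rw [pow_succ]
      linear_combination ih + (p : E.S n) ^ N * h1
  obtain ⟨L, hL⟩ := exists_limit (p : BKRing p k) G fun N => by
    simp [G, Finset.sum_range_succ]
  refine ⟨L, mem_FilS_iff.mpr fun N => ?_⟩
  obtain ⟨c, hc⟩ := hL N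
  refine ⟨F N, hF N, T N - algebraMap _ _ c, ?_⟩
  have h2 := congrArg (algebraMap (BKRing p k) (E.S n)) hc
  rw [map_sub, map_mul, map_pow, map_natCast] at h2
  linear_combination hsum N - h2

/-- `𝔖_n ∩ Fil^M S_n = E ^ M 𝔖_n` for `M ≤ p`. -/
lemma pow_dvd_of_mem_FilS (hm : E.HasOrder m) {n M : ℕ} (hM : M ≤ p) {g : BKRing p k}
    (hg : algebraMap (BKRing p k) (E.S n) g ∈ E.FilS n M) : E.elt n ^ M ∣ g := by
  have h1 : ∀ N, ∃ y, E.elt n ^ M ∣ g - (p : BKRing p k) ^ N * y := by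
    intro N
    obtain ⟨d, hd, t, hgt⟩ := mem_FilS_iff.mp hg N
    obtain ⟨e, he⟩ := E.pow_dvd_of_algebraMap n N (algebraMap _ _ g - d)
      ⟨t, by rw [map_sub, ← algebraMap_S, hgt]; ring⟩
    obtain ⟨y, hy⟩ := exists_add_FilD hM e
    refine ⟨y, pow_dvd_of_mem_FilD hm ?_⟩
    have h2 : algebraMap (BKRing p k) (E.PDEnv n) (g - (p : BKRing p k) ^ N * y) =
        d + (p : E.PDEnv n) ^ N * (e - algebraMap _ _ y) := by
      rw [map_sub, map_mul, map_pow, map_natCast]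
      linear_combination he
    rw [h2]
    exact add_mem hd (Ideal.mul_mem_left _ _ hy)
  -- By Krull's intersection theorem `E ^ M 𝔖_n` is closed for the `p`-adic topology.
  have hne : Ideal.span {(p : BKRing p k)} ≠ ⊤ := by
    rw [Ne, Ideal.span_singleton_eq_top]
    exact prime_p.not_isUnit
  have hK := Ideal.iInf_pow_smul_eq_bot_of_isLocalRing (M := BKRing p k ⧸
    Ideal.span {E.elt n ^ M}) (Ideal.span {(p : BKRing p k)}) hne
  rw [← Ideal.mem_span_singleton, ← Ideal.Quotient.eq_zero_iff_mem]
  have h3 : Ideal.Quotient.mk (Ideal.span {E.elt n ^ M}) g ∈ (⊥ : Submodule (BKRing p k)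
      (BKRing p k ⧸ Ideal.span {E.elt n ^ M})) := by
    rw [← hK, Submodule.mem_iInf]
    intro N
    obtain ⟨y, hy⟩ := h1 N
    have h4 : Ideal.Quotient.mk (Ideal.span {E.elt n ^ M}) g =
        (p : BKRing p k) ^ N • Ideal.Quotient.mk (Ideal.span {E.elt n ^ M}) y := by
      refine Ideal.Quotient.eq.mpr ?_
      rw [Ideal.mem_span_singleton]
      exact hy
    rw [h4]
    exact Submodule.smul_mem_smul (Ideal.pow_mem_pow (Ideal.mem_span_singleton_self _) N) trivial
  simpa using h3

end NormalizedPoly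

end Fil

/-! ### Frobenius and the filtration of `S_n` -/

section FrobFil

variable {p : ℕ} [Fact p.Prime] {k : Type u} [Field k] [CharP k p] [PerfectRing k p]

/-- The `p`-adic valuation of `p ^ i / i!` is at least `e`, for `i ≥ e` and `e ≤ p - 1`. -/
lemma padicValNat_factorial_add_le {e i : ℕ} (he : e ≤ p - 1) (hi : e ≤ i) :
    padicValNat p i.factorial + e ≤ i := by
  have hp := (Fact.out : p.Prime).two_le
  rcases lt_or_ge i p with h | h
  · have : padicValNat p i.factorial = 0 := by
      refine padicValNat.eq_zero_of_not_dvd fun h' => ?_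
      rw [(Fact.out : p.Prime).dvd_factorial] at h'
      omega
    omega
  · have h1 := sub_one_mul_padicValNat_factorial_lt_of_ne_zero p (n := i) (by omega)
    obtain ⟨q, rfl⟩ : ∃ q, p = q + 1 := ⟨p - 1, by omega⟩
    simp only [Nat.add_sub_cancel] at *
    by_contra h3
    have h4 : i + 1 ≤ padicValNat (q + 1) i.factorial + q := by omega
    have h5 := Nat.mul_le_mul_left q h4
    obtain ⟨j, rfl⟩ : ∃ j, i = q + 1 + j := ⟨i - (q + 1), by omega⟩
    have h6 : q * padicValNat (q + 1) (q + 1 + j).factorial ≤ q + j := by omega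
    have h7 : q * (q + 1 + j + 1) ≤ q + j + q * q := by
      calc _ ≤ q * (padicValNat (q + 1) (q + 1 + j).factorial + q) := h5
        _ = q * padicValNat (q + 1) (q + 1 + j).factorial + q * q := by ring
        _ ≤ _ := by omega
    have h8 : 1 * j ≤ q * j := Nat.mul_le_mul_right j (by omega)
    have h9 : q * (q + 1 + j + 1) = q * q + 2 * q + q * j := by ring
    omega

lemma exists_factorial_mul_eq {e i : ℕ} (he : e ≤ p - 1) (hi : e ≤ i) :
    ∃ a : WittVector p k, (i.factorial : WittVector p k) * ((p : WittVector p k) ^ e * a) =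
      (p : WittVector p k) ^ i := by
  obtain ⟨w, hw⟩ := natCast_eq_pow_mul_unit (p := p) (k := k) i.factorial_ne_zero
  have h := padicValNat_factorial_add_le he hi
  refine ⟨(p : WittVector p k) ^ (i - (padicValNat p i.factorial + e)) * ↑w⁻¹, ?_⟩
  rw [hw]
  calc _ = (p : WittVector p k) ^ (padicValNat p i.factorial) * p ^ e *
        p ^ (i - (padicValNat p i.factorial + e)) * (w * ↑w⁻¹) := by ring
    _ = _ := by rw [← pow_add, ← pow_add, Nat.add_sub_cancel' h]; simp

namespace NormalizedPoly

variable {E : NormalizedPoly p k} {m : ℕ}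

/-- As `φ(E) = p c`, one has `φ(E ^ i / i!) = (p ^ i / i!) c ^ i`. -/
lemma pow_dvd_frobS_gamma (hm : E.HasOrder m) (n : ℕ) {e i : ℕ} (he : e ≤ p - 1) (hi : e ≤ i) :
    (p : E.S n) ^ e ∣ E.frobS n (E.gamma n i) := by
  have := isDomain_S hm n
  obtain ⟨a, ha⟩ := exists_factorial_mul_eq (k := k) he hi
  have h0 := congrArg ((algebraMap (BKRing p k) (E.S n)).comp PowerSeries.C) ha
  simp only [map_mul, map_natCast, map_pow] at h0
  refine ⟨((algebraMap (BKRing p k) (E.S n)).comp PowerSeries.C) a * (E.c n) ^ i, ?_⟩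
  apply mul_left_cancel₀ (natCast_ne_zero_S hm n i.factorial_ne_zero)
  rw [← map_natCast (E.frobS n), ← map_mul, factorial_mul_gamma, map_pow, ← p_mul_c, mul_pow, ← h0,
    map_natCast]
  ring

lemma dvd_of_mem_FilS {n e : ℕ} {B : Type*} [CommRing B] (f : E.S n →+* B)
    (hf : ∀ i ≥ e, (p : B) ^ e ∣ f (E.gamma n i)) {s : E.S n} (hs : s ∈ E.FilS n e) :
    (p : B) ^ e ∣ f s := by
  rw [FilS, Ideal.mem_iInf] at hs
  have h : Ideal.span {x | ∃ i ≥ e, x = E.gamma n i} ⊔ Ideal.span {(p : E.S n) ^ e} ≤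
      (Ideal.span {(p : B) ^ e}).comap f := by
    refine sup_le (Ideal.span_le.mpr ?_) (Ideal.span_le.mpr ?_)
    · rintro _ ⟨i, hi, rfl⟩
      exact Ideal.mem_span_singleton.mpr (hf i hi)
    · rintro _ rfl
      exact Ideal.mem_span_singleton.mpr (by rw [map_pow, map_natCast])
  exact Ideal.mem_span_singleton.mp (h (hs e))

/-- `φ(Fil^e S_n)` is contained in `p ^ e S_n` for `e ≤ p - 1`. -/
lemma pow_dvd_frobS (hm : E.HasOrder m) (n : ℕ) {e : ℕ} (he : e ≤ p - 1) {s : E.S n}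
    (hs : s ∈ E.FilS n e) : (p : E.S n) ^ e ∣ E.frobS n s :=
  dvd_of_mem_FilS _ (fun _ hi => pow_dvd_frobS_gamma hm n he hi) hs

lemma inclD_gammaD (n i : ℕ) : E.inclD n (E.gammaD n i) = E.gammaD (n + 1) i := by
  apply Subtype.ext
  apply factorial_cancel i
  change _ * inclFrac p k (E.divPow n i) = _ * E.divPow (n + 1) i
  rw [factorial_mul_divPow, ← map_natCast (inclFrac p k), ← map_mul, factorial_mul_divPow,
    map_pow, inclFrac_algebraMap, inclBK_elt]

lemma inclS_gamma (n i : ℕ) : E.inclS n (E.gamma n i) = E.gamma (n + 1) i := by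
  rw [gamma, inclS_D, inclD_gammaD, gamma]

/-- The refinement of `pow_dvd_frobS` in which the quotient by `p ^ e` is taken in `S_n`, through
which the Frobenius of `S_{n+1}` factors. -/
lemma pow_dvd_psiS (hm : E.HasOrder m) (n : ℕ) {e : ℕ} (he : e ≤ p - 1) {s : E.S (n + 1)}
    (hs : s ∈ E.FilS (n + 1) e) : (p : E.S n) ^ e ∣ E.psiS n s :=
  dvd_of_mem_FilS _ (fun i hi => by
    rw [← inclS_gamma, psiS_inclS]
    exact pow_dvd_frobS_gamma hm n he hi) hs

/-! ### The rings `S_n[z_n⁻¹]` -/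

lemma constantCoeff_inclBK (g : BKRing p k) :
    PowerSeries.constantCoeff (inclBK p k g) = PowerSeries.constantCoeff g := by
  rw [← PowerSeries.coeff_zero_eq_constantCoeff_apply,
    ← PowerSeries.coeff_zero_eq_constantCoeff_apply]
  simp [inclBK, coeff_expandHom]

lemma constantCoeff_z (n : ℕ) :
    PowerSeries.constantCoeff (E.z n) = (p : WittVector p k) ^ n := by
  induction n with
  | zero => simp [z_zero]
  | succ n ih =>
    rw [z_succ, constantCoeff_inclBK, map_mul, ih, pow_succ]
    congr 1
    have h := E.constantCoeff_elt 0
    rw [NormalizedPoly.elt, Function.iterate_zero, id] at h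
    rw [← PowerSeries.coeff_zero_eq_constantCoeff_apply, twistBK, PowerSeries.coeff_map,
      PowerSeries.coeff_zero_eq_constantCoeff_apply, h, map_natCast]

lemma isUnit_toFrac_zS (hm : E.HasOrder m) (n : ℕ) : IsUnit (toFrac hm n (E.zS n)) := by
  rw [zS, toFrac_BK, PowerSeries.isUnit_iff_constantCoeff,
    ← PowerSeries.coeff_zero_eq_constantCoeff_apply, coeff_algebraMap_BK,
    PowerSeries.coeff_zero_eq_constantCoeff_apply, constantCoeff_z, isUnit_iff_ne_zero, Ne,
    map_eq_zero_iff _ algebraMap_witt_injective]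
  exact pow_ne_zero _ (WittVector.p_nonzero p k)

/-- The embedding of `S_n[z_n⁻¹]` in `W(k)[1/p]⟦u_n⟧`; the constant term of `z_n` is `p ^ n`, so
that `z_n` is invertible there. -/
noncomputable def locFrac (hm : E.HasOrder m) (n : ℕ) : E.SLoc n →+* PowerSeries (WittFrac p k) :=
  E.locLift n (toFrac hm n) (isUnit_toFrac_zS hm n)

lemma locFrac_toLoc (hm : E.HasOrder m) (n : ℕ) (s : E.S n) :
    locFrac hm n (E.toLoc n s) = toFrac hm n s := E.locLift_toLoc _ _ _ s

lemma exists_eq_zUnit_mul (n : ℕ) (x : E.SLoc n) :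
    ∃ (i : ℕ) (s : E.S n), (E.zUnit n ^ i : (E.SLoc n)ˣ) * x = E.toLoc n s := by
  obtain ⟨i, a, ha⟩ := IsLocalization.Away.surj (S := Localization.Away (E.zS n)) (E.zS n) x
  refine ⟨i, a, ?_⟩
  rw [Units.val_pow_eq_pow_val, coe_zUnit, mul_comm]
  exact ha

lemma locFrac_injective (hm : E.HasOrder m) (n : ℕ) : Function.Injective (locFrac hm n) := by
  rw [injective_iff_map_eq_zero]
  intro x hx
  obtain ⟨i, s, hs⟩ := exists_eq_zUnit_mul n x
  have h := congrArg (locFrac hm n) hs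
  rw [map_mul, hx, mul_zero, locFrac_toLoc] at h
  have h2 : s = 0 := toFrac_injective hm n (by rw [← h, map_zero])
  rw [h2, map_zero] at hs
  exact (Units.mul_right_eq_zero _).mp hs

lemma toLoc_injective (hm : E.HasOrder m) (n : ℕ) : Function.Injective (E.toLoc n) := by
  intro x y h
  apply toFrac_injective hm n
  rw [← locFrac_toLoc, ← locFrac_toLoc, h]

lemma locFrac_frobLoc (hm : E.HasOrder m) (n : ℕ) (x : E.SLoc n) :
    locFrac hm n (E.frobLoc n x) = frobFrac p k (locFrac hm n x) := by
  have h : (locFrac hm n).comp (E.frobLoc n) = (frobFrac p k).comp (locFrac hm n) := by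
    apply E.loc_hom_ext
    intro s
    simp only [RingHom.comp_apply, frobLoc_toLoc, locFrac_toLoc, toFrac_frobS]
  exact RingHom.congr_fun h x

lemma locFrac_inclLoc (hm : E.HasOrder m) (n : ℕ) (x : E.SLoc n) :
    locFrac hm (n + 1) (E.inclLoc n x) = inclFrac p k (locFrac hm n x) := by
  have h : (locFrac hm (n + 1)).comp (E.inclLoc n) = (inclFrac p k).comp (locFrac hm n) := by
    apply E.loc_hom_ext
    intro s
    simp only [RingHom.comp_apply, inclLoc_toLoc, locFrac_toLoc, toFrac_inclS]
  exact RingHom.congr_fun h x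

lemma frobLoc_injective (hm : E.HasOrder m) (n : ℕ) : Function.Injective (E.frobLoc n) := by
  intro x y h
  apply locFrac_injective hm n
  apply frobFrac_injective
  rw [← locFrac_frobLoc, ← locFrac_frobLoc, h]

lemma inclLoc_injective (hm : E.HasOrder m) (n : ℕ) : Function.Injective (E.inclLoc n) := by
  intro x y h
  apply locFrac_injective hm n
  apply inclFrac_injective
  rw [← locFrac_inclLoc hm, ← locFrac_inclLoc hm, h]

/-- The element `φ(E)` is a unit of `S_n[z_n⁻¹]` for `n ≥ 1`. -/
lemma isUnit_toLoc_frobS_elt (n : ℕ) : IsUnit (E.toLoc (n + 1)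
    (algebraMap (BKRing p k) _ (frobBK p k (E.elt (n + 1))))) := by
  rw [← frobS_algebraMap, ← p_mul_c, map_mul]
  exact (E.isUnit_toLoc_p n).mul ((E.c (n + 1)).isUnit.map _)

end NormalizedPoly

end FrobFil

/-! ### Base change to `S` -/

lemma smul_left_cancel_of_free {R M : Type*} [CommRing R] [IsDomain R] [AddCommGroup M] [Module R M]
    [Module.Free R M] {a : R} (ha : a ≠ 0) {x y : M} (h : a • x = a • y) : x = y := by
  apply (Module.Free.chooseBasis R M).repr.injective
  ext i
  have h1 := congrArg (fun z => (Module.Free.chooseBasis R M).repr z i) h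
  simp only [map_smul, Finsupp.smul_apply, smul_eq_mul] at h1
  exact mul_left_cancel₀ ha h1

section BaseChange

variable {p : ℕ} [Fact p.Prime] {k : Type u} [Field k] [CharP k p] [PerfectRing k p]
variable {E : NormalizedPoly p k} {r m : ℕ}

/-- On `Fil^r M` the Frobenius is `φ(E) ^ r φ_{M,r}`. -/
lemma BKMod.phi_of_mem (M : BKMod E r) (x : M.Fil) :
    BKMod.phi M x = frobBK p k E.ser ^ r • M.phiR x := by
  rw [← map_pow, ← M.phiR.map_smulₛₗ]
  rfl

/-- On `Fil^r 𝓜` the Frobenius is `p ^ r φ_{𝓜,r}`. -/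
lemma BreuilMod.phi_of_mem (M : BreuilMod E r) (x : M.Fil) :
    BreuilMod.phi M x = (p : E.S 0) ^ r • M.phiR x := by
  have h : E.frobS 0 E.inS = (p : E.S 0) * E.c 0 := (E.p_mul_c 0).symm
  have h1 : M.phiOf (E.inS ^ r) E.inS_pow_mem (x : M.carrier) =
      E.frobS 0 (E.inS ^ r) • M.phiR x := by
    rw [← M.phiR.map_smulₛₗ]
    rfl
  rw [BreuilMod.phi, LinearMap.smul_apply, h1, smul_smul, map_pow, h, mul_pow, mul_left_comm,
    ← Units.val_pow_eq_pow_val, ← Units.val_mul, ← mul_pow, inv_mul_cancel, one_pow, Units.val_one,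
    mul_one]

variable (M : BKMod E r)

/-- The submodule of `S ⊗ M` generated by `Fil^p S ⊗ M`. -/
noncomputable def filP : Submodule (E.S 0) (E.S 0 ⊗[BKRing p k] M.carrier) :=
  Submodule.span (E.S 0) {x | ∃ s ∈ E.FilS 0 p, ∃ m : M.carrier, x = s ⊗ₜ m}

/-- The submodule `Fil^r (S ⊗ M)` generated by the images of `S ⊗ Fil^r M` and `Fil^r S ⊗ M`. -/
noncomputable def filB : Submodule (E.S 0) (E.S 0 ⊗[BKRing p k] M.carrier) :=
  Submodule.span (E.S 0)
    ({x | ∃ s : E.S 0, ∃ m ∈ M.Fil, x = s ⊗ₜ m} ∪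
      {x | ∃ s ∈ E.FilS 0 r, ∃ m : M.carrier, x = s ⊗ₜ m})

/-- The Frobenius `φ ⊗ φ_M` of `S ⊗ M`. -/
noncomputable def frobB :
    E.S 0 ⊗[BKRing p k] M.carrier →ₛₗ[E.frobS 0] E.S 0 ⊗[BKRing p k] M.carrier :=
  semiTensor (E.frobS_algebraMap 0) (BKMod.phi M)

variable {M}

lemma frobB_tmul (s : E.S 0) (m : M.carrier) :
    frobB M (s ⊗ₜ m) = E.frobS 0 s ⊗ₜ BKMod.phi M m := rfl

lemma elt_zero : E.elt 0 = E.ser := rfl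

lemma filP_le (hr : r < p - 1) : filP M ≤ filB M := by
  refine Submodule.span_mono ?_
  rintro _ ⟨s, hs, m, rfl⟩
  exact Or.inr ⟨s, NormalizedPoly.FilS_mono (by omega) hs, m, rfl⟩

lemma one_tmul_mem_Fil {m : M.carrier} (hm : m ∈ M.Fil) :
    (1 ⊗ₜ m : E.S 0 ⊗[BKRing p k] M.carrier) ∈ filB M :=
  Submodule.subset_span (Or.inl ⟨1, m, hm, rfl⟩)

/-- `S ⊗ M = M + Fil^p S ⊗ M`, because `S = 𝔖 + Fil^p S`. -/
lemma exists_tmul_add_filP (x : E.S 0 ⊗[BKRing p k] M.carrier) :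
    ∃ m : M.carrier, x - 1 ⊗ₜ m ∈ filP M := by
  induction x with
  | zero => exact ⟨0, by rw [TensorProduct.tmul_zero, sub_zero]; exact zero_mem _⟩
  | add x y hx hy =>
    obtain ⟨m, hm⟩ := hx
    obtain ⟨m', hm'⟩ := hy
    refine ⟨m + m', ?_⟩
    rw [TensorProduct.tmul_add, add_sub_add_comm]
    exact add_mem hm hm'
  | tmul s m =>
    obtain ⟨g, hg⟩ := NormalizedPoly.exists_add_FilS le_rfl s
    refine ⟨g • m, ?_⟩
    rw [TensorProduct.tmul_smul, TensorProduct.smul_tmul', Algebra.smul_def, mul_one,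
      ← TensorProduct.sub_tmul]
    exact Submodule.subset_span ⟨_, hg, m, rfl⟩

/-- `Fil^r (S ⊗ M) = Fil^r M + Fil^p S ⊗ M`: for `s = g + s'` in `Fil^r S` with `g` in `𝔖` and
`s'` in `Fil^p S`, the element `g` is in `𝔖 ∩ Fil^r S = E ^ r 𝔖`. -/
lemma exists_tmul_add_filP_of_mem (hm : E.HasOrder m) (hr : r < p - 1)
    {x : E.S 0 ⊗[BKRing p k] M.carrier} (hx : x ∈ filB M) :
    ∃ f ∈ M.Fil, x - 1 ⊗ₜ f ∈ filP M := by
  have key : ∀ (s : E.S 0) (f : M.carrier), f ∈ M.Fil → ∃ f' ∈ M.Fil,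
      (s ⊗ₜ f - 1 ⊗ₜ f' : E.S 0 ⊗[BKRing p k] M.carrier) ∈ filP M := by
    intro s f hf
    obtain ⟨g, hg⟩ := NormalizedPoly.exists_add_FilS le_rfl s
    refine ⟨g • f, Submodule.smul_mem _ _ hf, ?_⟩
    rw [TensorProduct.tmul_smul, TensorProduct.smul_tmul', Algebra.smul_def, mul_one,
      ← TensorProduct.sub_tmul]
    exact Submodule.subset_span ⟨_, hg, f, rfl⟩
  unfold filB at hx
  induction hx using Submodule.span_induction with
  | mem x hx =>
    obtain ⟨s, f, hf, rfl⟩ | ⟨s, hs, f, rfl⟩ := hx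
    · exact key s f hf
    · obtain ⟨g, hg⟩ := NormalizedPoly.exists_add_FilS le_rfl s
      refine ⟨g • f, ?_, ?_⟩
      · have h1 : algebraMap (BKRing p k) (E.S 0) g ∈ E.FilS 0 r := by
          rw [← sub_sub_cancel s (algebraMap _ _ g)]
          exact sub_mem hs (NormalizedPoly.FilS_mono (by omega) hg)
        obtain ⟨h, rfl⟩ := NormalizedPoly.pow_dvd_of_mem_FilS hm (by omega) h1
        exact M.smul_mem_Fil (Ideal.mem_span_singleton.mpr (Dvd.intro h rfl)) f
      · rw [TensorProduct.tmul_smul, TensorProduct.smul_tmul', Algebra.smul_def, mul_one,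
          ← TensorProduct.sub_tmul]
        exact Submodule.subset_span ⟨_, hg, f, rfl⟩
  | zero => exact ⟨0, zero_mem _, by rw [TensorProduct.tmul_zero, sub_zero]; exact zero_mem _⟩
  | add x y _ _ hx hy =>
    obtain ⟨m, hm, h⟩ := hx
    obtain ⟨m', hm', h'⟩ := hy
    refine ⟨m + m', add_mem hm hm', ?_⟩
    rw [TensorProduct.tmul_add, add_sub_add_comm]
    exact add_mem h h'
  | smul s x _ hx =>
    obtain ⟨f, hf, h⟩ := hx
    obtain ⟨f', hf', h'⟩ := key s f hf
    refine ⟨f', hf', ?_⟩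
    have h2 := add_mem (Submodule.smul_mem _ s h) h'
    rwa [smul_sub, TensorProduct.smul_tmul', smul_eq_mul, mul_one, sub_add_sub_cancel] at h2

/-- `M ∩ (Fil^p S ⊗ M)` is contained in `Fil^r M`, as `𝔖 ∩ Fil^p S = E ^ p 𝔖`. -/
lemma mem_Fil_of_tmul_mem_filP (hm : E.HasOrder m) (hr : r < p - 1) {f : M.carrier}
    (hf : (1 ⊗ₜ f : E.S 0 ⊗[BKRing p k] M.carrier) ∈ filP M) : f ∈ M.Fil := by
  let b := Module.Free.chooseBasis (BKRing p k) M.carrier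
  have h1 : ∀ x ∈ filP M, ∀ i, (b.baseChange (E.S 0)).repr x i ∈ E.FilS 0 p := by
    intro x hx i
    unfold filP at hx
    induction hx using Submodule.span_induction with
    | mem x hx =>
      obtain ⟨s, hs, m, rfl⟩ := hx
      rw [Module.Basis.baseChange_repr_tmul, Algebra.smul_def]
      exact Ideal.mul_mem_left _ _ hs
    | zero => simp
    | add x y _ _ hx hy => rw [map_add]; exact add_mem hx hy
    | smul s x _ hx => rw [map_smul]; exact Ideal.mul_mem_left _ _ hx
  have h2 : ∀ i, ∃ c, b.repr f i = E.ser ^ r * c := by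
    intro i
    have h2 := h1 _ hf i
    rw [Module.Basis.baseChange_repr_tmul, Algebra.smul_def, mul_one] at h2
    have h3 := NormalizedPoly.pow_dvd_of_mem_FilS hm le_rfl h2
    rw [elt_zero] at h3
    exact (pow_dvd_pow E.ser (show r ≤ p by omega)).trans h3
  choose c hc using h2
  rw [← b.sum_repr f]
  refine sum_mem fun i _ => ?_
  rw [hc]
  exact M.smul_mem_Fil (Ideal.mem_span_singleton.mpr (Dvd.intro _ rfl)) _

lemma one_tmul_mem_Fil_iff (hm : E.HasOrder m) (hr : r < p - 1) {f : M.carrier} :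
    (1 ⊗ₜ f : E.S 0 ⊗[BKRing p k] M.carrier) ∈ filB M ↔ f ∈ M.Fil := by
  refine ⟨fun h => ?_, one_tmul_mem_Fil⟩
  obtain ⟨f', hf', h'⟩ := exists_tmul_add_filP_of_mem hm hr h
  rw [← TensorProduct.tmul_sub] at h'
  rw [← sub_add_cancel f f']
  exact add_mem (mem_Fil_of_tmul_mem_filP hm hr h') hf'

lemma one_tmul_smul (g : BKRing p k) (m : M.carrier) :
    (1 ⊗ₜ (g • m) : E.S 0 ⊗[BKRing p k] M.carrier) =
      algebraMap (BKRing p k) (E.S 0) g • (1 ⊗ₜ m) := by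
  rw [TensorProduct.tmul_smul, TensorProduct.smul_tmul', TensorProduct.smul_tmul',
    Algebra.smul_def, smul_eq_mul]

lemma tmul_eq_smul (s : E.S 0) (m : M.carrier) :
    (s ⊗ₜ m : E.S 0 ⊗[BKRing p k] M.carrier) = s • (1 ⊗ₜ m) := by
  rw [TensorProduct.smul_tmul', smul_eq_mul, mul_one]

lemma frobS_ser_pow : algebraMap (BKRing p k) (E.S 0) (frobBK p k E.ser ^ r) =
    (p : E.S 0) ^ r * (E.c 0 : E.S 0) ^ r := by
  rw [map_pow, ← mul_pow, ← NormalizedPoly.frobS_algebraMap]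
  exact congrArg (· ^ r) (E.p_mul_c 0).symm

lemma frobB_tmul_of_mem (s : E.S 0) (f : M.Fil) : frobB M (s ⊗ₜ (f : M.carrier)) =
    (p : E.S 0) ^ r • ((E.frobS 0 s * (E.c 0 : E.S 0) ^ r) • (1 ⊗ₜ M.phiR f)) := by
  rw [frobB_tmul, BKMod.phi_of_mem, tmul_eq_smul, one_tmul_smul, frobS_ser_pow, smul_smul,
    smul_smul]
  congr 1
  ring

lemma smul_mem_filB {s : E.S 0} (hs : s ∈ E.FilS 0 r) (x : E.S 0 ⊗[BKRing p k] M.carrier) :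
    s • x ∈ filB M := by
  induction x with
  | zero => rw [smul_zero]; exact zero_mem _
  | add x y hx hy => rw [smul_add]; exact add_mem hx hy
  | tmul t m =>
    rw [TensorProduct.smul_tmul']
    exact Submodule.subset_span (Or.inr ⟨s * t, Ideal.mul_mem_right _ _ hs, m, rfl⟩)

/-- The quotient of `S ⊗ M` by `Fil^r (S ⊗ M)` is `p`-torsion free; in fact it is `M / Fil^r M`. -/
lemma mem_filB_of_smul_mem (hm : E.HasOrder m) (hr : r < p - 1)
    {x : E.S 0 ⊗[BKRing p k] M.carrier} (hx : (p : E.S 0) • x ∈ filB M) : x ∈ filB M := by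
  obtain ⟨m, hmx⟩ := exists_tmul_add_filP x
  have h1 : (1 ⊗ₜ ((p : BKRing p k) • m) : E.S 0 ⊗[BKRing p k] M.carrier) ∈ filB M := by
    have h2 := sub_mem hx (Submodule.smul_mem _ (p : E.S 0) (filP_le hr hmx))
    rw [one_tmul_smul, map_natCast]
    convert h2 using 1
    rw [smul_sub, sub_sub_cancel]
  rw [one_tmul_mem_Fil_iff hm hr] at h1
  have h4 : m ∈ M.Fil := by
    have := M.torsionFree (Submodule.Quotient.mk m) (by
      rw [← Submodule.Quotient.mk_smul, Submodule.Quotient.mk_eq_zero]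
      exact h1)
    rwa [Submodule.Quotient.mk_eq_zero] at this
  have h5 := add_mem (filP_le hr hmx) (one_tmul_mem_Fil h4)
  rwa [sub_add_cancel] at h5

lemma exists_smul_eq_frobB (hm : E.HasOrder m) (hr : r < p - 1)
    {x : E.S 0 ⊗[BKRing p k] M.carrier} (hx : x ∈ filB M) :
    ∃ y, (p : E.S 0) ^ r • y = frobB M x := by
  unfold filB at hx
  induction hx using Submodule.span_induction with
  | mem x hx =>
    obtain ⟨s, f, hf, rfl⟩ | ⟨s, hs, f, rfl⟩ := hx
    · exact ⟨_, (frobB_tmul_of_mem s ⟨f, hf⟩).symm⟩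
    · obtain ⟨t, ht⟩ := NormalizedPoly.pow_dvd_frobS hm 0 (by omega) hs
      exact ⟨t ⊗ₜ BKMod.phi M f, by rw [frobB_tmul, ht, TensorProduct.smul_tmul', smul_eq_mul]⟩
  | zero => exact ⟨0, by rw [smul_zero, map_zero]⟩
  | add x y _ _ hx hy =>
    obtain ⟨a, ha⟩ := hx
    obtain ⟨b, hb⟩ := hy
    exact ⟨a + b, by rw [smul_add, ha, hb, map_add]⟩
  | smul s x _ hx =>
    obtain ⟨a, ha⟩ := hx
    exact ⟨E.frobS 0 s • a, by rw [smul_comm, ha, map_smulₛₗ]⟩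

lemma span_div_frobB_eq_top :
    Submodule.span (E.S 0) {y | ∃ x ∈ filB M, (p : E.S 0) ^ r • y = frobB M x} = ⊤ := by
  rw [eq_top_iff]
  intro x _
  have h1 : ∀ f : M.carrier, (1 ⊗ₜ f : E.S 0 ⊗[BKRing p k] M.carrier) ∈
      Submodule.span (E.S 0) {y | ∃ x ∈ filB M, (p : E.S 0) ^ r • y = frobB M x} := by
    intro f
    have hf : f ∈ Submodule.span (BKRing p k) (Set.range M.phiR) := by
      rw [M.span_range_phiR]; trivial
    induction hf using Submodule.span_induction with
    | mem f hf =>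
      obtain ⟨f, rfl⟩ := hf
      have h2 := Submodule.smul_mem (Submodule.span (E.S 0)
        {y | ∃ x ∈ filB M, (p : E.S 0) ^ r • y = frobB M x})
        (((E.c 0)⁻¹ ^ r : (E.S 0)ˣ) : E.S 0)
        (Submodule.subset_span ⟨_, one_tmul_mem_Fil f.2, (frobB_tmul_of_mem 1 f).symm⟩)
      rwa [map_one, one_mul, smul_smul, ← Units.val_pow_eq_pow_val, ← Units.val_mul, ← mul_pow,
        inv_mul_cancel, one_pow, Units.val_one, one_smul] at h2
    | zero => rw [TensorProduct.tmul_zero]; exact zero_mem _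
    | add x y _ _ hx hy => rw [TensorProduct.tmul_add]; exact add_mem hx hy
    | smul g x _ hx => rw [one_tmul_smul]; exact Submodule.smul_mem _ _ hx
  induction x with
  | zero => exact zero_mem _
  | add x y hx hy => exact add_mem (hx trivial) (hy trivial)
  | tmul s f => rw [tmul_eq_smul]; exact Submodule.smul_mem _ s (h1 f)

/-- The base change of a filtered Breuil–Kisin module is a quasi-Breuil module. -/
theorem baseChangeIsBreuil (hm : E.HasOrder m) (hr : r < p - 1) : BaseChangeIsBreuil E r := by
  intro M
  have := NormalizedPoly.isDomain_S hm 0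
  have hp0 : (p : E.S 0) ^ r ≠ 0 := pow_ne_zero _ (NormalizedPoly.natCast_p_ne_zero hm 0)
  exact
    { finite := inferInstanceAs (Module.Finite (E.S 0) (E.S 0 ⊗[BKRing p k] M.carrier))
      free := inferInstanceAs (Module.Free (E.S 0) (E.S 0 ⊗[BKRing p k] M.carrier))
      smul_top_le := Submodule.smul_le.mpr fun s hs x _ => smul_mem_filB (M := M) hs x
      torsionFree := fun x hx => by
        obtain ⟨x, rfl⟩ := Submodule.Quotient.mk_surjective _ x
        rw [← Submodule.Quotient.mk_smul, Submodule.Quotient.mk_eq_zero] at hx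
        rw [Submodule.Quotient.mk_eq_zero]
        exact mem_filB_of_smul_mem (M := M) hm hr hx
      existsUnique_div := fun x hx => existsUnique_of_exists_of_unique
        (exists_smul_eq_frobB (M := M) hm hr hx) fun y z hy hz =>
          smul_left_cancel_of_free (M := E.S 0 ⊗[BKRing p k] M.carrier) hp0 (hy.trans hz.symm)
      span_eq_top := span_div_frobB_eq_top (M := M) }

end BaseChange

/-! ### The modules `S_n[z_n⁻¹] ⊗ M` for a filtered Breuil–Kisin module `M` -/

section LevelBK

variable {p : ℕ} [Fact p.Prime] {k : Type u} [Field k] [CharP k p] [PerfectRing k p]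
variable {E : NormalizedPoly p k} {r m : ℕ}

namespace NormalizedPoly

variable (E) in
/-- The map `𝔖_n → S_n[z_n⁻¹]`. -/
noncomputable def bkLoc (n : ℕ) : BKRing p k →+* E.SLoc n :=
  (E.toLoc n).comp (algebraMap (BKRing p k) (E.S n))

lemma bkLoc_apply (n : ℕ) (g : BKRing p k) :
    E.bkLoc n g = E.toLoc n (algebraMap (BKRing p k) (E.S n) g) := rfl

lemma baseS_algebraMap (n : ℕ) (g : BKRing p k) :
    E.baseS n (algebraMap _ _ g) = algebraMap (BKRing p k) (E.S n) ((inclBK p k)^[n] g) := by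
  induction n with
  | zero => rfl
  | succ n ih =>
    rw [baseS, RingHom.comp_apply, ih, inclS_algebraMap, Function.iterate_succ_apply']

lemma inclD_mem_FilD {n M : ℕ} {d : E.PDEnv n} (hd : d ∈ E.FilD n M) :
    E.inclD n d ∈ E.FilD (n + 1) M := by
  induction hd using Submodule.span_induction with
  | mem x hx =>
    obtain ⟨i, hi, rfl⟩ := hx
    exact Ideal.subset_span ⟨i, hi, inclD_gammaD n i⟩
  | zero => rw [map_zero]; exact zero_mem _
  | add x y _ _ hx hy => rw [map_add]; exact add_mem hx hy
  | smul a x _ hx => rw [smul_eq_mul, map_mul]; exact Ideal.mul_mem_left _ _ hx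

lemma inclS_mem_FilS {n M : ℕ} {s : E.S n} (hs : s ∈ E.FilS n M) :
    E.inclS n s ∈ E.FilS (n + 1) M := by
  rw [mem_FilS_iff] at hs ⊢
  intro N
  obtain ⟨d, hd, t, h⟩ := hs N
  exact ⟨_, inclD_mem_FilD hd, E.inclS n t, by
    rw [h, map_add, map_mul, map_pow, map_natCast, inclS_D]⟩

lemma baseS_mem_FilS (n : ℕ) {M : ℕ} {s : E.S 0} (hs : s ∈ E.FilS 0 M) :
    E.baseS n s ∈ E.FilS n M := by
  induction n with
  | zero => exact hs
  | succ n ih => exact inclS_mem_FilS ih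

lemma inclS_c (hm : E.HasOrder m) (n : ℕ) : E.inclS n (E.c n) = E.c (n + 1) := by
  have := isDomain_S hm (n + 1)
  apply mul_left_cancel₀ (natCast_p_ne_zero hm (n + 1))
  rw [p_mul_c, ← inclBK_elt, ← inclS_algebraMap, frobS_inclS, ← p_mul_c, map_mul, map_natCast]

lemma twistBK_surjective (n : ℕ) : Function.Surjective (twistBK p k n) := by
  have h : Function.Surjective (sigmaInv p k n) := by
    have h1 : ∀ a, sigmaInv p k n a = ((WittVector.frobeniusEquiv p k).symm)^[n] a := by
      intro a
      induction n generalizing a with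
      | zero => rfl
      | succ n ih =>
        have : sigmaInv p k (n + 1) a =
          sigmaInv p k n ((WittVector.frobeniusEquiv p k).symm a) := by simp [sigmaInv, pow_succ]
        rw [this, ih, Function.iterate_succ_apply]
    intro b
    obtain ⟨a, ha⟩ := (WittVector.frobeniusEquiv p k).symm.surjective.iterate n b
    exact ⟨a, (h1 a).trans ha⟩
  intro f
  choose w hw using fun j => h (PowerSeries.coeff j f)
  refine ⟨PowerSeries.mk w, ?_⟩
  ext j : 1
  rw [twistBK, PowerSeries.coeff_map, PowerSeries.coeff_mk, hw]

end NormalizedPoly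

open NormalizedPoly

/-- The quasi-Breuil module `S ⊗ M`. -/
noncomputable abbrev bc (hB : BaseChangeIsBreuil E r) (M : BKMod E r) : BreuilMod E r :=
  (baseChangeFunctor hB).obj M

variable (hB : BaseChangeIsBreuil E r) (M : BKMod E r) (n : ℕ)

lemma bc_phi (hm : E.HasOrder m) (x : E.S 0 ⊗[BKRing p k] M.carrier) :
    BreuilMod.phi (bc hB M) x = frobB M x := by
  have := isDomain_S hm 0
  have hp0 : (p : E.S 0) ^ r ≠ 0 := pow_ne_zero _ (natCast_p_ne_zero hm 0)
  have hx : E.inS ^ r • x ∈ filB M := smul_mem_filB E.inS_pow_mem x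
  have h1 : (p : E.S 0) ^ r • ((bc hB M).phiR ⟨E.inS ^ r • x, hx⟩ : E.S 0 ⊗[BKRing p k] M.carrier) =
      frobB M (E.inS ^ r • x) := (hB M).smul_divided_phiR ⟨E.inS ^ r • x, hx⟩
  have h2 : E.frobS 0 (E.inS ^ r) = (p : E.S 0) ^ r * (E.c 0 : E.S 0) ^ r := by
    rw [map_pow, ← mul_pow]
    exact congrArg (· ^ r) (E.p_mul_c 0).symm
  rw [map_smulₛₗ, h2, mul_smul] at h1
  have h3 := smul_left_cancel_of_free hp0 h1
  have h4 : BreuilMod.phi (bc hB M) x = (((E.c 0)⁻¹ ^ r : (E.S 0)ˣ) : E.S 0) •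
    ((bc hB M).phiR ⟨E.inS ^ r • x, hx⟩ : E.S 0 ⊗[BKRing p k] M.carrier) := rfl
  refine h4.trans ?_
  rw [h3]
  refine (smul_smul _ _ (frobB M x)).trans ?_
  rw [← Units.val_pow_eq_pow_val, ← Units.val_mul, ← mul_pow, inv_mul_cancel, one_pow,
    Units.val_one, one_smul]

variable {M} in
/-- The element `1 ⊗ m` of `S_n[z_n⁻¹] ⊗ M`. -/
noncomputable def lm (x : M.carrier) : Level (bc hB M) n :=
  Level.tmul 1 (show (bc hB M).carrier from (1 ⊗ₜ x : E.S 0 ⊗[BKRing p k] M.carrier))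

variable {M}

lemma lm_add (x y : M.carrier) : lm hB n (x + y) = lm hB n x + lm hB n y := by
  unfold lm
  rw [TensorProduct.tmul_add]
  exact TensorProduct.tmul_add _ _ _

lemma level_smul_tmul (s : E.S 0) (x : (bc hB M).carrier) :
    (Level.tmul 1 (s • x) : Level (bc hB M) n) = E.toLoc n (E.baseS n s) • Level.tmul 1 x := by
  rw [Level.smul_tmul, mul_one]
  refine (TensorProduct.tmul_smul s (1 : E.SLoc n) x).trans ?_
  refine (TensorProduct.smul_tmul' _ _ _).trans ?_
  rw [Algebra.smul_def, mul_one]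
  rfl

lemma lm_smul (g : BKRing p k) (x : M.carrier) :
    lm hB n (g • x) = E.bkLoc n ((inclBK p k)^[n] g) • lm hB n x := by
  unfold lm
  rw [one_tmul_smul, bkLoc_apply, ← baseS_algebraMap]
  exact level_smul_tmul hB n _ _

lemma tmul_eq_smul_lm (s : E.S 0) (x : M.carrier) :
    (Level.tmul 1 (show (bc hB M).carrier from (s ⊗ₜ x : E.S 0 ⊗[BKRing p k] M.carrier)) :
      Level (bc hB M) n) = E.toLoc n (E.baseS n s) • lm hB n x := by
  rw [tmul_eq_smul]
  exact level_smul_tmul hB n _ _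

lemma frob_smul_lm (hm : E.HasOrder m) (s : E.SLoc n) (x : M.carrier) :
    Level.frob (bc hB M) n (s • lm hB n x) = E.frobLoc n s • lm hB n (BKMod.phi M x) := by
  rw [map_smulₛₗ]
  congr 1
  unfold lm
  rw [Level.frob_tmul, map_one]
  congr 1
  refine (bc_phi hB M hm _).trans ?_
  rw [frobB_tmul, map_one]

lemma incl_lm (x : M.carrier) : Level.incl (bc hB M) n (lm hB n x) = lm hB (n + 1) x := by
  unfold lm
  rw [Level.incl_tmul, map_one]

/-- The action of `𝔖` on level `n` is twisted by the automorphism `φ^{-n}` of the coefficients, so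
that `𝔖`-submodules and `𝔖_n`-submodules agree. -/
lemma exists_bk_smul (g : BKRing p k) :
    ∃ g' : BKRing p k, ∀ x : Level (bc hB M) n, E.bkLoc n g • x = g' • x := by
  obtain ⟨g', rfl⟩ := twistBK_surjective n g
  exact ⟨g', fun x => rfl⟩

/-- The element `φ(E)` of `S_n[z_n⁻¹]`. -/
noncomputable def phiE (E : NormalizedPoly p k) (n : ℕ) : E.SLoc n :=
  E.bkLoc n (frobBK p k (E.elt n))

lemma frob_lm_of_mem (hm : E.HasOrder m) (x : M.Fil) :
    Level.frob (bc hB M) n (lm hB n (x : M.carrier)) = phiE E n ^ r • lm hB n (M.phiR x) := by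
  have h := frob_smul_lm hB n hm 1 (x : M.carrier)
  rw [one_smul, map_one, one_smul] at h
  rw [h, BKMod.phi_of_mem, lm_smul, phiE, ← map_pow]
  congr 2
  rw [← map_pow, ← map_pow, ← frobBK_iterate_inclBK, iterate_map_pow]
  rfl

/-- The `𝔖_n`-submodule of `S_n[z_n⁻¹] ⊗ M` generated by a submodule of `M`. -/
noncomputable def latL (N : Submodule (BKRing p k) M.carrier) :
    Submodule (BKRing p k) (Level (bc hB M) n) :=
  Submodule.span (BKRing p k) (lm hB n '' N)

/-- The `S_n`-submodule of `S_n[z_n⁻¹] ⊗ M` generated by a submodule of `M`. -/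
noncomputable def latS (N : Submodule (BKRing p k) M.carrier) :
    Submodule (E.S n) (Level (bc hB M) n) :=
  Submodule.span (E.S n) (lm hB n '' N)

variable (M) in
/-- The `S_n`-submodule of `S_n[z_n⁻¹] ⊗ M` generated by `Fil^p S_n ⊗ M`. -/
noncomputable def latP : Submodule (E.S n) (Level (bc hB M) n) :=
  Submodule.span (E.S n) {y | ∃ s ∈ E.FilS n p, ∃ x : M.carrier, y = E.toLoc n s • lm hB n x}

variable {n} in
lemma bkLoc_smul_mem {N : Submodule (BKRing p k) M.carrier} (g : BKRing p k)
    {x : Level (bc hB M) n} (hx : x ∈ latL hB n N) : E.bkLoc n g • x ∈ latL hB n N := by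
  obtain ⟨g', hg'⟩ := exists_bk_smul hB (M := M) n g
  rw [hg']
  exact Submodule.smul_mem _ _ hx

lemma latL_mono {N N' : Submodule (BKRing p k) M.carrier} (h : N ≤ N') :
    latL hB n N ≤ latL hB n N' :=
  Submodule.span_mono (Set.image_mono h)

/-- `φ` maps the lattice of `Fil^r M` at level `n + 1` onto `φ(E) ^ r` times the lattice of `M` at
level `n`. -/
lemma exists_frob_eq (hm : E.HasOrder m) {y : Level (bc hB M) n} (hy : y ∈ latL hB n ⊤) :
    ∃ x ∈ latL hB (n + 1) M.Fil,
      Level.frob (bc hB M) (n + 1) x = phiE E (n + 1) ^ r • Level.incl (bc hB M) n y := by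
  have hsmul : ∀ (g : BKRing p k) (y : Level (bc hB M) n), (∃ x ∈ latL hB (n + 1) M.Fil,
      Level.frob (bc hB M) (n + 1) x = phiE E (n + 1) ^ r • Level.incl (bc hB M) n y) →
      ∃ x ∈ latL hB (n + 1) M.Fil, Level.frob (bc hB M) (n + 1) x =
        phiE E (n + 1) ^ r • Level.incl (bc hB M) n (g • y) := by
    rintro g y ⟨x, hx, h⟩
    refine ⟨g • x, Submodule.smul_mem _ _ hx, ?_⟩
    rw [Level.frob_bk_smul_succ, h, Level.bk_smul_def, Level.incl_smul, smul_comm]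
  have hadd : ∀ (y y' : Level (bc hB M) n), (∃ x ∈ latL hB (n + 1) M.Fil,
      Level.frob (bc hB M) (n + 1) x = phiE E (n + 1) ^ r • Level.incl (bc hB M) n y) →
      (∃ x ∈ latL hB (n + 1) M.Fil,
      Level.frob (bc hB M) (n + 1) x = phiE E (n + 1) ^ r • Level.incl (bc hB M) n y') →
      ∃ x ∈ latL hB (n + 1) M.Fil, Level.frob (bc hB M) (n + 1) x =
        phiE E (n + 1) ^ r • Level.incl (bc hB M) n (y + y') := by
    rintro y y' ⟨x, hx, h⟩ ⟨x', hx', h'⟩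
    exact ⟨x + x', add_mem hx hx', by rw [map_add, h, h', map_add, smul_add]⟩
  have hzero : ∃ x ∈ latL hB (n + 1) M.Fil, Level.frob (bc hB M) (n + 1) x =
        phiE E (n + 1) ^ r • Level.incl (bc hB M) n 0 :=
    ⟨0, zero_mem _, by rw [map_zero, map_zero, smul_zero]⟩
  unfold latL at hy
  induction hy using Submodule.span_induction with
  | mem y hy =>
    obtain ⟨x, -, rfl⟩ := hy
    have hx : x ∈ Submodule.span (BKRing p k) (Set.range M.phiR) := by
      rw [M.span_range_phiR]; trivial
    induction hx using Submodule.span_induction with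
    | mem x hx =>
      obtain ⟨f, rfl⟩ := hx
      exact ⟨lm hB (n + 1) (f : M.carrier), Submodule.subset_span ⟨_, f.2, rfl⟩, by
        rw [frob_lm_of_mem hB _ hm, incl_lm]⟩
    | zero =>
      have : lm hB n (0 : M.carrier) = 0 := by
        have := lm_add hB n (0 : M.carrier) 0
        rwa [add_zero, left_eq_add] at this
      rw [this]
      exact hzero
    | add x x' _ _ hx hx' => rw [lm_add]; exact hadd _ _ hx hx'
    | smul g x _ hx =>
      rw [lm_smul]
      obtain ⟨g', hg'⟩ := exists_bk_smul hB (M := M) n ((inclBK p k)^[n] g)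
      rw [hg']
      exact hsmul _ _ hx
  | zero => exact hzero
  | add y y' _ _ hy hy' => exact hadd _ _ hy hy'
  | smul g y _ hy => exact hsmul _ _ hy

/-- The converse of `exists_frob_eq`. -/
lemma exists_eq_frob (hm : E.HasOrder m) {x : Level (bc hB M) (n + 1)}
    (hx : x ∈ latL hB (n + 1) M.Fil) : ∃ y ∈ latL hB n (⊤ : Submodule (BKRing p k) M.carrier),
      Level.frob (bc hB M) (n + 1) x = phiE E (n + 1) ^ r • Level.incl (bc hB M) n y := by
  unfold latL at hx
  induction hx using Submodule.span_induction with
  | mem x hx =>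
    obtain ⟨f, hf, rfl⟩ := hx
    exact ⟨lm hB n (M.phiR ⟨f, hf⟩), Submodule.subset_span ⟨_, trivial, rfl⟩, by
      rw [incl_lm]; exact frob_lm_of_mem hB (n + 1) hm ⟨f, hf⟩⟩
  | zero => exact ⟨0, zero_mem _, by rw [map_zero, map_zero, smul_zero]⟩
  | add x x' _ _ hx hx' =>
    obtain ⟨y, hy, h⟩ := hx
    obtain ⟨y', hy', h'⟩ := hx'
    exact ⟨y + y', add_mem hy hy', by rw [map_add, h, h', map_add, smul_add]⟩
  | smul g x _ hx =>
    obtain ⟨y, hy, h⟩ := hx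
    refine ⟨g • y, Submodule.smul_mem _ _ hy, ?_⟩
    rw [Level.frob_bk_smul_succ, h, Level.bk_smul_def, Level.incl_smul, smul_comm]

lemma phiE_succ (n : ℕ) : phiE E (n + 1) = E.toLoc (n + 1) ((p : E.S (n + 1)) * E.c (n + 1)) := by
  rw [p_mul_c, frobS_algebraMap]
  rfl

lemma isUnit_phiE (n : ℕ) : IsUnit (phiE E (n + 1)) := isUnit_toLoc_frobS_elt n

/-- `φ` maps `Fil^p S_{n+1} ⊗ M` to `p ^ (p-1-r) φ(E) ^ r (S_n ⊗ M)`. -/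
lemma exists_eq_frob_of_mem_latP (hm : E.HasOrder m) (hr : r < p - 1)
    {x : Level (bc hB M) (n + 1)} (hx : x ∈ latP hB M (n + 1)) :
    ∃ y ∈ latS hB n (⊤ : Submodule (BKRing p k) M.carrier),
      Level.frob (bc hB M) (n + 1) x = phiE E (n + 1) ^ r • Level.incl (bc hB M) n
        (E.toLoc n ((p : E.S n) ^ (p - 1 - r)) • y) := by
  unfold latP at hx
  induction hx using Submodule.span_induction with
  | mem x hx =>
    obtain ⟨s, hs, x, rfl⟩ := hx
    obtain ⟨t, ht⟩ := pow_dvd_psiS hm n le_rfl (FilS_mono (by omega) hs)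
    refine ⟨(((E.c n)⁻¹ ^ r : (E.S n)ˣ) * t : E.S n) • lm hB n (BKMod.phi M x),
      Submodule.smul_mem _ _ (Submodule.subset_span ⟨_, trivial, rfl⟩), ?_⟩
    have h1 : (E.c (n + 1) : E.S (n + 1)) ^ r * E.inclS n ((E.c n)⁻¹ ^ r : (E.S n)ˣ) = 1 := by
      rw [← inclS_c hm, ← map_pow, ← map_mul, ← Units.val_pow_eq_pow_val, ← Units.val_mul,
        ← mul_pow, mul_inv_cancel, one_pow, Units.val_one, map_one]
    rw [frob_smul_lm hB _ hm, frobLoc_toLoc, ← inclS_psiS, ht, Level.smul_def', smul_smul,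
      Level.incl_smul, incl_lm, smul_smul, phiE_succ, ← map_mul, inclLoc_toLoc, ← map_pow,
      ← map_mul]
    congr 2
    have h2 : (p : E.S (n + 1)) ^ (p - 1) = (p : E.S (n + 1)) ^ r * (p : E.S (n + 1)) ^ (p - 1 - r) := by
      rw [← pow_add, Nat.add_sub_cancel' hr.le]
    simp only [map_mul, map_pow, map_natCast]
    rw [h2, mul_pow]
    linear_combination (-(p : E.S (n + 1)) ^ r * (p : E.S (n + 1)) ^ (p - 1 - r) * E.inclS n t) * h1
  | zero => exact ⟨0, zero_mem _, by rw [map_zero, smul_zero, map_zero, smul_zero]⟩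
  | add x x' _ _ hx hx' =>
    obtain ⟨y, hy, h⟩ := hx
    obtain ⟨y', hy', h'⟩ := hx'
    exact ⟨y + y', add_mem hy hy', by rw [map_add, h, h', smul_add, map_add, smul_add]⟩
  | smul s x _ hx =>
    obtain ⟨y, hy, h⟩ := hx
    refine ⟨E.psiS n s • y, Submodule.smul_mem _ _ hy, ?_⟩
    rw [Level.smul_def', map_smulₛₗ, h, frobLoc_toLoc, ← inclS_psiS, Level.smul_def',
      smul_comm (E.toLoc n _) (E.toLoc n _), Level.incl_smul (E.toLoc n (E.psiS n s)),
      inclLoc_toLoc, smul_comm]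

end LevelBK

/-! ### Contraction: the sequences `(ξ_n)` of `S ⊗ M` are determined by `ξ_0 ∈ M` -/

section Contraction

variable {p : ℕ} [Fact p.Prime] {k : Type u} [Field k] [CharP k p] [PerfectRing k p]
variable {E : NormalizedPoly p k} {r m : ℕ}

open NormalizedPoly

variable (hB : BaseChangeIsBreuil E r) {M : BKMod E r} (n : ℕ)

/-- The basis of `S_n[z_n⁻¹] ⊗ M` induced by a basis of `M`. -/
noncomputable def levelBasis : Module.Basis (Module.Free.ChooseBasisIndex (BKRing p k) M.carrier)
    (E.SLoc n) (Level (bc hB M) n) :=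
  ((Module.Free.chooseBasis (BKRing p k) M.carrier).baseChange (E.S 0)).baseChange (E.SLoc n)

lemma levelBasis_apply (i : Module.Free.ChooseBasisIndex (BKRing p k) M.carrier) :
    levelBasis hB n i = lm hB n (Module.Free.chooseBasis (BKRing p k) M.carrier i) := by
  refine (Module.Basis.baseChange_apply _ _ i).trans ?_
  rw [Module.Basis.baseChange_apply]
  rfl

lemma levelBasis_repr_smul_lm (s : E.SLoc n) (x : M.carrier)
    (i : Module.Free.ChooseBasisIndex (BKRing p k) M.carrier) :
    (levelBasis hB n).repr (s • lm hB n x) i = s * E.bkLoc n ((inclBK p k)^[n]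
      ((Module.Free.chooseBasis (BKRing p k) M.carrier).repr x i)) := by
  rw [map_smul, Finsupp.smul_apply, smul_eq_mul]
  congr 1
  have h := Module.Basis.baseChange_repr_tmul (E.SLoc n)
    ((Module.Free.chooseBasis (BKRing p k) M.carrier).baseChange (E.S 0)) (1 : E.SLoc n) (1 ⊗ₜ x) i
  refine h.trans ?_
  rw [Module.Basis.baseChange_repr_tmul, Algebra.smul_def, Algebra.smul_def, mul_one, mul_one,
    algebraMap_SLoc, bkLoc_apply, ← baseS_algebraMap]

lemma exists_bk_smul_eq (g : BKRing p k) :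
    ∃ g' : BKRing p k, ∀ x : Level (bc hB M) n, g • x = E.bkLoc n g' • x :=
  ⟨twistBK p k n g, fun _ => rfl⟩

lemma latL_le_latS {N : Submodule (BKRing p k) M.carrier} {x : Level (bc hB M) n}
    (hx : x ∈ latL hB n N) : x ∈ latS hB n N := by
  unfold latL at hx
  induction hx using Submodule.span_induction with
  | mem x hx => exact Submodule.subset_span hx
  | zero => exact zero_mem _
  | add x y _ _ hx hy => exact add_mem hx hy
  | smul g x _ hx => exact Submodule.smul_mem _ (E.twistS n g) hx

lemma smul_mem_latP {s : E.S n} (hs : s ∈ E.FilS n p) {N : Submodule (BKRing p k) M.carrier}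
    {x : Level (bc hB M) n} (hx : x ∈ latS hB n N) : s • x ∈ latP hB M n := by
  unfold latS at hx
  induction hx using Submodule.span_induction with
  | mem x hx =>
    obtain ⟨x, -, rfl⟩ := hx
    exact Submodule.subset_span ⟨s, hs, x, rfl⟩
  | zero => rw [smul_zero]; exact zero_mem _
  | add x y _ _ hx hy => rw [smul_add]; exact add_mem hx hy
  | smul g x _ hx => rw [smul_comm]; exact Submodule.smul_mem _ g hx

/-- Since `S_n = 𝔖_n + Fil^p S_n`, the `S_n`-lattices are the sum of the `𝔖_n`-lattices and of
`Fil^p S_n ⊗ M`. -/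
lemma exists_latL_add_latP {N : Submodule (BKRing p k) M.carrier} {x : Level (bc hB M) n}
    (hx : x ∈ latS hB n N) : ∃ f ∈ latL hB n N, x - f ∈ latP hB M n := by
  unfold latS at hx
  induction hx using Submodule.span_induction with
  | mem x hx => exact ⟨x, Submodule.subset_span hx, by rw [sub_self]; exact zero_mem _⟩
  | zero => exact ⟨0, zero_mem _, by rw [sub_self]; exact zero_mem _⟩
  | add x y _ _ hx hy =>
    obtain ⟨f, hf, h⟩ := hx
    obtain ⟨f', hf', h'⟩ := hy
    refine ⟨f + f', add_mem hf hf', ?_⟩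
    rw [add_sub_add_comm]
    exact add_mem h h'
  | smul s x _ hx =>
    obtain ⟨f, hf, h⟩ := hx
    obtain ⟨g, hg⟩ := exists_add_FilS le_rfl s
    refine ⟨E.bkLoc n g • f, bkLoc_smul_mem hB g hf, ?_⟩
    have h1 : s • x - E.bkLoc n g • f = s • (x - f) + (s - algebraMap (BKRing p k) (E.S n) g) • f := by
      rw [smul_sub, sub_smul]
      change _ = _ + (s • f - E.bkLoc n g • f)
      abel
    rw [h1]
    exact add_mem (Submodule.smul_mem _ s h) (smul_mem_latP hB n hg (latL_le_latS hB n hf))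

lemma repr_of_mem_latL {y : Level (bc hB M) n}
    (hy : y ∈ latL hB n (⊤ : Submodule (BKRing p k) M.carrier))
    (i : Module.Free.ChooseBasisIndex (BKRing p k) M.carrier) :
    ∃ g, (levelBasis hB n).repr y i = E.bkLoc n g := by
  unfold latL at hy
  induction hy using Submodule.span_induction with
  | mem x hx =>
    obtain ⟨x, -, rfl⟩ := hx
    have h := levelBasis_repr_smul_lm hB n 1 x i
    rw [one_smul, one_mul] at h
    exact ⟨_, h⟩
  | zero => exact ⟨0, by rw [map_zero, map_zero]; rfl⟩
  | add x y _ _ hx hy =>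
    obtain ⟨g, hg⟩ := hx
    obtain ⟨g', hg'⟩ := hy
    exact ⟨g + g', by rw [map_add, Finsupp.add_apply, hg, hg', map_add]⟩
  | smul a x _ hx =>
    obtain ⟨g, hg⟩ := hx
    obtain ⟨a', ha'⟩ := exists_bk_smul_eq hB (M := M) n a
    exact ⟨a' * g, by rw [ha', map_smul, Finsupp.smul_apply, hg, map_mul, smul_eq_mul]⟩

lemma repr_of_mem_latP {y : Level (bc hB M) n} (hy : y ∈ latP hB M n)
    (i : Module.Free.ChooseBasisIndex (BKRing p k) M.carrier) :
    ∃ s ∈ E.FilS n p, (levelBasis hB n).repr y i = E.toLoc n s := by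
  unfold latP at hy
  induction hy using Submodule.span_induction with
  | mem x hx =>
    obtain ⟨s, hs, x, rfl⟩ := hx
    rw [levelBasis_repr_smul_lm, bkLoc_apply, ← map_mul]
    exact ⟨_, Ideal.mul_mem_right _ _ hs, rfl⟩
  | zero => exact ⟨0, zero_mem _, by rw [map_zero, map_zero]; rfl⟩
  | add x y _ _ hx hy =>
    obtain ⟨g, hs, hg⟩ := hx
    obtain ⟨g', hs', hg'⟩ := hy
    exact ⟨g + g', add_mem hs hs', by rw [map_add, Finsupp.add_apply, hg, hg', map_add]⟩
  | smul a x _ hx =>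
    obtain ⟨g, hs, hg⟩ := hx
    exact ⟨a * g, Ideal.mul_mem_left _ _ hs, by
      rw [Level.smul_def', map_smul, Finsupp.smul_apply, hg, map_mul, smul_eq_mul]⟩

/-- `(𝔖_n ⊗ M) ∩ (Fil^p S_n ⊗ M)` is contained in `E ^ r (𝔖_n ⊗ M)`. -/
lemma mem_latL_of_mem_latP (hm : E.HasOrder m) (hr : r < p - 1) {y : Level (bc hB M) n}
    (hy : y ∈ latL hB n (⊤ : Submodule (BKRing p k) M.carrier)) (hy' : y ∈ latP hB M n) :
    y ∈ latL hB n M.Fil := by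
  have h1 : ∀ i, ∃ c, (levelBasis hB n).repr y i = E.bkLoc n (E.elt n ^ r * c) := by
    intro i
    obtain ⟨g, hg⟩ := repr_of_mem_latL hB n hy i
    obtain ⟨s, hs, hgs⟩ := repr_of_mem_latP hB n hy' i
    rw [hg, bkLoc_apply] at hgs
    rw [← toLoc_injective hm n hgs] at hs
    obtain ⟨c, rfl⟩ := (pow_dvd_pow (E.elt n) (show r ≤ p by omega)).trans
      (pow_dvd_of_mem_FilS hm le_rfl hs)
    exact ⟨c, hg⟩
  choose c hc using h1
  rw [← (levelBasis hB n).sum_repr y]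
  refine sum_mem fun i _ => ?_
  rw [hc, mul_comm, map_mul, mul_smul, levelBasis_apply]
  refine bkLoc_smul_mem hB _ (Submodule.subset_span ⟨E.ser ^ r •
    Module.Free.chooseBasis (BKRing p k) M.carrier i,
    M.smul_mem_Fil (Ideal.mem_span_singleton_self _) _, ?_⟩)
  rw [lm_smul, iterate_map_pow]
  rfl

lemma tmul_mem_latP {x : E.S 0 ⊗[BKRing p k] M.carrier} (hx : x ∈ filP M) :
    (Level.tmul 1 (show (bc hB M).carrier from x) : Level (bc hB M) n) ∈ latP hB M n := by
  unfold filP at hx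
  induction hx using Submodule.span_induction with
  | mem x hx =>
    obtain ⟨s, hs, x, rfl⟩ := hx
    rw [tmul_eq_smul_lm]
    exact Submodule.subset_span ⟨_, baseS_mem_FilS n hs, x, rfl⟩
  | zero =>
    have : (Level.tmul 1 (0 : (bc hB M).carrier) : Level (bc hB M) n) = 0 :=
      TensorProduct.tmul_zero _ _
    exact this ▸ zero_mem _
  | add x y _ _ hx hy =>
    have : (Level.tmul 1 (show (bc hB M).carrier from x + y) : Level (bc hB M) n) =
      Level.tmul 1 (show (bc hB M).carrier from x) + Level.tmul 1 (show (bc hB M).carrier from y) :=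
      TensorProduct.tmul_add _ _ _
    exact this ▸ add_mem hx hy
  | smul s x _ hx =>
    have := level_smul_tmul hB (M := M) n s x
    exact this ▸ Submodule.smul_mem _ (E.baseS n s) hx

/-- `Fil^0` is contained in `z_n^{-r} (S_n ⊗ Fil^r M + Fil^p S_n ⊗ M)`. -/
lemma zUnit_smul_mem_of_mem_fil (hm : E.HasOrder m) (hr : r < p - 1) {ξ : Level (bc hB M) (n + 1)}
    (hξ : ξ ∈ Level.fil (bc hB M) (n + 1) 0) :
    (E.zUnit (n + 1) : E.SLoc (n + 1)) ^ r • ξ ∈ latS hB (n + 1) M.Fil ⊔ latP hB M (n + 1) := by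
  unfold Level.fil at hξ
  induction hξ using Submodule.span_induction with
  | zero => rw [smul_zero]; exact zero_mem _
  | add x y _ _ hx hy => rw [smul_add]; exact add_mem hx hy
  | smul s x _ hx =>
    rw [Level.smul_def', smul_comm]
    exact Submodule.smul_mem _ s hx
  | mem x hx =>
    obtain ⟨a, b, hab, y, hy, rfl⟩ := hx
    unfold BreuilMod.fil FilteredPhiModule.FilZ at hy
    split_ifs at hy with hb
    · obtain ⟨e, he⟩ : ∃ e : ℕ, (r : ℤ) - b = e := ⟨((r : ℤ) - b).toNat, by omega⟩
      rw [he, Int.toNat_natCast] at hy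
      have hy : (E.inS ^ e • y : E.S 0 ⊗[BKRing p k] M.carrier) ∈ filB M := hy
      obtain ⟨w, hw⟩ := E.elt_dvd_z n
      have h1 : (E.zUnit (n + 1) : E.SLoc (n + 1)) ^ r *
          ((E.zUnit (n + 1) ^ a : (E.SLoc (n + 1))ˣ) : E.SLoc (n + 1)) =
          E.toLoc (n + 1) (algebraMap _ _ (w ^ e)) * E.toLoc (n + 1) (E.baseS (n + 1) (E.inS ^ e)) := by
        have h2 : E.inS ^ e = algebraMap (BKRing p k) (E.S 0) (E.ser ^ e) := by
          rw [map_pow]; rfl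
        have h3 : a = (e : ℤ) - r := by omega
        rw [← Units.val_pow_eq_pow_val, ← Units.val_mul, ← zpow_natCast, ← zpow_add, h3,
          add_sub_cancel, zpow_natCast, Units.val_pow_eq_pow_val, coe_zUnit, zS, hw, ← map_mul, h2,
          baseS_algebraMap, ← map_mul, ← map_pow, ← map_pow, iterate_map_pow, mul_pow, mul_comm]
        rfl
      rw [Level.smul_tmul, h1, ← mul_one (E.toLoc (n + 1) _ * _), ← Level.smul_tmul, mul_smul,
        ← level_smul_tmul hB, ← Level.smul_def']
      refine Submodule.smul_mem _ _ ?_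
      obtain ⟨f, hf, h⟩ := exists_tmul_add_filP_of_mem hm hr hy
      have h4 := tmul_mem_latP hB (n + 1) h
      have h5 : (Level.tmul 1 (E.inS ^ e • y) : Level (bc hB M) (n + 1)) =
          lm hB (n + 1) f + Level.tmul 1 (show (bc hB M).carrier from
            (show E.S 0 ⊗[BKRing p k] M.carrier from E.inS ^ e • y) - 1 ⊗ₜ f) := by
        unfold lm
        refine Eq.trans ?_ (TensorProduct.tmul_add (1 : E.SLoc (n + 1)) _ _)
        exact congrArg (Level.tmul 1) (add_sub_cancel _ _).symm
      rw [h5]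
      exact add_mem (Submodule.mem_sup_left (Submodule.subset_span ⟨f, hf, rfl⟩))
        (Submodule.mem_sup_right h4)
    · have hy : y = 0 := hy
      have h0 : (Level.tmul ((E.zUnit (n + 1) ^ a : (E.SLoc (n + 1))ˣ) : E.SLoc (n + 1)) y :
          Level (bc hB M) (n + 1)) = 0 := by
        rw [hy]
        exact TensorProduct.tmul_zero _ _
      rw [h0, smul_zero]
      exact zero_mem _

/-- `z_n ^ r Fil^0` is contained in `𝔖_n ⊗ Fil^r M + Fil^p S_n ⊗ M`. -/
lemma exists_of_mem_fil (hm : E.HasOrder m) (hr : r < p - 1) {ξ : Level (bc hB M) (n + 1)}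
    (hξ : ξ ∈ Level.fil (bc hB M) (n + 1) 0) :
    ∃ f ∈ latL hB (n + 1) M.Fil,
      (E.zUnit (n + 1) : E.SLoc (n + 1)) ^ r • ξ - f ∈ latP hB M (n + 1) := by
  obtain ⟨x, hx, y, hy, hxy⟩ := Submodule.mem_sup.mp (zUnit_smul_mem_of_mem_fil hB n hm hr hξ)
  obtain ⟨f, hf, h⟩ := exists_latL_add_latP hB (n + 1) hx
  refine ⟨f, hf, ?_⟩
  rw [← hxy, add_sub_right_comm]
  exact add_mem h hy

lemma frobLoc_zUnit (n : ℕ) : E.frobLoc (n + 1) (E.zUnit (n + 1)) =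
    phiE E (n + 1) * E.inclLoc n (E.zUnit n) := by
  rw [coe_zUnit, coe_zUnit, zS, zS, frobLoc_toLoc, inclLoc_toLoc, frobS_algebraMap, frobBK_z,
    inclS_algebraMap, map_mul, map_mul]
  rfl

/-- The inclusions of the levels in one another are injective. -/
lemma incl_injective (hm : E.HasOrder m) : Function.Injective (Level.incl (bc hB M) n) := by
  have h : ∀ x, ∀ i, (levelBasis hB (n + 1)).repr (Level.incl (bc hB M) n x) i =
      E.inclLoc n ((levelBasis hB n).repr x i) := by
    intro x i
    conv_lhs => rw [← (levelBasis hB n).sum_repr x]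
    rw [map_sum, map_sum, Finsupp.finsetSum_apply, Finset.sum_eq_single i]
    · rw [Level.incl_smul, levelBasis_apply, incl_lm, ← levelBasis_apply, map_smul,
        Module.Basis.repr_self, Finsupp.smul_apply, Finsupp.single_eq_same, smul_eq_mul, mul_one]
    · intro j _ hj
      rw [Level.incl_smul, levelBasis_apply, incl_lm, ← levelBasis_apply, map_smul,
        Module.Basis.repr_self, Finsupp.smul_apply, Finsupp.single_eq_of_ne hj.symm, smul_zero]
    · intro h
      exact (h (Finset.mem_univ _)).elim
  intro x y hxy
  apply (levelBasis hB n).repr.injective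
  ext i
  apply inclLoc_injective hm n
  rw [← h, ← h, hxy]

/-- Applying `φ` at level `n + 1` and dividing by `φ(E) ^ r` improves the approximation of
`z_n ^ r ξ_n` by `𝔖_n ⊗ M` by the factor `p ^ (p - 1 - r)`. -/
lemma exists_approx_of_succ (hm : E.HasOrder m) (hr : r < p - 1) {ξ : Level (bc hB M) n}
    {ξ' : Level (bc hB M) (n + 1)}
    (h : Level.frob (bc hB M) (n + 1) ξ' = Level.incl (bc hB M) n ξ) {N : ℕ}
    {f q : Level (bc hB M) (n + 1)} (hf : f ∈ latL hB (n + 1) M.Fil)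
    (hq : q ∈ latP hB M (n + 1))
    (hξ' : (E.zUnit (n + 1) : E.SLoc (n + 1)) ^ r • ξ' = f + (p : E.S (n + 1)) ^ N • q) :
    ∃ f' ∈ latL hB n (⊤ : Submodule (BKRing p k) M.carrier), ∃ q' ∈ latP hB M n,
      (E.zUnit n : E.SLoc n) ^ r • ξ = f' + (p : E.S n) ^ (N + (p - 1 - r)) • q' := by
  obtain ⟨y, hy, hfy⟩ := exists_eq_frob hB n hm hf
  obtain ⟨y', hy', hqy⟩ := exists_eq_frob_of_mem_latP hB n hm hr hq
  have h1 := congrArg (Level.frob (bc hB M) (n + 1)) hξ'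
  rw [Level.smul_def', map_add, map_smulₛₗ, map_smulₛₗ, hfy, hqy, h, map_pow, frobLoc_zUnit, mul_pow,
    frobLoc_toLoc, mul_smul, smul_comm _ (phiE E (n + 1) ^ r), ← smul_add,
    ((isUnit_phiE n).pow r).smul_left_cancel] at h1
  have h2 : E.toLoc (n + 1) (E.frobS (n + 1) ((p : E.S (n + 1)) ^ N)) =
      E.inclLoc n (E.toLoc n ((p : E.S n) ^ N)) := by
    simp only [map_pow, map_natCast]
  rw [← map_pow, ← Level.incl_smul, h2, ← Level.incl_smul, ← map_add] at h1
  have h3 := incl_injective hB n hm h1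
  obtain ⟨g, hg, hgp⟩ := exists_latL_add_latP hB n hy'
  refine ⟨y + E.bkLoc n ((p : BKRing p k) ^ (N + (p - 1 - r))) • g,
    add_mem hy (bkLoc_smul_mem hB _ hg), y' - g, hgp, ?_⟩
  rw [h3, smul_smul, ← map_mul, ← pow_add, Level.smul_def', bkLoc_apply, map_pow (algebraMap _ _),
    map_natCast, add_assoc, ← smul_add, add_sub_cancel]

/-- All `z_n ^ r ξ_n` are congruent to elements of `𝔖_n ⊗ Fil^r M` modulo `p ^ (j (p - 1 - r))`, for
every `j`. In the inductive step, `exists_approx_of_succ` only gives an element of `𝔖_n ⊗ M`; it is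
in the lattice of `Fil^r M` by comparison with the approximation for `j = 0`. -/
lemma exists_approx (hm : E.HasOrder m) (hr : r < p - 1) {ξ : ∀ n, Level (bc hB M) n}
    (hξ : ξ ∈ limModule (bc hB M)) (j : ℕ) : ∀ n, ∃ f ∈ latL hB (n + 1) M.Fil,
      ∃ q ∈ latP hB M (n + 1), (E.zUnit (n + 1) : E.SLoc (n + 1)) ^ r • ξ (n + 1) =
        f + (p : E.S (n + 1)) ^ (j * (p - 1 - r)) • q := by
  induction j with
  | zero =>
    intro n
    obtain ⟨f, hf, h⟩ := exists_of_mem_fil hB n hm hr (hξ.1 (n + 1))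
    exact ⟨f, hf, _, h, by rw [zero_mul, pow_zero, one_smul, add_sub_cancel]⟩
  | succ j ih =>
    intro n
    obtain ⟨f, hf, q, hq, h⟩ := ih (n + 1)
    obtain ⟨y, hy, q', hq', h'⟩ := exists_approx_of_succ hB (n + 1) hm hr (hξ.2 (n + 1)) hf hq h
    obtain ⟨f₀, hf₀, h₀⟩ := exists_of_mem_fil hB n hm hr (hξ.1 (n + 1))
    refine ⟨y, ?_, q', hq', by rw [h', add_mul, one_mul]⟩
    have h1 : y - f₀ ∈ latL hB (n + 1) M.Fil := by
      refine mem_latL_of_mem_latP hB (n + 1) hm hr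
        (sub_mem hy (latL_mono hB (n + 1) le_top hf₀)) ?_
      have h2 := sub_mem h₀ (Submodule.smul_mem _
        ((p : E.S (n + 1)) ^ (j * (p - 1 - r) + (p - 1 - r))) hq')
      rw [h'] at h2
      convert h2 using 1
      abel
    have h2 := add_mem h1 hf₀
    rwa [sub_add_cancel] at h2

/-- The element `ξ_0` of a compatible sequence lies in `M`. -/
lemma exists_eq_lm (hm : E.HasOrder m) (hr : r < p - 1) {ξ : ∀ n, Level (bc hB M) n}
    (hξ : ξ ∈ limModule (bc hB M)) : ∃ x : M.carrier, ξ 0 = lm hB 0 x := by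
  have h1 : ∀ i, ∃ g, (levelBasis hB 0).repr (ξ 0) i = E.bkLoc 0 g := by
    intro i
    obtain ⟨s, hs⟩ := E.toLoc_zero_surjective ((levelBasis hB 0).repr (ξ 0) i)
    obtain ⟨g, rfl⟩ := mem_range_of_forall_pow hm 0 (s := s) fun N => by
      obtain ⟨f, hf, q, hq, h⟩ := exists_approx hB hm hr hξ N 0
      obtain ⟨y, hy, q', hq', h'⟩ := exists_approx_of_succ hB 0 hm hr (hξ.2 0) hf hq h
      obtain ⟨g, hg⟩ := repr_of_mem_latL hB 0 hy i
      obtain ⟨t, -, ht⟩ := repr_of_mem_latP hB 0 hq' i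
      -- There is no denominator at level `0`.
      have hz : (E.zUnit 0 : E.SLoc 0) = 1 := by
        rw [coe_zUnit, zS, z_zero, map_one, map_one]
      rw [hz, one_pow, one_smul] at h'
      refine ⟨g, (p : E.S 0) ^ (N * (p - 1 - r) + (p - 1 - r) - N) * t, toLoc_injective hm 0 ?_⟩
      have hN : N ≤ N * (p - 1 - r) + (p - 1 - r) :=
        (Nat.le_mul_of_pos_right N (by omega)).trans (Nat.le_add_right _ _)
      rw [hs, h', map_add, Finsupp.add_apply, hg, Level.smul_def', map_smul, Finsupp.smul_apply, ht,
        smul_eq_mul, ← mul_assoc, ← pow_add, Nat.add_sub_cancel' hN, map_add, map_mul, bkLoc_apply]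
    exact ⟨g, hs.symm⟩
  choose g hg using h1
  refine ⟨∑ i, g i • Module.Free.chooseBasis (BKRing p k) M.carrier i, ?_⟩
  apply (levelBasis hB 0).repr.injective
  ext i
  have h2 := levelBasis_repr_smul_lm hB 0 1
    (∑ i, g i • Module.Free.chooseBasis (BKRing p k) M.carrier i) i
  rw [one_smul, one_mul, Module.Basis.repr_sum_self] at h2
  rw [hg, h2]
  rfl

/-- Every element of `M` is the element `ξ_0` of a compatible sequence. -/
lemma exists_limModule (hm : E.HasOrder m) (x : M.carrier) :
    ∃ ξ ∈ limModule (bc hB M), ξ 0 = lm hB 0 x := by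
  choose! F hF hF' using fun (n : ℕ) (y : Level (bc hB M) n)
    (hy : y ∈ latL hB n (⊤ : Submodule (BKRing p k) M.carrier)) => exists_frob_eq hB n hm hy
  -- Lifting `x` through the Frobenius maps gives `y_n` with `φ(y_{n+1}) = φ(E) ^ r y_n`. Then
  -- `ξ_n = z_n^{-r} y_n` is compatible, because `φ(z_{n+1}) = φ(E) z_n`.
  let y : ∀ n, Level (bc hB M) n := fun n => Nat.rec (lm hB 0 x) F n
  have hy0 : y 0 = lm hB 0 x := rfl
  have hys : ∀ n, y (n + 1) = F n (y n) := fun n => rfl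
  have hy : ∀ n, y n ∈ latL hB n (⊤ : Submodule (BKRing p k) M.carrier) := by
    intro n
    induction n with
    | zero => exact Submodule.subset_span ⟨x, trivial, rfl⟩
    | succ n ih => rw [hys]; exact latL_mono hB (n + 1) le_top (hF n _ ih)
  refine ⟨fun n => (((E.zUnit n)⁻¹ ^ r : (E.SLoc n)ˣ) : E.SLoc n) • y n, ⟨fun n => ?_, fun n => ?_⟩, ?_⟩
  · cases n with
    | zero => exact Level.mem_fil_zero _
    | succ n =>
      have h1 : ∀ w ∈ latS hB (n + 1) M.Fil,
          (((E.zUnit (n + 1))⁻¹ ^ r : (E.SLoc (n + 1))ˣ) : E.SLoc (n + 1)) • w ∈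
            Level.fil (bc hB M) (n + 1) 0 := by
        intro w hw
        unfold latS at hw
        induction hw using Submodule.span_induction with
        | zero => rw [smul_zero]; exact zero_mem _
        | add x y _ _ hx hy => rw [smul_add]; exact add_mem hx hy
        | smul s x _ hx =>
          rw [Level.smul_def', smul_comm]
          exact Submodule.smul_mem _ s hx
        | mem w hw =>
          obtain ⟨f, hf, rfl⟩ := hw
          refine Submodule.subset_span ⟨-r, r, by omega,
            (1 ⊗ₜ f : E.S 0 ⊗[BKRing p k] M.carrier), ?_, ?_⟩
          · rw [BreuilMod.fil_r]
            exact one_tmul_mem_Fil hf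
          · unfold lm
            rw [Level.smul_tmul, mul_one, zpow_neg, zpow_natCast, inv_pow]
      change _ • y (n + 1) ∈ _
      rw [hys]
      exact h1 _ (latL_le_latS hB (n + 1) (hF n _ (hy n)))
  · change Level.frob (bc hB M) (n + 1) (_ • y (n + 1)) = Level.incl (bc hB M) n (_ • y n)
    rw [map_smulₛₗ, hys, hF' n _ (hy n), Level.incl_smul, smul_smul]
    congr 1
    have h1 : ∀ (n : ℕ), (E.zUnit n : E.SLoc n) *
        (((E.zUnit n)⁻¹ : (E.SLoc n)ˣ) : E.SLoc n) = 1 := fun n => Units.mul_inv _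
    have h2 := congrArg (E.frobLoc (n + 1)) (h1 (n + 1))
    have h3 := congrArg (E.inclLoc n) (h1 n)
    rw [map_mul, frobLoc_zUnit, map_one] at h2
    rw [map_mul, map_one] at h3
    rw [Units.val_pow_eq_pow_val, Units.val_pow_eq_pow_val, map_pow, map_pow, ← mul_pow]
    congr 1
    linear_combination (E.inclLoc n (((E.zUnit n)⁻¹ : (E.SLoc n)ˣ) : E.SLoc n)) * h2 -
      (E.frobLoc (n + 1) (((E.zUnit (n + 1))⁻¹ : (E.SLoc (n + 1))ˣ) : E.SLoc (n + 1)) *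
        phiE E (n + 1)) * h3
  · have hz : E.zUnit 0 = 1 := by
      apply Units.ext
      rw [coe_zUnit, zS, z_zero, map_one, map_one, Units.val_one]
    change (((E.zUnit 0)⁻¹ ^ r : (E.SLoc 0)ˣ) : E.SLoc 0) • y 0 = _
    rw [hz, inv_one, one_pow, Units.val_one, one_smul, hy0]

/-- The Frobenius is injective at the levels `n ≥ 1`, where `φ(E)` is invertible. -/
lemma frob_injective (hm : E.HasOrder m) :
    Function.Injective (Level.frob (bc hB M) (n + 1)) := by
  -- The linearization `T` of `φ` is surjective, since the unit `φ(E) ^ r` times the values of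
  -- `φ_{M,r}` are values of `φ`; hence it is injective, and `φ` is `T` composed with the injective
  -- map `φ` on the coordinates.
  let b := Module.Free.chooseBasis (BKRing p k) M.carrier
  let T : Level (bc hB M) (n + 1) →ₗ[E.SLoc (n + 1)] Level (bc hB M) (n + 1) :=
    (levelBasis hB (n + 1)).constr (E.SLoc (n + 1)) fun i => lm hB (n + 1) (BKMod.phi M (b i))
  have hT : ∀ i, T (levelBasis hB (n + 1) i) = lm hB (n + 1) (BKMod.phi M (b i)) := fun i =>
    Module.Basis.constr_basis _ _ _ i
  have h1 : ∀ x : M.carrier, lm hB (n + 1) (BKMod.phi M x) ∈ LinearMap.range T := by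
    intro x
    rw [← b.sum_repr x]
    have h2 : ∀ s : Finset (Module.Free.ChooseBasisIndex (BKRing p k) M.carrier),
        lm hB (n + 1) (BKMod.phi M (∑ i ∈ s, b.repr x i • b i)) ∈ LinearMap.range T := by
      intro s
      classical
      induction s using Finset.induction_on with
      | empty =>
        rw [Finset.sum_empty, map_zero]
        have := lm_smul hB (n + 1) 0 (0 : M.carrier)
        rw [zero_smul, iterate_map_zero, map_zero, zero_smul] at this
        rw [this]
        exact zero_mem _
      | insert i s hi ih =>
        rw [Finset.sum_insert hi, map_add, lm_add]
        refine add_mem ?_ ih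
        rw [map_smulₛₗ, lm_smul, ← hT]
        exact Submodule.smul_mem _ _ (LinearMap.mem_range_self _ _)
    exact h2 _
  have h2 : LinearMap.range T = ⊤ := by
    have h3 : ∀ x : M.carrier, lm hB (n + 1) x ∈ LinearMap.range T := by
      intro x
      have hx : x ∈ Submodule.span (BKRing p k) (Set.range M.phiR) := by
        rw [M.span_range_phiR]; trivial
      induction hx using Submodule.span_induction with
      | mem x hx =>
        obtain ⟨f, rfl⟩ := hx
        have h4 := frob_lm_of_mem hB (n + 1) hm f
        have h5 := frob_smul_lm hB (n + 1) hm 1 (f : M.carrier)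
        rw [one_smul, map_one, one_smul] at h5
        obtain ⟨w, hw⟩ := (isUnit_phiE (E := E) n).pow r
        rw [h5, ← hw] at h4
        have h6 := Submodule.smul_mem _ ((w⁻¹ : (E.SLoc (n + 1))ˣ) : E.SLoc (n + 1)) (h1 f)
        rwa [h4, smul_smul, Units.inv_mul, one_smul] at h6
      | zero =>
        have := lm_smul hB (n + 1) 0 (0 : M.carrier)
        rw [zero_smul, iterate_map_zero, map_zero, zero_smul] at this
        rw [this]
        exact zero_mem _
      | add x y _ _ hx hy => rw [lm_add]; exact add_mem hx hy
      | smul g x _ hx => rw [lm_smul]; exact Submodule.smul_mem _ _ hx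
    rw [eq_top_iff, ← (levelBasis hB (n + 1)).span_eq, Submodule.span_le]
    rintro _ ⟨i, rfl⟩
    rw [levelBasis_apply]
    exact h3 _
  have : Module.Finite (E.SLoc (n + 1)) (Level (bc hB M) (n + 1)) :=
    Module.Finite.of_basis (levelBasis hB (n + 1))
  have hinj := OrzechProperty.injective_of_surjective_endomorphism T (LinearMap.range_eq_top.mp h2)
  rw [injective_iff_map_eq_zero]
  intro x hx
  have h3 : T (∑ i, E.frobLoc (n + 1) ((levelBasis hB (n + 1)).repr x i) •
      levelBasis hB (n + 1) i) = 0 := by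
    rw [map_sum, ← hx]
    conv_rhs => rw [← (levelBasis hB (n + 1)).sum_repr x]
    rw [map_sum]
    refine Finset.sum_congr rfl fun i _ => ?_
    rw [map_smul, hT, levelBasis_apply, frob_smul_lm hB (n + 1) hm]
  have h4 := hinj (h3.trans (map_zero T).symm)
  apply (levelBasis hB (n + 1)).repr.injective
  ext i
  have h5 := congrArg (fun z => (levelBasis hB (n + 1)).repr z i) h4
  simp only [Module.Basis.repr_sum_self, map_zero, Finsupp.zero_apply] at h5
  rw [map_zero, Finsupp.zero_apply]
  exact frobLoc_injective hm (n + 1) (h5.trans (map_zero _).symm)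

/-- A compatible sequence is determined by `ξ_0`, as `φ` is injective at the levels `n ≥ 1`. -/
lemma limModule_ext (hm : E.HasOrder m) {ξ η : limModule (bc hB M)} (h : ξ.1 0 = η.1 0) :
    ξ = η := by
  apply Subtype.ext
  funext n
  induction n with
  | zero => exact h
  | succ n ih =>
    apply frob_injective hB n hm
    rw [ξ.2.2 n, η.2.2 n, ih]

end Contraction

/-! ### Isomorphisms of filtered modules -/

section Isos

variable {R : Type u} [CommRing R] {φ : R →+* R} {I : Ideal R} {p : ℕ}

/-- A linear equivalence compatible with the filtrations and with `φ_r` is an isomorphism. -/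
def FilteredPhiModule.isoOfEquiv {M N : FilteredPhiModule R φ I p} (e : M.carrier ≃ₗ[R] N.carrier)
    (hfil : ∀ x, x ∈ M.Fil ↔ e x ∈ N.Fil)
    (hphi : ∀ x : M.Fil, e (M.phiR x) = N.phiR ⟨e x, (hfil x).mp x.2⟩) : M ≅ N where
  hom := ⟨e, fun x hx => (hfil x).mp hx, hphi⟩
  inv := ⟨e.symm, fun x hx => (hfil _).mpr ((e.apply_symm_apply x).symm ▸ hx), fun x => by
    have hx : e.symm x.1 ∈ M.Fil := (hfil _).mpr (by rw [e.apply_symm_apply]; exact x.2)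
    have h := hphi ⟨e.symm x.1, hx⟩
    apply e.injective
    refine (e.apply_symm_apply _).trans (Eq.trans ?_ h.symm)
    congr 1
    exact Subtype.ext (e.apply_symm_apply _).symm⟩
  hom_inv_id := FilteredPhiModule.hom_ext (LinearMap.ext fun x => e.symm_apply_apply x)
  inv_hom_id := FilteredPhiModule.hom_ext (LinearMap.ext fun x => e.apply_symm_apply x)

/-- The linear equivalence underlying an isomorphism. -/
def PhiModule.equivOfIso {M N : PhiModule R φ} (f : M ≅ N) : M.carrier ≃ₗ[R] N.carrier :=
  LinearEquiv.ofLinearMap f.hom.lin f.inv.lin (congrArg PhiModule.Hom.lin f.inv_hom_id)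
    (congrArg PhiModule.Hom.lin f.hom_inv_id)

lemma PhiModule.mem_Fil_iff_of_iso {M N : PhiModule R φ} (f : M ≅ N) (x : M.carrier) :
    PhiModule.equivOfIso f x ∈ N.Fil ↔ x ∈ M.Fil := by
  refine ⟨fun h => ?_, f.hom.map_fil x⟩
  have h1 := f.inv.map_fil _ h
  have h2 : f.inv.lin (PhiModule.equivOfIso f x) = x := (PhiModule.equivOfIso f).symm_apply_apply x
  rwa [h2] at h1

/-- The property of being an object after division of the Frobenius only depends on the isomorphism
class. -/
lemma PhiModule.IsDivided.of_iso {M N : PhiModule R φ} {c : R} (f : M ≅ N)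
    (h : M.IsDivided I p c) : N.IsDivided I p c := by
  let e := PhiModule.equivOfIso f
  have hfil : ∀ x, e x ∈ N.Fil ↔ x ∈ M.Fil := PhiModule.mem_Fil_iff_of_iso f
  have hfil' : ∀ y, y ∈ N.Fil ↔ e.symm y ∈ M.Fil := fun y => by
    rw [← hfil, e.apply_symm_apply]
  have hfrob : ∀ x, e (M.frob x) = N.frob (e x) := f.hom.map_frob
  have hdiv : ∀ (x y : M.carrier), c • e y = N.frob (e x) ↔ c • y = M.frob x := fun x y => by
    rw [← hfrob, ← map_smul, e.injective.eq_iff]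
  have := h.finite
  have := h.free
  exact
    { finite := Module.Finite.equiv e
      free := Module.Free.of_equiv e
      smul_top_le := Submodule.smul_le.mpr fun s hs x _ => by
        rw [hfil', map_smul]
        exact h.smul_top_le (Submodule.smul_mem_smul hs trivial)
      torsionFree := fun x hx => by
        obtain ⟨x, rfl⟩ := Submodule.Quotient.mk_surjective _ x
        rw [← Submodule.Quotient.mk_smul, Submodule.Quotient.mk_eq_zero, hfil', map_smul,
          ← Submodule.Quotient.mk_eq_zero, Submodule.Quotient.mk_smul] at hx
        rw [Submodule.Quotient.mk_eq_zero, hfil', ← Submodule.Quotient.mk_eq_zero]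
        exact h.torsionFree _ hx
      existsUnique_div := fun x hx => by
        obtain ⟨y, hy, hy'⟩ := h.existsUnique_div _ ((hfil' x).mp hx)
        refine ⟨e y, ?_, fun z hz => ?_⟩
        · change c • e y = N.frob x
          rw [← e.apply_symm_apply x, hdiv]
          exact hy
        · rw [← e.apply_symm_apply z, hy' (e.symm z) ((hdiv _ _).mp ?_)]
          rw [e.apply_symm_apply, e.apply_symm_apply]
          exact hz
      span_eq_top := by
        have h1 := congrArg (Submodule.map (e : M.carrier →ₗ[R] N.carrier)) h.span_eq_top
        rw [Submodule.map_span, Submodule.map_top, LinearEquiv.range] at h1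
        rw [eq_top_iff, ← h1]
        refine Submodule.span_mono ?_
        rintro _ ⟨y, ⟨x, hx, hy⟩, rfl⟩
        exact ⟨e x, (hfil x).mpr hx, (hdiv x y).mpr hy⟩ }

end Isos

/-! ### The isomorphism of `M` with the module of sequences of `S ⊗ M` -/

section LimIso

variable {p : ℕ} [Fact p.Prime] {k : Type u} [Field k] [CharP k p] [PerfectRing k p]
variable {E : NormalizedPoly p k} {r m : ℕ}

open NormalizedPoly

/-- At level `0` the module `𝓜` embeds in `𝓜 ⊗ S_0[z_0⁻¹]`. -/
lemma tmul_one_injective (hm : E.HasOrder m) (M : BreuilMod E r) :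
    Function.Injective (fun x : M.carrier => (Level.tmul 1 x : Level M 0)) := by
  intro x y hxy
  let b := Module.Free.chooseBasis (E.S 0) M.carrier
  apply b.repr.injective
  ext i
  have h := congrArg (fun z => (b.baseChange (E.SLoc 0)).repr z i) hxy
  have h1 : ∀ x : M.carrier, (b.baseChange (E.SLoc 0)).repr (1 ⊗ₜ x) i = E.toLoc 0 (b.repr x i) := by
    intro x
    rw [Module.Basis.baseChange_repr_tmul, Algebra.smul_def, mul_one]
    rfl
  exact toLoc_injective hm 0 ((h1 x).symm.trans (h.trans (h1 y)))

lemma constantCoeff_frobBK_ser : PowerSeries.constantCoeff (frobBK p k E.ser) =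
    (p : WittVector p k) := by
  rw [← PowerSeries.coeff_zero_eq_constantCoeff_apply]
  have h := E.constantCoeff_elt 0
  rw [← PowerSeries.coeff_zero_eq_constantCoeff_apply, elt_zero] at h
  simp [frobBK, coeff_expandHom, h]

lemma frobBK_ser_pow_ne_zero : frobBK p k E.ser ^ r ≠ 0 := by
  refine pow_ne_zero _ fun h => WittVector.p_nonzero p k ?_
  rw [← constantCoeff_frobBK_ser (E := E), h, map_zero]

/-- A filtered Breuil–Kisin module with its undivided Frobenius. -/
noncomputable abbrev BKMod.toPhiModule (M : BKMod E r) : PhiModule (BKRing p k) (frobBK p k) where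
  carrier := M.carrier
  Fil := M.Fil
  frob := BKMod.phi M

/-- Dividing the Frobenius of a filtered Breuil–Kisin module by `φ(E) ^ r` gives back `φ_{M,r}`. -/
lemma BKMod.isDivided (M : BKMod E r) : M.toPhiModule.IsDivided (Ideal.span {E.ser ^ r}) p
    (frobBK p k E.ser ^ r) where
  finite := M.finite
  free := M.free
  smul_top_le := M.smul_top_le
  torsionFree := M.torsionFree
  existsUnique_div x hx := ⟨M.phiR ⟨x, hx⟩, (BKMod.phi_of_mem M ⟨x, hx⟩).symm, fun y hy =>
    smul_left_cancel_of_free (M := M.carrier) frobBK_ser_pow_ne_zero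
      (Eq.trans hy (BKMod.phi_of_mem M ⟨x, hx⟩))⟩
  span_eq_top := by
    rw [eq_top_iff, ← M.span_range_phiR]
    refine Submodule.span_mono ?_
    rintro _ ⟨x, rfl⟩
    exact ⟨x, x.2, (BKMod.phi_of_mem M x).symm⟩

variable (hB : BaseChangeIsBreuil E r)

lemma bk_smul_lm {M : BKMod E r} (g : BKRing p k) (x : M.carrier) :
    lm hB 0 (g • x) = g • lm hB 0 x := by
  rw [lm_smul, Level.bk_smul_def, E.twistS_zero]
  rfl

lemma frob_lm (hm : E.HasOrder m) {M : BKMod E r} (x : M.carrier) :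
    Level.frob (bc hB M) 0 (lm hB 0 x) = lm hB 0 (BKMod.phi M x) := by
  have h := frob_smul_lm hB 0 hm 1 x
  rwa [one_smul, map_one, one_smul] at h

lemma lm_injective (hm : E.HasOrder m) (M : BKMod E r) : Function.Injective (lm (M := M) hB 0) := by
  intro x y h
  have h1 := tmul_one_injective hm (bc hB M) h
  let b := Module.Free.chooseBasis (BKRing p k) M.carrier
  apply b.repr.injective
  refine Finsupp.ext fun i => ?_
  have h2 := congrArg (fun z => (b.baseChange (E.S 0)).repr z i) h1
  have h3 : ∀ x : M.carrier, (b.baseChange (E.S 0)).repr (1 ⊗ₜ x) i =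
      algebraMap _ _ (b.repr x i) := by
    intro x
    rw [Module.Basis.baseChange_repr_tmul, Algebra.smul_def, mul_one]
  exact algebraMap_S_injective hm 0 ((h3 x).symm.trans (h2.trans (h3 y)))

/-- The isomorphism of `M` with the module of sequences of `S ⊗ M`, inverse to `ξ ↦ ξ_0`. -/
noncomputable def limEquiv (hm : E.HasOrder m) (hr : r < p - 1) (M : BKMod E r) :
    M.carrier ≃ₗ[BKRing p k] limModule (bc hB M) :=
  LinearEquiv.ofBijective
    { toFun := fun x => ⟨(exists_limModule hB hm x).choose,
        (exists_limModule hB hm x).choose_spec.1⟩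
      map_add' := fun x y => limModule_ext hB hm (by
        refine (exists_limModule hB hm (x + y)).choose_spec.2.trans ?_
        rw [lm_add]
        exact congrArg₂ (· + ·) (exists_limModule hB hm x).choose_spec.2.symm
          (exists_limModule hB hm y).choose_spec.2.symm)
      map_smul' := fun g x => limModule_ext hB hm (by
        refine (exists_limModule hB hm (g • x)).choose_spec.2.trans ?_
        rw [bk_smul_lm]
        exact congrArg (g • ·) (exists_limModule hB hm x).choose_spec.2.symm) }
    (by
      refine ⟨fun x y h => lm_injective hB hm M ?_, fun ξ => ?_⟩
      · rw [← (exists_limModule hB hm x).choose_spec.2, ← (exists_limModule hB hm y).choose_spec.2]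
        exact congrFun (congrArg Subtype.val h) 0
      · obtain ⟨x, hx⟩ := exists_eq_lm hB hm hr ξ.2
        exact ⟨x, limModule_ext hB hm ((exists_limModule hB hm x).choose_spec.2.trans hx.symm)⟩)

lemma limEquiv_zero (hm : E.HasOrder m) (hr : r < p - 1) {M : BKMod E r} (x : M.carrier) :
    (limEquiv hB hm hr M x).1 0 = lm hB 0 x :=
  (exists_limModule hB hm x).choose_spec.2

lemma limEquiv_mem_limFil (hm : E.HasOrder m) (hr : r < p - 1) {M : BKMod E r} (x : M.carrier) :
    limEquiv hB hm hr M x ∈ limFil (bc hB M) r ↔ x ∈ M.Fil := by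
  rw [← one_tmul_mem_Fil_iff hm hr]
  constructor
  · rintro ⟨y, hy, h⟩
    rw [limEquiv_zero] at h
    rw [BreuilMod.fil_r] at hy
    have h1 : (1 ⊗ₜ x : E.S 0 ⊗[BKRing p k] M.carrier) = y := tmul_one_injective hm (bc hB M) h
    rw [h1]
    exact hy
  · intro h
    refine ⟨(1 ⊗ₜ x : E.S 0 ⊗[BKRing p k] M.carrier), ?_, limEquiv_zero hB hm hr x⟩
    rw [BreuilMod.fil_r]
    exact h

lemma limEquiv_frob (hm : E.HasOrder m) (hr : r < p - 1) {M : BKMod E r} (x : M.carrier) :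
    limEquiv hB hm hr M (BKMod.phi M x) = limFrob (bc hB M) (limEquiv hB hm hr M x) := by
  apply limModule_ext hB hm
  rw [limEquiv_zero]
  change _ = Level.frob (bc hB M) 0 ((limEquiv hB hm hr M x).1 0)
  rw [limEquiv_zero, frob_lm hB hm]

/-- The isomorphism of `M` with the module of sequences of `S ⊗ M`, with the Frobenius maps. -/
noncomputable def limPhiIso (hm : E.HasOrder m) (hr : r < p - 1) (M : BKMod E r) :
    M.toPhiModule ≅ (preLim E r).obj (bc hB M) where
  hom := ⟨(limEquiv hB hm hr M).toLinearMap, fun x hx => (limEquiv_mem_limFil hB hm hr x).mpr hx,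
    limEquiv_frob hB hm hr⟩
  inv := ⟨(limEquiv hB hm hr M).symm.toLinearMap, fun ξ hξ =>
      (limEquiv_mem_limFil hB hm hr _).mp (by
        have := (limEquiv hB hm hr M).apply_symm_apply ξ
        exact this.symm ▸ hξ), fun ξ => by
      apply (limEquiv hB hm hr M).injective
      refine ((limEquiv hB hm hr M).apply_symm_apply _).trans
        (Eq.trans ?_ (limEquiv_frob hB hm hr _).symm)
      exact congrArg (limFrob (bc hB M)) ((limEquiv hB hm hr M).apply_symm_apply ξ).symm⟩
  hom_inv_id := PhiModule.hom_ext (LinearMap.ext fun x => (limEquiv hB hm hr M).symm_apply_apply x)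
  inv_hom_id := PhiModule.hom_ext (LinearMap.ext fun x => (limEquiv hB hm hr M).apply_symm_apply x)

/-- If every quasi-Breuil module comes from `𝔖`, then `M̲` takes values in the filtered
Breuil–Kisin modules. -/
theorem limIsBK (hm : E.HasOrder m) (hr : r < p - 1)
    (hS : ∀ N : BreuilMod E r, ∃ M : BKMod E r, Nonempty (bc hB M ≅ N)) : LimIsBK E r := by
  intro N
  obtain ⟨M, ⟨f⟩⟩ := hS N
  exact M.isDivided.of_iso (limPhiIso hB hm hr M ≪≫ (preLim E r).mapIso f)

variable (hL : LimIsBK E r)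

/-- The isomorphism of filtered Breuil–Kisin modules `M ≃ M̲(S ⊗ M)`. -/
noncomputable def limIso (hm : E.HasOrder m) (hr : r < p - 1) (M : BKMod E r) :
    M ≅ (limFunctor hL).obj (bc hB M) :=
  FilteredPhiModule.isoOfEquiv (N := (limFunctor hL).obj (bc hB M)) (limEquiv hB hm hr M)
    (fun x => (limEquiv_mem_limFil hB hm hr x).symm) (fun x => by
      refine (hL (bc hB M)).cancel ?_
      refine Eq.trans ?_ ((hL (bc hB M)).smul_divided_phiR
        ⟨limEquiv hB hm hr M x, (limEquiv_mem_limFil hB hm hr _).mpr x.2⟩).symm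
      refine ((limEquiv hB hm hr M).map_smul _ _).symm.trans ?_
      rw [← BKMod.phi_of_mem]
      exact limEquiv_frob hB hm hr _)

/-- The isomorphism of functors `M̲ ∘ 𝓜̲ ≃ id`. -/
noncomputable def compLimIso (hm : E.HasOrder m) (hr : r < p - 1) :
    baseChangeFunctor hB ⋙ limFunctor hL ≅ 𝟭 (BKMod E r) :=
  (NatIso.ofComponents (fun M => limIso hB hL hm hr M) fun {M N} f => by
    apply FilteredPhiModule.hom_ext
    ext1 x
    change limEquiv hB hm hr N (f.lin x) =
      ((preLim E r).map ((baseChangeFunctor hB).map f)).lin (limEquiv hB hm hr M x)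
    apply limModule_ext hB hm
    rw [limEquiv_zero]
    change _ = Level.map 0 ((baseChangeFunctor hB).map f) ((limEquiv hB hm hr M x).1 0)
    rw [limEquiv_zero]
    rfl).symm

/-- The functor `M̲` is faithful: for `𝓜 = S ⊗ M` a morphism out of `𝓜` is determined by its
restriction to `M`, which is its effect on the elements `ξ_0`. -/
lemma limFunctor_faithful (hm : E.HasOrder m) (hr : r < p - 1)
    (hS : ∀ N : BreuilMod E r, ∃ M : BKMod E r, Nonempty (bc hB M ≅ N)) :
    (limFunctor hL).Faithful where
  map_injective {N N'} f g h := by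
    obtain ⟨M, ⟨i⟩⟩ := hS N
    rw [← cancel_epi i.hom]
    have h1 : (limFunctor hL).map (i.hom ≫ f) = (limFunctor hL).map (i.hom ≫ g) := by
      rw [Functor.map_comp, Functor.map_comp, h]
    have h2 : ∀ x : M.carrier, (i.hom ≫ f).lin (1 ⊗ₜ x : E.S 0 ⊗[BKRing p k] M.carrier) =
        (i.hom ≫ g).lin (1 ⊗ₜ x : E.S 0 ⊗[BKRing p k] M.carrier) := by
      intro x
      have h3 := congrArg (fun w => (FilteredPhiModule.Hom.lin w) (limEquiv hB hm hr M x)) h1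
      have h4 : Level.map 0 (i.hom ≫ f) ((limEquiv hB hm hr M x).1 0) =
        Level.map 0 (i.hom ≫ g) ((limEquiv hB hm hr M x).1 0) :=
        congrFun (congrArg Subtype.val h3) 0
      rw [limEquiv_zero] at h4
      exact tmul_one_injective hm N' h4
    apply FilteredPhiModule.hom_ext
    ext1 y
    change E.S 0 ⊗[BKRing p k] M.carrier at y
    induction y with
    | zero => exact (map_zero _).trans (map_zero _).symm
    | add y z hy hz =>
      exact (map_add _ _ _).trans ((congrArg₂ (· + ·) hy hz).trans (map_add _ _ _).symm)
    | tmul s x =>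
      rw [tmul_eq_smul]
      exact (map_smul _ _ _).trans ((congrArg (s • ·) (h2 x)).trans (map_smul _ _ _).symm)

end LimIso

/-! ### Functors with a faithful left inverse -/

section Equivalence

/-- An essentially surjective functor with a faithful left inverse is an equivalence. -/
lemma nonempty_comp_iso_id {C D : Type*} [Category C] [Category D] {F : C ⥤ D} {G : D ⥤ C}
    (α : F ⋙ G ≅ 𝟭 C) [G.Faithful] [F.EssSurj] : Nonempty (G ⋙ F ≅ 𝟭 D) := by
  -- `F` is faithful as `F ⋙ G` is, and full as `F ⋙ G` is full and `G` is faithful.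
  have hfaith : F.Faithful := Functor.Faithful.of_comp_iso α
  have : (F ⋙ G).Full := Functor.Full.of_iso α.symm
  have hfull : F.Full := Functor.Full.of_comp_faithful F G
  have : F.IsEquivalence := { }
  let e := F.asEquivalence
  exact ⟨(Functor.leftUnitor (G ⋙ F)).symm ≪≫
    Functor.isoWhiskerRight e.counitIso.symm (G ⋙ F) ≪≫
    Functor.isoWhiskerLeft e.inverse (Functor.isoWhiskerRight α F) ≪≫ e.counitIso⟩

end Equivalence

/-! ### Successive approximation in quasi-Breuil modules -/

section FreeAdic

variable {R N : Type*} [CommRing R] [AddCommGroup N] [Module R N] [Module.Free R N]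

lemma exists_limit_of_free [Module.Finite R N] (a : R) [IsPrecomplete (Ideal.span {a}) R] (f : ℕ → N)
    (hf : ∀ n, ∃ y, f (n + 1) - f n = a ^ n • y) : ∃ L, ∀ n, ∃ y, L - f n = a ^ n • y := by
  let b := Module.Free.chooseBasis R N
  have h1 : ∀ i, ∃ L, ∀ n, a ^ n ∣ L - b.repr (f n) i := fun i =>
    exists_limit a (fun n => b.repr (f n) i) fun n => by
      obtain ⟨y, hy⟩ := hf n
      refine ⟨b.repr y i, ?_⟩
      rw [← Finsupp.sub_apply, ← map_sub, hy, map_smul, Finsupp.smul_apply, smul_eq_mul]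
  choose L hL using h1
  refine ⟨∑ i, L i • b i, fun n => ?_⟩
  choose c hc using fun i => hL i n
  refine ⟨∑ i, c i • b i, ?_⟩
  conv_lhs => rw [← b.sum_repr (f n)]
  rw [← Finset.sum_sub_distrib, Finset.smul_sum]
  refine Finset.sum_congr rfl fun i _ => ?_
  rw [← sub_smul, hc, mul_smul]

lemma eq_zero_of_forall_eq_pow_smul (a : R) [IsHausdorff (Ideal.span {a}) R] {x : N}
    (hx : ∀ n, ∃ y, x = a ^ n • y) : x = 0 := by
  let b := Module.Free.chooseBasis R N
  apply b.repr.injective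
  ext i
  rw [map_zero, Finsupp.zero_apply]
  refine eq_zero_of_forall_pow_dvd a fun n => ?_
  obtain ⟨y, hy⟩ := hx n
  exact ⟨b.repr y i, by rw [hy, map_smul, Finsupp.smul_apply, smul_eq_mul]⟩

lemma mem_smul_top_iff_repr {ι : Type*} [Finite ι] (b : Module.Basis ι R N) (I : Ideal R) (x : N) :
    x ∈ I • (⊤ : Submodule R N) ↔ ∀ i, b.repr x i ∈ I := by
  cases nonempty_fintype ι
  constructor
  · intro hx i
    induction hx using Submodule.smul_induction_on' with
    | smul s hs y hy => rw [map_smul]; exact Ideal.mul_mem_right _ _ hs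
    | add x _ y _ hx hy => rw [map_add]; exact add_mem hx hy
  · intro h
    rw [← b.sum_repr x]
    exact sum_mem fun i _ => Submodule.smul_mem_smul (h i) trivial

end FreeAdic

section Approx

variable {p : ℕ} [Fact p.Prime] {k : Type u} [Field k] [CharP k p] [PerfectRing k p]
variable {E : NormalizedPoly p k} {r m : ℕ}

open NormalizedPoly

namespace BreuilMod

variable (N : BreuilMod E r)

/-- The submodule `Fil^p S ⬝ 𝓜`. -/
noncomputable def filTop : Submodule (E.S 0) N.carrier := E.FilS 0 p • ⊤

/-- The normalized divided Frobenius `c₀^{-r} φ_{𝓜,r}`. -/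
noncomputable def phiC : N.Fil →ₛₗ[E.frobS 0] N.carrier :=
  (((E.c 0)⁻¹ ^ r : (E.S 0)ˣ) : E.S 0) • N.phiR

variable {N}

lemma filTop_le (hr : r < p - 1) : filTop N ≤ N.Fil :=
  (Submodule.smul_mono_left (FilS_mono (by omega))).trans N.smul_top_le

/-- The submodule `Fil^p S ⬝ 𝓜` is closed for the `p`-adic topology. -/
lemma mem_filTop_of_approx {x : N.carrier}
    (hx : ∀ K : ℕ, ∃ w ∈ filTop N, ∃ y, x = w + (p : E.S 0) ^ K • y) : x ∈ filTop N := by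
  rw [filTop, mem_smul_top_iff_repr (Module.Free.chooseBasis (E.S 0) N.carrier)]
  intro i
  rw [FilS, Ideal.mem_iInf]
  intro K
  obtain ⟨w, hw, y, rfl⟩ := hx K
  rw [filTop, mem_smul_top_iff_repr (Module.Free.chooseBasis (E.S 0) N.carrier)] at hw
  have h1 := hw i
  rw [FilS, Ideal.mem_iInf] at h1
  rw [map_add, Finsupp.add_apply, map_smul, Finsupp.smul_apply, smul_eq_mul]
  exact add_mem (h1 K) (Ideal.mem_sup_right (Ideal.mul_mem_right _ _
    (Ideal.mem_span_singleton_self _)))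

/-- On `Fil^p S ⬝ 𝓜` the divided Frobenius is divisible by `p`, as `r < p - 1`. -/
lemma exists_phiC_eq (hm : E.HasOrder m) (hr : r < p - 1) {z : N.Fil} (hz : z.1 ∈ filTop N) :
    ∃ y, phiC N z = (p : E.S 0) • y := by
  have := isDomain_S hm 0
  have h1 : ∀ z ∈ filTop N, ∃ y, BreuilMod.phi N z = (p : E.S 0) ^ (r + 1) • y := by
    intro z hz
    unfold filTop at hz
    induction hz using Submodule.smul_induction_on' with
    | smul s hs y hy =>
      obtain ⟨t, ht⟩ := pow_dvd_frobS hm 0 (show r + 1 ≤ p - 1 by omega)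
        (FilS_mono (by omega) hs)
      exact ⟨t • BreuilMod.phi N y, by rw [map_smulₛₗ, ht, mul_smul]⟩
    | add x _ y _ hx hy =>
      obtain ⟨a, ha⟩ := hx
      obtain ⟨b, hb⟩ := hy
      exact ⟨a + b, by rw [map_add, ha, hb, smul_add]⟩
  obtain ⟨y, hy⟩ := h1 z hz
  rw [BreuilMod.phi_of_mem, pow_succ, mul_smul] at hy
  have h2 := smul_left_cancel_of_free (pow_ne_zero _ (natCast_p_ne_zero hm 0)) hy
  exact ⟨(((E.c 0)⁻¹ ^ r : (E.S 0)ˣ) : E.S 0) • y, by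
    rw [phiC, LinearMap.smul_apply, h2, smul_comm]⟩

lemma phiR_eq_smul_phiC (x : N.Fil) : N.phiR x = (E.c 0 : E.S 0) ^ r • phiC N x := by
  rw [phiC, LinearMap.smul_apply, smul_smul, ← Units.val_pow_eq_pow_val, ← Units.val_mul,
    ← mul_pow, mul_inv_cancel, one_pow, Units.val_one, one_smul]

variable {ι : Type*} [Fintype ι]

/-- If `α` generates `Fil^r 𝓜` modulo `Fil^p S ⬝ 𝓜`, then its divided Frobenius generates `𝓜`, by
Nakayama's lemma for `p`: the divided Frobenius of `Fil^p S ⬝ 𝓜` vanishes modulo `p`. -/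
lemma span_phiC_eq_top (hm : E.HasOrder m) (hr : r < p - 1) {α : ι → N.Fil}
    (h : N.Fil ≤ Submodule.span (E.S 0) (Set.range fun j => (α j : N.carrier)) ⊔ filTop N) :
    Submodule.span (E.S 0) (Set.range fun j => phiC N (α j)) = ⊤ := by
  rw [eq_top_iff]
  refine Submodule.le_of_le_smul_of_le_jacobson_bot Module.Finite.fg_top (E.p_mem_jacobson 0) ?_
  conv_lhs => rw [← N.span_range_phiR]
  rw [Submodule.span_le]
  rintro _ ⟨x, rfl⟩
  obtain ⟨y, hy, z, hz, hyz⟩ := Submodule.mem_sup.mp (h x.2)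
  obtain ⟨c, rfl⟩ := (Submodule.mem_span_range_iff_exists_fun _).mp hy
  have hx : x = ∑ j, c j • α j + ⟨z, filTop_le hr hz⟩ := by
    apply Subtype.ext
    rw [← hyz]
    push_cast
    rfl
  obtain ⟨w, hw⟩ := exists_phiC_eq hm hr (z := ⟨z, filTop_le hr hz⟩) hz
  rw [phiR_eq_smul_phiC]
  refine Submodule.smul_mem _ _ ?_
  rw [hx, map_add, map_sum, hw]
  refine add_mem (Submodule.mem_sup_left (sum_mem fun j _ => ?_)) (Submodule.mem_sup_right
    (Submodule.smul_mem_smul (Ideal.mem_span_singleton_self _) trivial))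
  rw [map_smulₛₗ]
  exact Submodule.smul_mem _ _ (Submodule.subset_span ⟨j, rfl⟩)

/-- Since `S = 𝔖 + Fil^p S`, the `𝔖`-combinations of generators exhaust `𝓜` modulo `Fil^p S ⬝ 𝓜`. -/
lemma exists_sum_add_filTop {e : ι → N.carrier}
    (he : Submodule.span (E.S 0) (Set.range e) = ⊤) (x : N.carrier) :
    ∃ g : ι → BKRing p k, x - ∑ i, algebraMap (BKRing p k) (E.S 0) (g i) • e i ∈ filTop N := by
  obtain ⟨c, rfl⟩ := (Submodule.mem_span_range_iff_exists_fun (E.S 0)).mp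
    (show x ∈ Submodule.span (E.S 0) (Set.range e) by rw [he]; trivial)
  choose g hg using fun i => exists_add_FilS (E := E) le_rfl (c i)
  refine ⟨g, ?_⟩
  rw [← Finset.sum_sub_distrib]
  refine sum_mem fun i _ => ?_
  rw [← sub_smul]
  exact Submodule.smul_mem_smul (hg i) trivial

variable (N) in
/-- The vectors `e` and the matrix `A` over `𝔖` are such that the vectors `α = e A` are in
`Fil^r 𝓜`, are congruent to `α₀` modulo `Fil^p S ⬝ 𝓜`, and satisfy `c₀^{-r} φ_{𝓜,r}(α) = e` modulo
`p ^ n`. -/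
def IsApprox (α₀ : ι → N.carrier) (n : ℕ) (e : ι → N.carrier) (A : ι → ι → BKRing p k) : Prop :=
  ∃ α : ι → N.Fil, (∀ j, (α j : N.carrier) = ∑ i, algebraMap (BKRing p k) (E.S 0) (A i j) • e i) ∧
    (∀ j, (α j : N.carrier) - α₀ j ∈ filTop N) ∧
    ∀ j, ∃ y, phiC N (α j) - e j = (p : E.S 0) ^ n • y

lemma le_span_sup_filTop {α₀ α : ι → N.carrier}
    (h₀ : N.Fil ≤ Submodule.span (E.S 0) (Set.range α₀) ⊔ filTop N)
    (h : ∀ j, α j - α₀ j ∈ filTop N) :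
    N.Fil ≤ Submodule.span (E.S 0) (Set.range α) ⊔ filTop N := by
  refine h₀.trans (sup_le (Submodule.span_le.mpr ?_) le_sup_right)
  rintro _ ⟨j, rfl⟩
  rw [← sub_sub_cancel (α j) (α₀ j)]
  exact sub_mem (Submodule.mem_sup_left (Submodule.subset_span ⟨j, rfl⟩))
    (Submodule.mem_sup_right (h j))

lemma sum_add_mul_smul {R V : Type*} [CommRing R] [AddCommGroup V] [Module R V] (c : R) (a : ι → R)
    (U : ι → ι → R) (e : ι → V) :
    ∑ l, (a l + c * ∑ i, a i * U l i) • e l = ∑ i, a i • (e i + c • ∑ l, U l i • e l) := by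
  simp only [add_smul, smul_add, Finset.sum_add_distrib, Finset.mul_sum, Finset.sum_smul,
    Finset.smul_sum, smul_smul]
  congr 1
  rw [Finset.sum_comm]
  refine Finset.sum_congr rfl fun i _ => Finset.sum_congr rfl fun l _ => ?_
  congr 1
  ring

/-- The approximation step: replace `e` by `e' = c₀^{-r} φ_{𝓜,r}(α)`, write `e = e' (1 + p ^ n U)`
and `U = U₀ + Z` with `U₀` over `𝔖` and `Z` over `Fil^p S`, and replace `A` by `(1 + p ^ n U₀) A`. -/
lemma IsApprox.succ (hm : E.HasOrder m) (hr : r < p - 1) {α₀ : ι → N.carrier}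
    (h₀ : N.Fil ≤ Submodule.span (E.S 0) (Set.range α₀) ⊔ filTop N) {n : ℕ} {e : ι → N.carrier}
    {A : ι → ι → BKRing p k} (h : IsApprox N α₀ n e A) :
    ∃ e' A', IsApprox N α₀ (n + 1) e' A' ∧ (∀ i, ∃ y, e' i - e i = (p : E.S 0) ^ n • y) ∧
      (∀ i j, (p : BKRing p k) ^ n ∣ A' i j - A i j) ∧
      ∀ j, ∃ w ∈ filTop N, ∑ i, algebraMap (BKRing p k) (E.S 0) (A' i j) • e' i -
        ∑ i, algebraMap (BKRing p k) (E.S 0) (A i j) • e i = (p : E.S 0) ^ n • w := by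
  obtain ⟨α, hα, hα₀, hφ⟩ := h
  have hspan := span_phiC_eq_top hm hr (le_span_sup_filTop h₀ hα₀)
  choose y hy using hφ
  choose U hU using fun i => exists_sum_add_filTop hspan (-y i)
  let A' : ι → ι → BKRing p k := fun l j => A l j + (p : BKRing p k) ^ n * ∑ i, A i j * U i l
  have he : ∀ i, e i = phiC N (α i) + (p : E.S 0) ^ n • (-y i) := fun i => by
    rw [smul_neg, ← hy, ← sub_eq_add_neg, sub_sub_cancel]
  -- With these choices `e' A' - e A = p ^ n w`, where `w = -(e' Z) A` is in `Fil^p S ⬝ 𝓜`; its divided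
  -- Frobenius is divisible by `p`, which is the gain of precision.
  let w : ι → N.carrier := fun j => -∑ i, algebraMap (BKRing p k) (E.S 0) (A i j) •
    (-y i - ∑ l, algebraMap (BKRing p k) (E.S 0) (U i l) • phiC N (α l))
  have hw : ∀ j, w j ∈ filTop N := fun j =>
    neg_mem (sum_mem fun i _ => Submodule.smul_mem _ _ (hU i))
  have hdiff : ∀ j, ∑ i, algebraMap (BKRing p k) (E.S 0) (A' i j) • phiC N (α i) -
      ∑ i, algebraMap (BKRing p k) (E.S 0) (A i j) • e i = (p : E.S 0) ^ n • w j := by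
    intro j
    have h1 := sum_add_mul_smul ((p : E.S 0) ^ n)
      (fun i => algebraMap (BKRing p k) (E.S 0) (A i j))
      (fun l i => algebraMap (BKRing p k) (E.S 0) (U i l)) (fun i => phiC N (α i))
    have h2 : ∀ i, algebraMap (BKRing p k) (E.S 0) (A' i j) =
        algebraMap (BKRing p k) (E.S 0) (A i j) + (p : E.S 0) ^ n *
          ∑ l, algebraMap (BKRing p k) (E.S 0) (A l j) *
            algebraMap (BKRing p k) (E.S 0) (U l i) := by
      intro i
      simp only [A', map_add, map_mul, map_sum, map_pow, map_natCast]
    rw [Finset.sum_congr rfl fun i _ => congrArg (· • phiC N (α i)) (h2 i), h1]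
    simp only [w]
    rw [← Finset.sum_sub_distrib, smul_neg, Finset.smul_sum, ← Finset.sum_neg_distrib]
    refine Finset.sum_congr rfl fun i _ => ?_
    rw [he, ← smul_sub, smul_comm ((p : E.S 0) ^ n), ← smul_neg]
    congr 1
    rw [smul_sub]
    abel
  have hmem : ∀ j, (p : E.S 0) ^ n • w j ∈ filTop N := fun j => Submodule.smul_mem _ _ (hw j)
  refine ⟨fun i => phiC N (α i), A', ⟨fun j => α j + ⟨(p : E.S 0) ^ n • w j,
    filTop_le hr (hmem j)⟩, fun j => ?_, fun j => ?_, fun j => ?_⟩, fun i => ⟨y i, hy i⟩,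
    fun i j => ⟨∑ l, A l j * U l i, by simp only [A', add_sub_cancel_left]⟩,
    fun j => ⟨w j, hw j, hdiff j⟩⟩
  · rw [Submodule.coe_add, hα]
    exact (congrArg (_ + ·) (hdiff j).symm).trans (add_sub_cancel _ _)
  · rw [Submodule.coe_add, add_sub_right_comm]
    exact add_mem (hα₀ j) (hmem j)
  · obtain ⟨v, hv⟩ := exists_phiC_eq hm hr (z := ⟨w j, filTop_le hr (hw j)⟩) (hw j)
    have h3 : (⟨(p : E.S 0) ^ n • w j, filTop_le hr (hmem j)⟩ : N.Fil) =
      (p : E.S 0) ^ n • ⟨w j, filTop_le hr (hw j)⟩ := rfl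
    exact ⟨v, by rw [map_add, add_sub_cancel_left, h3, map_smulₛₗ, hv, map_pow, map_natCast,
      smul_smul, pow_succ]⟩

/-- The approximations converge: there are `A` over `𝔖` and `α` in `Fil^r 𝓜` with `α = e A` for
`e = c₀^{-r} φ_{𝓜,r}(α)`, and `α` still generates `Fil^r 𝓜` modulo `Fil^p S ⬝ 𝓜`. -/
lemma exists_phiC_eq_basis (hm : E.HasOrder m) (hr : r < p - 1) {α₀ : ι → N.carrier}
    (h₀ : N.Fil ≤ Submodule.span (E.S 0) (Set.range α₀) ⊔ filTop N) {e₀ : ι → N.carrier}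
    {A₀ : ι → ι → BKRing p k} (hA₀ : IsApprox N α₀ 0 e₀ A₀) :
    ∃ (A : ι → ι → BKRing p k) (α : ι → N.Fil),
      (∀ j, (α j : N.carrier) = ∑ i, algebraMap (BKRing p k) (E.S 0) (A i j) • phiC N (α i)) ∧
      N.Fil ≤ Submodule.span (E.S 0) (Set.range fun j => (α j : N.carrier)) ⊔ filTop N := by
  choose! Fe FA hF1 hF2 hF3 hF4 using fun (n : ℕ) (e : ι → N.carrier) (A : ι → ι → BKRing p k)
    (h : IsApprox N α₀ n e A) => h.succ hm hr h₀
  let s : ℕ → (ι → N.carrier) × (ι → ι → BKRing p k) := fun n =>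
    Nat.rec (e₀, A₀) (fun n x => (Fe n x.1 x.2, FA n x.1 x.2)) n
  have hs : ∀ n, s (n + 1) = (Fe n (s n).1 (s n).2, FA n (s n).1 (s n).2) := fun n => rfl
  have hA : ∀ n, IsApprox N α₀ n (s n).1 (s n).2 := by
    intro n
    induction n with
    | zero => exact hA₀
    | succ n ih => rw [hs]; exact hF1 n _ _ ih
  have he : ∀ i, ∃ L, ∀ n, ∃ y, L - (s n).1 i = (p : E.S 0) ^ n • y := fun i =>
    exists_limit_of_free (p : E.S 0) (fun n => (s n).1 i) fun n => hF2 n _ _ (hA n) i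
  have hB : ∀ i j, ∃ L, ∀ n, (p : BKRing p k) ^ n ∣ L - (s n).2 i j := fun i j =>
    exists_limit (p : BKRing p k) (fun n => (s n).2 i j) fun n => hF3 n _ _ (hA n) i j
  choose e he using he
  choose A hA' using hB
  let a : ℕ → ι → N.carrier := fun n j =>
    ∑ i, algebraMap (BKRing p k) (E.S 0) ((s n).2 i j) • (s n).1 i
  let b : ι → N.carrier := fun j => ∑ i, algebraMap (BKRing p k) (E.S 0) (A i j) • e i
  have hab : ∀ n j, ∃ y, b j - a n j = (p : E.S 0) ^ n • y := by
    intro n j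
    choose y hy using fun i => he i n
    choose c hc using fun i => hA' i j n
    refine ⟨∑ i, (algebraMap (BKRing p k) (E.S 0) (c i) • e i +
      algebraMap (BKRing p k) (E.S 0) ((s n).2 i j) • y i), ?_⟩
    rw [← Finset.sum_sub_distrib, Finset.smul_sum]
    refine Finset.sum_congr rfl fun i _ => ?_
    have h1 := congrArg (algebraMap (BKRing p k) (E.S 0)) (hc i)
    rw [map_sub, map_mul, map_pow, map_natCast] at h1
    rw [smul_add, smul_comm _ _ (y i), ← hy, smul_smul, ← h1, sub_smul, smul_sub]
    abel
  have haa : ∀ n N' j, ∃ w ∈ filTop N, a (n + N') j - a n j = (p : E.S 0) ^ n • w := by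
    intro n N' j
    induction N' with
    | zero => exact ⟨0, zero_mem _, by rw [add_zero, sub_self, smul_zero]⟩
    | succ N' ih =>
      obtain ⟨w, hw, h⟩ := ih
      obtain ⟨w', hw', h'⟩ := hF4 (n + N') _ _ (hA (n + N')) j
      refine ⟨w + (p : E.S 0) ^ N' • w', add_mem hw (Submodule.smul_mem _ _ hw'), ?_⟩
      rw [smul_add, smul_smul, ← pow_add, ← h, ← h']
      change a (n + N' + 1) j - a n j = a (n + N') j - a n j + (a (n + N' + 1) j - a (n + N') j)
      abel
  have := isDomain_S hm 0
  have hp0 := natCast_p_ne_zero hm 0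
  -- The remainder `(b - a_n) / p ^ n` is a `p`-adic limit of elements of `Fil^p S ⬝ 𝓜`.
  have hba : ∀ n j, ∃ w ∈ filTop N, b j - a n j = (p : E.S 0) ^ n • w := by
    intro n j
    obtain ⟨y, hy⟩ := hab n j
    refine ⟨y, mem_filTop_of_approx fun K => ?_, hy⟩
    obtain ⟨y', hy'⟩ := hab (n + K) j
    obtain ⟨w, hw, h⟩ := haa n K j
    refine ⟨w, hw, y', smul_left_cancel_of_free (pow_ne_zero n hp0) ?_⟩
    rw [smul_add, smul_smul, ← pow_add, ← hy, ← hy', ← h]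
    abel
  have hb : ∀ j, b j - α₀ j ∈ filTop N := by
    intro j
    obtain ⟨w, hw, h⟩ := hba 0 j
    obtain ⟨α, h1, h2, -⟩ := hA 0
    have h3 := add_mem (Submodule.smul_mem _ ((p : E.S 0) ^ 0) hw) (h2 j)
    rw [← h, h1] at h3
    change b j - a 0 j + (a 0 j - α₀ j) ∈ _ at h3
    rwa [sub_add_sub_cancel] at h3
  have hbF : ∀ j, b j ∈ N.Fil := by
    intro j
    obtain ⟨w, hw, h⟩ := hba 0 j
    obtain ⟨α, h1, -, -⟩ := hA 0
    have h3 := add_mem (filTop_le hr (Submodule.smul_mem _ ((p : E.S 0) ^ 0) hw)) (α j).2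
    rw [← h, h1] at h3
    change b j - a 0 j + a 0 j ∈ _ at h3
    rwa [sub_add_cancel] at h3
  have hφ : ∀ j, phiC N ⟨b j, hbF j⟩ = e j := by
    intro j
    rw [← sub_eq_zero]
    refine eq_zero_of_forall_eq_pow_smul (p : E.S 0) fun n => ?_
    obtain ⟨α, h1, -, h2⟩ := hA n
    obtain ⟨y, hy⟩ := h2 j
    obtain ⟨w, hw, h⟩ := hba n j
    obtain ⟨y', hy'⟩ := he j n
    have h3 : (⟨b j, hbF j⟩ : N.Fil) = α j + (p : E.S 0) ^ n • ⟨w, filTop_le hr hw⟩ := by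
      apply Subtype.ext
      change b j = (α j : N.carrier) + (p : E.S 0) ^ n • w
      rw [← h, h1]
      exact (add_sub_cancel (a n j) (b j)).symm
    refine ⟨y + phiC N ⟨w, filTop_le hr hw⟩ - y', ?_⟩
    rw [h3, map_add, map_smulₛₗ, map_pow, map_natCast, smul_sub, smul_add, ← hy, ← hy']
    abel
  refine ⟨A, fun j => ⟨b j, hbF j⟩, fun j => ?_, le_span_sup_filTop h₀ hb⟩
  simp only [hφ]
  rfl

end BreuilMod

end Approx

/-! ### Generators of submodules of `𝔖^d` -/

section Generators

variable {p : ℕ} [Fact p.Prime] {k : Type u} [Field k] [CharP k p] [PerfectRing k p]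

lemma span_p_le_jacobson_BK :
    Ideal.span {(p : BKRing p k)} ≤ (⊥ : Ideal (BKRing p k)).jacobson :=
  IsAdicComplete.le_jacobson_bot _

variable {ι : Type*} [Finite ι]

/-- The reduction modulo `p` of a submodule of `𝔖^ι`. -/
noncomputable def redSubmodule (F : Submodule (BKRing p k) (ι → BKRing p k)) :
    Submodule (PowerSeries k) (ι → PowerSeries k) where
  carrier := {w | ∃ v ∈ F, ∀ i, redBK p k (v i) = w i}
  zero_mem' := ⟨0, zero_mem _, fun i => map_zero _⟩
  add_mem' := by
    rintro _ _ ⟨v, hv, h⟩ ⟨v', hv', h'⟩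
    exact ⟨v + v', add_mem hv hv', fun i => by
      rw [Pi.add_apply, Pi.add_apply, map_add, h, h']⟩
  smul_mem' := by
    rintro c _ ⟨v, hv, h⟩
    obtain ⟨c, rfl⟩ := redBK_surjective c
    exact ⟨c • v, Submodule.smul_mem _ _ hv, fun i => by
      rw [Pi.smul_apply, Pi.smul_apply, smul_eq_mul, smul_eq_mul, map_mul, h]⟩

/-- A submodule of `𝔖^d` with `p`-torsion free quotient is generated by `d` elements, because its
reduction is a submodule of `k⟦u⟧^d`, where `k⟦u⟧` is a principal ideal domain. -/
lemma exists_generators (F : Submodule (BKRing p k) (ι → BKRing p k))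
    (hF : ∀ v, (p : BKRing p k) • v ∈ F → v ∈ F) :
    ∃ a : ι → (ι → BKRing p k), Submodule.span (BKRing p k) (Set.range a) = F := by
  cases nonempty_fintype ι
  obtain ⟨n, snf⟩ := (redSubmodule F).smithNormalForm (Pi.basisFun (PowerSeries k) ι)
  choose g hg hgr using fun i => (snf.bN i).2
  have hinj := snf.f.injective
  -- The rank `n` of the reduction may be smaller than `d`; the remaining generators are `0`.
  let a : ι → (ι → BKRing p k) := Function.extend snf.f g 0
  have ha : ∀ i, a (snf.f i) = g i := fun i => hinj.extend_apply _ _ _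
  have haF : ∀ j, a j ∈ F := by
    intro j
    by_cases hj : ∃ i, snf.f i = j
    · obtain ⟨i, rfl⟩ := hj
      rw [ha]
      exact hg i
    · have : a j = 0 := Function.extend_apply' _ _ _ hj
      rw [this]
      exact zero_mem _
  have hle : Submodule.span (BKRing p k) (Set.range a) ≤ F := by
    rw [Submodule.span_le]
    rintro _ ⟨j, rfl⟩
    exact haF j
  refine ⟨a, le_antisymm hle ?_⟩
  refine Submodule.le_of_le_smul_of_le_jacobson_bot (IsNoetherian.noetherian F)
    span_p_le_jacobson_BK fun v hv => ?_
  let w : redSubmodule F := ⟨fun i => redBK p k (v i), v, hv, fun i => rfl⟩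
  choose c hc using fun i => redBK_surjective (p := p) (snf.bN.repr w i)
  have h1 : ∀ l, redBK p k ((v - ∑ i, c i • g i) l) = 0 := by
    intro l
    have h2 : ∑ i, snf.bN.repr w i • (snf.bN i : ι → PowerSeries k) = fun i => redBK p k (v i) := by
      have h2 := congrArg Subtype.val (snf.bN.sum_repr w)
      rw [AddSubmonoidClass.coe_finsetSum] at h2
      exact h2
    have h3 := congrFun h2 l
    rw [Finset.sum_apply] at h3
    rw [Pi.sub_apply, Finset.sum_apply, map_sub, map_sum, ← h3, sub_eq_zero]
    refine Finset.sum_congr rfl fun i _ => ?_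
    rw [Pi.smul_apply, Pi.smul_apply, smul_eq_mul, smul_eq_mul, map_mul, hc, hgr]
  choose y hy using fun l => redBK_eq_zero_iff.mp (h1 l)
  have h2 : v - ∑ i, c i • g i = (p : BKRing p k) • y := funext hy
  have h3 : v = ∑ i, c i • g i + (p : BKRing p k) • y := by rw [← h2, add_sub_cancel]
  rw [h3]
  refine add_mem (Submodule.mem_sup_left (sum_mem fun i _ => Submodule.smul_mem _ _
    (Submodule.subset_span ⟨snf.f i, ha i⟩))) (Submodule.mem_sup_right
    (Submodule.smul_mem_smul (Ideal.mem_span_singleton_self _) (hF y ?_)))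
  rw [← h2]
  exact sub_mem hv (sum_mem fun i _ => Submodule.smul_mem _ _ (hg i))

end Generators

/-! ### Descent of quasi-Breuil modules to `𝔖` -/

section Descent

variable {p : ℕ} [Fact p.Prime] {k : Type u} [Field k] [CharP k p] [PerfectRing k p]
variable {E : NormalizedPoly p k} {r m : ℕ}

open NormalizedPoly

namespace BreuilMod

variable {N : BreuilMod E r} {ι : Type u} [Fintype ι]

/-- The map `𝔖^ι → 𝓜` with values `e` on the standard basis. -/
noncomputable def comb (e : ι → N.carrier) :
    (ι → BKRing p k) →ₛₗ[algebraMap (BKRing p k) (E.S 0)] N.carrier where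
  toFun v := ∑ i, algebraMap (BKRing p k) (E.S 0) (v i) • e i
  map_add' v w := by simp only [Pi.add_apply, map_add, add_smul, Finset.sum_add_distrib]
  map_smul' c v := by
    simp only [Pi.smul_apply, smul_eq_mul, map_mul, mul_smul, Finset.smul_sum]

lemma comb_apply (e : ι → N.carrier) (v : ι → BKRing p k) :
    comb e v = ∑ i, algebraMap (BKRing p k) (E.S 0) (v i) • e i := rfl

lemma comb_single [DecidableEq ι] (e : ι → N.carrier) (i : ι) : comb e (Pi.single i 1) = e i := by
  rw [comb_apply, Finset.sum_eq_single i]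
  · rw [Pi.single_eq_same, map_one, one_smul]
  · intro j _ hj
    rw [Pi.single_eq_of_ne hj, map_zero, zero_smul]
  · intro h
    exact (h (Finset.mem_univ i)).elim

lemma repr_comb (b : Module.Basis ι (E.S 0) N.carrier) (v : ι → BKRing p k) (i : ι) :
    b.repr (comb b v) i = algebraMap (BKRing p k) (E.S 0) (v i) := by
  rw [comb_apply, Module.Basis.repr_sum_self]

lemma comb_injective (hm : E.HasOrder m) (b : Module.Basis ι (E.S 0) N.carrier) :
    Function.Injective (comb b) := fun v w h => funext fun i =>
  algebraMap_S_injective hm 0 (by rw [← repr_comb b, h, repr_comb])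

lemma mem_Fil_of_smul_mem {x : N.carrier} (hx : (p : E.S 0) • x ∈ N.Fil) : x ∈ N.Fil := by
  have := N.torsionFree (Submodule.Quotient.mk x) (by
    rw [← Submodule.Quotient.mk_smul, Submodule.Quotient.mk_eq_zero]
    exact hx)
  rwa [Submodule.Quotient.mk_eq_zero] at this

/-- The submodule `Fil^r 𝓜 ∩ 𝔖^ι`, for a basis of `𝓜`. -/
noncomputable def filComb (e : ι → N.carrier) : Submodule (BKRing p k) (ι → BKRing p k) :=
  N.Fil.comap (comb e)

lemma mem_filComb_of_smul_mem (e : ι → N.carrier) (v : ι → BKRing p k)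
    (hv : (p : BKRing p k) • v ∈ filComb e) : v ∈ filComb e := by
  refine mem_Fil_of_smul_mem ?_
  have h : comb e ((p : BKRing p k) • v) ∈ N.Fil := hv
  rwa [map_smulₛₗ, map_natCast] at h

lemma ser_pow_smul_mem_filComb (e : ι → N.carrier) {M : ℕ} (hM : r ≤ M) (v : ι → BKRing p k) :
    E.ser ^ M • v ∈ filComb e := by
  change comb e (E.ser ^ M • v) ∈ N.Fil
  rw [map_smulₛₗ, map_pow]
  exact N.smul_mem_Fil (FilS_mono hM E.inS_pow_mem) _

/-- A basis of `𝓜` such that the normalized divided Frobenius of `𝓜` descends to the `𝔖`-lattice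
it generates. -/
structure IsDescent (b : Module.Basis ι (E.S 0) N.carrier) : Prop where
  exists_eq : ∀ v : filComb b, ∃ w, comb b w = phiC N ⟨comb b v, v.2⟩
  exists_phiC_eq : ∀ i, ∃ v : filComb b, phiC N ⟨comb b v, v.2⟩ = b i

/-- The filtered Breuil–Kisin module generated by a suitable basis of `𝓜`. -/
noncomputable def descend (hm : E.HasOrder m) {b : Module.Basis ι (E.S 0) N.carrier}
    (h : IsDescent b) : BKMod E r where
  carrier := ι → BKRing p k
  Fil := filComb b
  smul_top_le := Submodule.smul_le.mpr fun s hs v _ => by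
    obtain ⟨c, rfl⟩ := Ideal.mem_span_singleton.mp hs
    rw [mul_smul]
    exact ser_pow_smul_mem_filComb b le_rfl _
  torsionFree := fun x hx => by
    obtain ⟨x, rfl⟩ := Submodule.Quotient.mk_surjective _ x
    rw [← Submodule.Quotient.mk_smul, Submodule.Quotient.mk_eq_zero] at hx
    rw [Submodule.Quotient.mk_eq_zero]
    exact mem_filComb_of_smul_mem _ _ hx
  phiR :=
    { toFun := fun v => (h.exists_eq v).choose
      map_add' := fun v w => comb_injective hm b (by
        rw [map_add, (h.exists_eq _).choose_spec, (h.exists_eq v).choose_spec,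
          (h.exists_eq w).choose_spec, ← map_add]
        congr 1
        exact Subtype.ext (map_add (comb b) _ _))
      map_smul' := fun c v => comb_injective hm b (by
        rw [map_smulₛₗ, (h.exists_eq _).choose_spec, (h.exists_eq v).choose_spec,
          ← frobS_algebraMap, ← map_smulₛₗ]
        congr 1
        exact Subtype.ext ((comb b).map_smulₛₗ _ _)) }
  span_range_phiR := by
    classical
    rw [eq_top_iff, ← (Pi.basisFun (BKRing p k) ι).span_eq]
    refine Submodule.span_mono ?_
    rintro _ ⟨i, rfl⟩
    obtain ⟨v, hv⟩ := h.exists_phiC_eq i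
    refine ⟨v, comb_injective hm b ?_⟩
    rw [Pi.basisFun_apply, comb_single]
    exact (h.exists_eq v).choose_spec.trans hv

lemma comb_phi_descend (hm : E.HasOrder m) {b : Module.Basis ι (E.S 0) N.carrier}
    (h : IsDescent b) (v : ι → BKRing p k) :
    comb b (BKMod.phi (descend hm h) v) = BreuilMod.phi N (comb b v) := by
  have h1 : E.ser ^ r • v ∈ filComb b := ser_pow_smul_mem_filComb b le_rfl v
  have h2 : comb b (BKMod.phi (descend hm h) v) = phiC N ⟨comb b (E.ser ^ r • v), h1⟩ :=
    (h.exists_eq ⟨E.ser ^ r • v, h1⟩).choose_spec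
  have h3 : comb b (E.ser ^ r • v) = E.inS ^ r • comb b v := by
    rw [map_smulₛₗ, map_pow]
    rfl
  have h4 : (⟨comb b (E.ser ^ r • v), h1⟩ : N.Fil) =
    ⟨E.inS ^ r • comb b v, N.smul_mem_Fil E.inS_pow_mem _⟩ := Subtype.ext h3
  rw [h2, h4]
  rfl

/-- The linear equivalence `S ⊗ 𝔖^ι ≃ 𝓜` given by a basis. -/
noncomputable def descendEquiv (b : Module.Basis ι (E.S 0) N.carrier) :
    E.S 0 ⊗[BKRing p k] (ι → BKRing p k) ≃ₗ[E.S 0] N.carrier :=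
  ((Pi.basisFun (BKRing p k) ι).baseChange (E.S 0)).equiv b (Equiv.refl ι)

lemma descendEquiv_tmul (b : Module.Basis ι (E.S 0) N.carrier) (s : E.S 0) (v : ι → BKRing p k) :
    descendEquiv b (s ⊗ₜ v) = s • comb b v := by
  classical
  have h1 : ∀ i, descendEquiv b (1 ⊗ₜ Pi.single i 1) = b i := by
    intro i
    have h := ((Pi.basisFun (BKRing p k) ι).baseChange (E.S 0)).equiv_apply i b (Equiv.refl ι)
    rwa [Module.Basis.baseChange_apply, Pi.basisFun_apply] at h
  have h2 : (s ⊗ₜ v : E.S 0 ⊗[BKRing p k] (ι → BKRing p k)) =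
      ∑ i, (s * algebraMap (BKRing p k) (E.S 0) (v i)) • (1 ⊗ₜ Pi.single i 1) := by
    conv_lhs => rw [← (Pi.basisFun (BKRing p k) ι).sum_repr v, TensorProduct.tmul_sum]
    refine Finset.sum_congr rfl fun i _ => ?_
    rw [Pi.basisFun_repr, Pi.basisFun_apply, TensorProduct.tmul_smul, TensorProduct.smul_tmul',
      TensorProduct.smul_tmul', Algebra.smul_def, smul_eq_mul, mul_one, mul_comm]
  rw [h2, map_sum, comb_apply, Finset.smul_sum]
  refine Finset.sum_congr rfl fun i _ => ?_
  rw [map_smul, h1, mul_smul]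

lemma descendEquiv_frobB (hm : E.HasOrder m) {b : Module.Basis ι (E.S 0) N.carrier}
    (h : IsDescent b) (x : E.S 0 ⊗[BKRing p k] (ι → BKRing p k)) :
    descendEquiv b (frobB (descend hm h) x) = BreuilMod.phi N (descendEquiv b x) := by
  induction x with
  | zero =>
    rw [map_zero (descendEquiv b), map_zero (BreuilMod.phi N)]
    exact (congrArg (descendEquiv b) (map_zero (frobB (descend hm h)))).trans (map_zero _)
  | add x y hx hy =>
    rw [map_add (descendEquiv b), map_add (BreuilMod.phi N), ← hx, ← hy]
    exact (congrArg (descendEquiv b) (map_add (frobB (descend hm h)) x y)).trans (map_add _ _ _)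
  | tmul s v =>
    refine (descendEquiv_tmul b _ _).trans ?_
    rw [descendEquiv_tmul, map_smulₛₗ, ← comb_phi_descend hm h]
    rfl

lemma descendEquiv_mem_Fil (hm : E.HasOrder m) (hr : r < p - 1)
    {b : Module.Basis ι (E.S 0) N.carrier} (h : IsDescent b)
    (x : E.S 0 ⊗[BKRing p k] (ι → BKRing p k)) :
    x ∈ filB (descend hm h) ↔ descendEquiv b x ∈ N.Fil := by
  have h1 : ∀ x ∈ filB (descend hm h), descendEquiv b x ∈ N.Fil := by
    intro x hx
    unfold filB at hx
    induction hx using Submodule.span_induction with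
    | mem x hx =>
      obtain ⟨s, v, hv, rfl⟩ | ⟨s, hs, v, rfl⟩ := hx
      · exact (descendEquiv_tmul b s v).symm ▸ Submodule.smul_mem _ s hv
      · exact (descendEquiv_tmul b s v).symm ▸ N.smul_mem_Fil hs _
    | zero => exact (map_zero (descendEquiv b)).symm ▸ zero_mem _
    | add x y _ _ hx hy => exact (map_add (descendEquiv b) x y).symm ▸ add_mem hx hy
    | smul s x _ hx => exact (map_smul (descendEquiv b) s x).symm ▸ Submodule.smul_mem _ s hx
  refine ⟨h1 x, fun hx => ?_⟩
  obtain ⟨v, hv⟩ : ∃ v : ι → BKRing p k, (x - 1 ⊗ₜ v : E.S 0 ⊗[BKRing p k] (ι → BKRing p k)) ∈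
    filP (descend hm h) := exists_tmul_add_filP (M := descend hm h) x
  have h2 := h1 _ (filP_le hr hv)
  have h3 : descendEquiv b (1 ⊗ₜ v) ∈ N.Fil := by
    have h4 := sub_mem hx h2
    have h8 : descendEquiv b (x - 1 ⊗ₜ v) = descendEquiv b x - descendEquiv b (1 ⊗ₜ v) :=
      map_sub (descendEquiv b) x (1 ⊗ₜ v)
    rwa [h8, sub_sub_cancel] at h4
  have h5 : v ∈ filComb b := by
    have h6 := descendEquiv_tmul b 1 v
    rw [one_smul] at h6
    rw [h6] at h3
    exact h3
  have h7 := add_mem (filP_le hr hv) (one_tmul_mem_Fil (M := descend hm h) h5)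
  have h8 : (x - 1 ⊗ₜ v : E.S 0 ⊗[BKRing p k] (ι → BKRing p k)) + 1 ⊗ₜ v = x :=
    sub_add_cancel x _
  exact h8 ▸ h7

/-- The base change of the descended module is `𝓜`. -/
noncomputable def descendIso (hB : BaseChangeIsBreuil E r) (hm : E.HasOrder m) (hr : r < p - 1)
    {b : Module.Basis ι (E.S 0) N.carrier} (h : IsDescent b) : bc hB (descend hm h) ≅ N :=
  FilteredPhiModule.isoOfEquiv (M := bc hB (descend hm h)) (descendEquiv b)
    (descendEquiv_mem_Fil hm hr h) fun x => by
      have := isDomain_S hm 0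
      refine smul_left_cancel_of_free (pow_ne_zero r (natCast_p_ne_zero hm 0)) ?_
      rw [← BreuilMod.phi_of_mem]
      refine Eq.trans ?_ (descendEquiv_frobB hm h _)
      refine ((descendEquiv b).map_smul _ _).symm.trans (congrArg (descendEquiv b) ?_)
      exact (hB (descend hm h)).smul_divided_phiR x

lemma ser_mem_jacobson : Ideal.span {E.ser} ≤ (⊥ : Ideal (BKRing p k)).jacobson := by
  rw [IsLocalRing.jacobson_eq_maximalIdeal ⊥ bot_ne_top, Ideal.span_singleton_le_iff_mem,
    IsLocalRing.mem_maximalIdeal, mem_nonunits_iff, PowerSeries.isUnit_iff_constantCoeff]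
  have h := E.constantCoeff_elt 0
  rw [elt_zero] at h
  rw [h]
  exact (WittVector.irreducible p).not_isUnit

/-- If the vectors `α` with coordinates in `𝔖` generate `Fil^r 𝓜` modulo `Fil^p S ⬝ 𝓜`, their
coordinates generate `Fil^r 𝓜 ∩ 𝔖^ι`: the error is in `E ^ p 𝔖^ι`, hence in `E (Fil^r 𝓜 ∩ 𝔖^ι)`,
and Nakayama's lemma for `E` applies. -/
lemma filComb_le_span (hm : E.HasOrder m) (hr : r < p - 1)
    (b : Module.Basis ι (E.S 0) N.carrier) {a : ι → ι → BKRing p k}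
    (h : N.Fil ≤ Submodule.span (E.S 0) (Set.range fun j => comb b (a j)) ⊔ filTop N) :
    filComb b ≤ Submodule.span (BKRing p k) (Set.range a) := by
  refine Submodule.le_of_le_smul_of_le_jacobson_bot (IsNoetherian.noetherian _)
    (ser_mem_jacobson (E := E)) fun v hv => ?_
  obtain ⟨y, hy, z, hz, hyz⟩ := Submodule.mem_sup.mp (h hv)
  obtain ⟨c, rfl⟩ := (Submodule.mem_span_range_iff_exists_fun _).mp hy
  choose g hg using fun j => exists_add_FilS (E := E) le_rfl (c j)
  have h1 : comb b (v - ∑ j, g j • a j) ∈ filTop N := by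
    have h2 : comb b (v - ∑ j, g j • a j) =
        ∑ j, (c j - algebraMap (BKRing p k) (E.S 0) (g j)) • comb b (a j) + z := by
      rw [map_sub, map_sum, ← hyz]
      simp only [sub_smul, Finset.sum_sub_distrib, map_smulₛₗ]
      abel
    rw [h2]
    exact add_mem (sum_mem fun j _ => Submodule.smul_mem_smul (hg j) trivial) hz
  rw [filTop, mem_smul_top_iff_repr b] at h1
  have h2 : ∀ i, E.ser ^ p ∣ (v - ∑ j, g j • a j) i := fun i => by
    have h3 := h1 i
    rw [repr_comb] at h3
    have h4 := pow_dvd_of_mem_FilS hm le_rfl h3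
    rwa [elt_zero] at h4
  choose w hw using h2
  have h3 : v = ∑ j, g j • a j + E.ser • (E.ser ^ (p - 1) • w) := by
    rw [smul_smul, ← pow_succ', Nat.sub_add_cancel (Fact.out : p.Prime).one_le]
    rw [← sub_eq_iff_eq_add']
    exact funext hw
  rw [h3]
  exact add_mem (Submodule.mem_sup_left (sum_mem fun j _ => Submodule.smul_mem _ _
    (Submodule.subset_span ⟨j, rfl⟩))) (Submodule.mem_sup_right (Submodule.smul_mem_smul
    (Ideal.mem_span_singleton_self _) (ser_pow_smul_mem_filComb _ hr.le _)))

/-- A generating family of `𝓜` whose size is the rank is a basis. -/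
lemma exists_basis_eq {e : ι → N.carrier} (b : Module.Basis ι (E.S 0) N.carrier)
    (he : Submodule.span (E.S 0) (Set.range e) = ⊤) :
    ∃ b' : Module.Basis ι (E.S 0) N.carrier, ∀ i, b' i = e i := by
  let T : N.carrier →ₗ[E.S 0] N.carrier := b.constr (E.S 0) e
  have hT : Function.Surjective T := by
    rw [← LinearMap.range_eq_top, Module.Basis.constr_range, he]
  let T' := LinearEquiv.ofBijective T ⟨OrzechProperty.injective_of_surjective_endomorphism T hT, hT⟩
  exact ⟨b.map T', fun i => by
    rw [Module.Basis.map_apply]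
    exact b.constr_basis (E.S 0) e i⟩

/-- The fixed point of the approximation is a basis for which the divided Frobenius descends: the
coordinates of `α` generate `Fil^r 𝓜 ∩ 𝔖^ι`, and the divided Frobenius of `α` is the basis. -/
lemma exists_isDescent (hm : E.HasOrder m) (hr : r < p - 1) (N : BreuilMod E r) :
    ∃ b : Module.Basis (Module.Free.ChooseBasisIndex (E.S 0) N.carrier) (E.S 0) N.carrier,
      IsDescent b := by
  let b₀ := Module.Free.chooseBasis (E.S 0) N.carrier
  obtain ⟨a₀, ha₀⟩ := exists_generators (filComb b₀) (mem_filComb_of_smul_mem b₀)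
  have haF : ∀ j, comb b₀ (a₀ j) ∈ N.Fil := fun j =>
    ha₀.le (Submodule.subset_span ⟨j, rfl⟩)
  have h₀ : N.Fil ≤ Submodule.span (E.S 0) (Set.range fun j => comb b₀ (a₀ j)) ⊔ filTop N := by
    intro x hx
    obtain ⟨g, hg⟩ := exists_sum_add_filTop b₀.span_eq x
    have h1 : g ∈ filComb b₀ := by
      have h2 := sub_mem hx (filTop_le hr hg)
      rwa [sub_sub_cancel] at h2
    rw [← ha₀] at h1
    obtain ⟨c, hc⟩ := (Submodule.mem_span_range_iff_exists_fun _).mp h1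
    rw [← sub_add_cancel x (comb b₀ g)]
    refine add_mem (Submodule.mem_sup_right hg) (Submodule.mem_sup_left ?_)
    rw [← hc, map_sum]
    refine sum_mem fun j _ => ?_
    rw [map_smulₛₗ]
    exact Submodule.smul_mem _ _ (Submodule.subset_span ⟨j, rfl⟩)
  obtain ⟨A, α, hα, hle⟩ := exists_phiC_eq_basis hm hr h₀ (e₀ := b₀) (A₀ := fun i j => a₀ j i)
    ⟨fun j => ⟨comb b₀ (a₀ j), haF j⟩, fun j => rfl, fun j => by rw [sub_self]; exact zero_mem _,
      fun j => ⟨_, by rw [pow_zero, one_smul]⟩⟩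
  obtain ⟨b, hb⟩ := exists_basis_eq b₀ (span_phiC_eq_top hm hr hle)
  have hα' : ∀ j, comb b (fun i => A i j) = α j := fun j => by
    rw [hα, comb_apply]
    exact Finset.sum_congr rfl fun i _ => by rw [hb]
  have hspan := filComb_le_span hm hr b (a := fun j i => A i j) (by simpa only [hα'] using hle)
  refine ⟨b, ⟨fun v => ?_, fun j => ?_⟩⟩
  · obtain ⟨c, hc⟩ := (Submodule.mem_span_range_iff_exists_fun _).mp (hspan v.2)
    refine ⟨fun j => frobBK p k (c j), ?_⟩
    have h1 : (⟨comb b v, v.2⟩ : N.Fil) =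
        ∑ j, algebraMap (BKRing p k) (E.S 0) (c j) • α j := by
      apply Subtype.ext
      rw [AddSubmonoidClass.coe_finsetSum]
      change comb b v = _
      rw [← hc, map_sum]
      refine Finset.sum_congr rfl fun j _ => ?_
      rw [map_smulₛₗ, hα']
      rfl
    rw [h1, map_sum, comb_apply]
    refine Finset.sum_congr rfl fun j _ => ?_
    rw [map_smulₛₗ, frobS_algebraMap, hb]
  · have h1 : comb b (fun i => A i j) ∈ N.Fil := by
      rw [hα']
      exact (α j).2
    refine ⟨⟨fun i => A i j, h1⟩, ?_⟩
    rw [hb]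
    congr 1
    exact Subtype.ext (hα' j)

end BreuilMod

/-- Every quasi-Breuil module is the base change of a filtered Breuil–Kisin module. -/
theorem exists_bc_iso (hB : BaseChangeIsBreuil E r) (hm : E.HasOrder m) (hr : r < p - 1)
    (N : BreuilMod E r) : ∃ M : BKMod E r, Nonempty (bc hB M ≅ N) := by
  obtain ⟨b, hb⟩ := BreuilMod.exists_isDescent hm hr N
  exact ⟨_, ⟨BreuilMod.descendIso hB hm hr hb⟩⟩

end Descent

end BreuilKisin

theorem mainTheorem2 {p : ℕ} [Fact p.Prime] (hp : 2 < p)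
    {k : Type*} [Field k] [CharP k p] [PerfectRing k p]
    {O : Type*} [CommRing O] [IsDomain O] [IsDiscreteValuationRing O] [Algebra (WittVector p k) O]
    (hO : BreuilKisin.IsTotallyRamified p k O) (π₀ : O) (hπ₀ : Irreducible π₀)
    (E : BreuilKisin.NormalizedPoly p k) (hE : E.IsMinpoly π₀) (r : ℕ) (hr : r < p - 1) :
    ∃ (hB : BreuilKisin.BaseChangeIsBreuil E r) (hL : BreuilKisin.LimIsBK E r),
      Nonempty (BreuilKisin.baseChangeFunctor hB ⋙ BreuilKisin.limFunctor hL ≅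
        𝟭 (BreuilKisin.BKMod E r)) ∧
      Nonempty (BreuilKisin.limFunctor hL ⋙ BreuilKisin.baseChangeFunctor hB ≅
        𝟭 (BreuilKisin.BreuilMod E r)) := by
  have := hO.finite
  obtain ⟨m, hm⟩ := BreuilKisin.NormalizedPoly.exists_hasOrder
    (Algebra.IsIntegral.isIntegral (R := WittVector p k) π₀) hE
  have hB := BreuilKisin.baseChangeIsBreuil hm hr
  have hS := BreuilKisin.exists_bc_iso hB hm hr
  have hL := BreuilKisin.limIsBK hB hm hr hS
  have : (BreuilKisin.limFunctor hL).Faithful := BreuilKisin.limFunctor_faithful hB hL hm hr hS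
  have : (BreuilKisin.baseChangeFunctor hB).EssSurj := ⟨hS⟩
  exact ⟨hB, hL, ⟨BreuilKisin.compLimIso hB hL hm hr⟩,
    BreuilKisin.nonempty_comp_iso_id (BreuilKisin.compLimIso hB hL hm hr)⟩
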